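/- Let $k$ be a field, $q\in k^\times$ and $e\ge 0$ an integer. **Quantum matrices.** For $n\ge 1$ let $V_n$ have basis $v_1,\dots,v_n$ and let $R_n:V_n\otimes V_n\to V_n\otimes V_n$ be given by $R_n(v_i\otimes v_j)=v_j\otimes v_i$ if $i<j$, $=q\,v_i\otimes v_j$ if $i=j$, and $=(q-q^{-1})v_i\otimes v_j+v_j\otimes v_i$ if $i>j$; write $R_n(v_i\otimes v_j)=\sum_{p,r}(R_n)^{pr}_{ij}\,v_p\otimes v_r$. Let $A_q(n,n)$ be the $k$-bialgebra generated by $x_{ij}$ ($1\le i,j\le n$) with relations $\sum_{a,b}(R_n)^{pr}_{ab}x_{ai}x_{bj}=\sum_{a,b}(R_n)^{ab}_{ij}x_{pa}x_{rb}$, with $\Delta(x_{ij})=\sum_c x_{ic}\otimes x_{cj}$ and $\varepsilon(x_{ij})=\delta_{ij}$, graded by $\deg x_{ij}=1$. Let $\mathcal R:A_q(n,n)\otimes A_q(n,n)\to k$ be its coquasitriangular form, i.e. the linear map with $\mathcal R(x_{ij}\otimes x_{kl})=(R_n)^{ik}_{lj}$, $\mathcal R(1,a)=\mathcal R(a,1)=\varepsilon(a)$,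 $\mathcal R(ab,c)=\mathcal R(a,c_{(2)})\mathcal R(b,c_{(1)})$ and $\mathcal R(a,bc)=\mathcal R(a_{(1)},b)\mathcal R(a_{(2)},c)$. For right $A_q(n,n)$-comodules $M,N$ put $$R_{M,N}:M\otimes N\to N\otimes M,\qquad x\otimes y\mapsto \mathcal R(y_{(1)},x_{(1)})\;y_{(0)}\otimes x_{(0)}.$$ **Quantum polynomial functors.** An $e$-Hecke pair is a finite dimensional $A_q(n,n)$-comodule $V$, for some $n\ge1$, whose coaction takes values in $V\otimes A_q(n,n)_e$. The braid group $B_d$ acts on $V^{\otimes d}$ through $R_V:=R_{V,V}$. For $d\ge 0$, $\Gamma^d_{q,e}$ is the $k$-linear category of all $e$-Hecke pairs (for all $n\ge 1$) with $\operatorname{Hom}(V,W)=\operatorname{Hom}_{B_d}(V^{\otimes d},W^{\otimes d})$, and $\mathcal P^d_{q,e}$ is the category of $k$-linear functors from $\Gamma^d_{q,e}$ to finite dimensional vector spaces, with natural transformations as morphisms. Let $\mathcal P_{q,e}=\bigoplus_{d\ge0}\mathcal P^d_{q,e}$: an object is a family $F=(F_d)_{d\ge 0}$, $F_d\in\mathcal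 P^d_{q,e}$, with $F_d=0$ for all but finitely many $d$, and a morphism is a family of morphisms. It is a monoidal category with $$(F\otimes G)_d(V)=\bigoplus_{a+b=d}F_a(V)\otimes G_b(V),$$ where morphisms act through the restriction $\operatorname{Hom}_{B_d}(V^{\otimes d},W^{\otimes d})\to\operatorname{Hom}_{B_a}(V^{\otimes a},W^{\otimes a})\otimes\operatorname{Hom}_{B_b}(V^{\otimes b},W^{\otimes b})$ along $B_a\times B_b\subset B_d$, with unit $I$ the constant functor $k$ in degree $0$, and with the usual associativity isomorphisms and unit isomorphisms $l_F:I\otimes F\to F$, $r_F:F\otimes I\to F$. If $F\in\mathcal P^d_{q,e}$ and $V$ is an $e$-Hecke pair over $A_q(n,n)$, then $F(V)$ is an $A_q(n,n)$-comodule: the coaction of $V^{\otimes d}$ is $z\mapsto\sum_i f_i(z)\otimes a_i$ for a unique element $\sum_i f_i\otimes a_i$ of $\operatorname{End}_{B_d}(V^{\otimes d})\otimes A_q(n,n)$, and the coaction of $F(V)$ is $x\mapsto\sum_i F(f_i)(x)\otimes a_i$. **Theorem 4.4.** The monoidal category $(\mathcal P_{q,e},\otimes)$ is braided, with braiding $R_{F,G}:F\otimes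 G\to G\otimes F$ given at each $e$-Hecke pair $V$ by $R_{F(V),G(V)}$. That is, for all $F,G\in\mathcal P_{q,e}$ there is an isomorphism $R_{F,G}:F\otimes G\to G\otimes F$ in $\mathcal P_{q,e}$ which, at every $V$ and for all $a,b\ge0$, is on the summand $F_a(V)\otimes G_b(V)$ the map $R_{F_a(V),G_b(V)}:F_a(V)\otimes G_b(V)\to G_b(V)\otimes F_a(V)$; these isomorphisms are natural in $F$ and $G$, satisfy both hexagon axioms (up to the associativity isomorphisms, $R_{F\otimes G,H}=(R_{F,H}\otimes1)(1\otimes R_{G,H})$ and $R_{F,G\otimes H}=(1\otimes R_{F,H})(R_{F,G}\otimes 1)$), and satisfy the unit axioms $l_F\circ R_{F,I}=r_F$ and $r_F\circ R_{I,F}=l_F$. -/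

import Mathlib

open scoped TensorProduct
open CategoryTheory

noncomputable section

namespace QuantumPoly

universe u

/-- The coefficients `(R_n)^{pr}_{ij}` of the `R`-matrix of the defining representation:
`R_n (v_i ⊗ v_j) = ∑ (R_n)^{pr}_{ij} v_p ⊗ v_r` is `v_j ⊗ v_i` if `i < j`, `q v_i ⊗ v_j` if `i = j`
and `(q - q⁻¹) v_i ⊗ v_j + v_j ⊗ v_i` if `i > j`. -/
def stdR {k : Type u} [Field k] (q : kˣ) (n : ℕ) (p r i j : Fin n) : k :=
  if i < j then (if p = j ∧ r = i then 1 else 0)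
  else if i = j then (if p = i ∧ r = j then (q : k) else 0)
  else (if p = i ∧ r = j then (q : k) - (q : k)⁻¹ else 0) + (if p = j ∧ r = i then 1 else 0)

section FRT

variable {k : Type u} [Field k] {ι : Type} [Fintype ι] [DecidableEq ι]

/-- The braid form of the Yang-Baxter equation `R₁₂ R₂₃ R₁₂ = R₂₃ R₁₂ R₂₃` in coefficients, where
`R (v_i ⊗ v_j) = ∑ R p r i j • v_p ⊗ v_r`. -/
def YangBaxter (R : ι → ι → ι → ι → k) : Prop :=
  ∀ s i j p r t : ι,
    (∑ a, ∑ b, ∑ c, R p r a c * (R a b s i * R c t b j)) =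
      ∑ a, ∑ b, ∑ c, R a c i j * (R p b s a * R r t b c)

theorem stdR_eq (q : kˣ) (n : ℕ) (p r i j : Fin n) :
    stdR q n p r i j =
      (if i = j then (q : k) else 1) * (Pi.single j 1 : Fin n → k) p * (Pi.single i 1 : Fin n → k) r +
      (if j < i then (q : k) - (q : k)⁻¹ else 0) * (Pi.single i 1 : Fin n → k) p *
        (Pi.single j 1 : Fin n → k) r := by
  unfold stdR
  rcases lt_trichotomy i j with h | h | h
  · simp [h, h.ne, h.not_gt, ite_and, Pi.single_apply]
    split_ifs <;> rfl
  · subst h; simp [ite_and, Pi.single_apply]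
    split_ifs <;> rfl
  · simp only [h, h.ne', h.not_gt, ite_and, Pi.single_apply, if_true, if_false]
    split_ifs <;> simp [add_comm]

theorem stdR_sum (q : kˣ) (n : ℕ) (i j : Fin n) (f : Fin n → Fin n → k) :
    ∑ a, ∑ c, stdR q n a c i j * f a c = (if i = j then (q : k) else 1) * f j i +
      (if j < i then (q : k) - (q : k)⁻¹ else 0) * f i j := by
  simp [stdR_eq, add_mul, Finset.sum_add_distrib, Pi.single_apply]

theorem stdR_sum' (q : kˣ) (n : ℕ) (i j r : Fin n) (f : Fin n → k) :
    ∑ a, stdR q n a r i j * f a = (if i = j then (q : k) else 1) * (Pi.single i 1 : Fin n → k) r * f j +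
      (if j < i then (q : k) - (q : k)⁻¹ else 0) * (Pi.single j 1 : Fin n → k) r * f i := by
  simp [stdR_eq, add_mul, Finset.sum_add_distrib, Pi.single_apply]

theorem stdR_sum'' (q : kˣ) (n : ℕ) (i j r : Fin n) (f : Fin n → k) :
    ∑ a, stdR q n r a i j * f a = (if i = j then (q : k) else 1) * (Pi.single j 1 : Fin n → k) r * f i +
      (if j < i then (q : k) - (q : k)⁻¹ else 0) * (Pi.single i 1 : Fin n → k) r * f j := by
  simp [stdR_eq, add_mul, Finset.sum_add_distrib, Pi.single_apply]

set_option maxHeartbeats 1000000 in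
theorem stdR_yangBaxter (q : kˣ) (n : ℕ) : YangBaxter (stdR q n) := by
  intro s i j p r t
  have hq : (q : k) * (q : k)⁻¹ = 1 := mul_inv_cancel₀ q.ne_zero
  have h1 : (∑ a, ∑ b, ∑ c, stdR q n p r a c * (stdR q n a b s i * stdR q n c t b j)) =
      ∑ a, ∑ b, stdR q n a b s i * ∑ c, stdR q n c t b j * stdR q n p r a c := by
    simp only [Finset.mul_sum]
    refine Finset.sum_congr rfl fun a _ => Finset.sum_congr rfl fun b _ =>
      Finset.sum_congr rfl fun c _ => by ring
  have h2 : (∑ a, ∑ b, ∑ c, stdR q n a c i j * (stdR q n p b s a * stdR q n r t b c)) =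
      ∑ a, ∑ c, stdR q n a c i j * ∑ b, stdR q n p b s a * stdR q n r t b c := by
    refine Finset.sum_congr rfl fun a _ => ?_
    rw [Finset.sum_comm]
    refine Finset.sum_congr rfl fun c _ => ?_
    rw [Finset.mul_sum]
  rw [h1, h2, stdR_sum, stdR_sum]
  clear h1 h2
  simp only [stdR_sum', stdR_sum'']
  simp only [stdR_eq]
  generalize (q : k)⁻¹ = q' at *
  rcases lt_trichotomy s i with h | h | h <;> rcases lt_trichotomy i j with h' | h' | h' <;>
    rcases lt_trichotomy s j with h'' | h'' | h'' <;>
    first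
    | (exfalso; order)
    | ((try subst h) <;> (try subst h') <;> (try subst h'') <;>
        simp only [*, lt_irrefl, LT.lt.ne, LT.lt.ne', LT.lt.not_gt, if_true, if_false] <;>
        first
        | ring1
        | linear_combination ((Pi.single s 1 : Fin n → k) r * (Pi.single s 1 : Fin n → k) p *
            (Pi.single j 1 : Fin n → k) t * (q - q')) * hq
        | linear_combination (-(Pi.single i 1 : Fin n → k) r * (Pi.single i 1 : Fin n → k) t *
            (Pi.single s 1 : Fin n → k) p * (q - q')) * hq)

end FRT

section FRT

variable {k : Type u} [Field k] {ι : Type} [Fintype ι]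

/-- The RTT relations `∑ R^{pr}_{ab} x_{ai} x_{bj} = ∑ R^{ab}_{ij} x_{pa} x_{rb}`. -/
inductive RTTRel (R : ι → ι → ι → ι → k) :
    FreeAlgebra k (ι × ι) → FreeAlgebra k (ι × ι) → Prop
  | rtt (p r i j : ι) : RTTRel R
      (∑ a, ∑ b, R p r a b • (FreeAlgebra.ι k (a, i) * FreeAlgebra.ι k (b, j)))
      (∑ a, ∑ b, R a b i j • (FreeAlgebra.ι k (p, a) * FreeAlgebra.ι k (r, b)))

/-- The Faddeev-Reshetikhin-Takhtajan algebra of `R`: the free algebra on the symbols `x_{ij}`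
modulo the RTT relations. -/
def FRT (R : ι → ι → ι → ι → k) : Type u := RingQuot (RTTRel R)

namespace FRT
variable (R : ι → ι → ι → ι → k)

instance : Ring (FRT R) := inferInstanceAs (Ring (RingQuot (RTTRel R)))
instance : Algebra k (FRT R) := inferInstanceAs (Algebra k (RingQuot (RTTRel R)))

/-- The generators `x_{ij}`. -/
def x (i j : ι) : FRT R := RingQuot.mkAlgHom k (RTTRel R) (FreeAlgebra.ι k (i, j))

theorem rtt (p r i j : ι) :
    ∑ a, ∑ b, R p r a b • (x R a i * x R b j) = ∑ a, ∑ b, R a b i j • (x R p a * x R r b) := by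
  have h := RingQuot.mkAlgHom_rel k (RTTRel.rtt (R := R) p r i j)
  simp only [map_sum, map_smul, map_mul] at h
  exact h

variable {R}
variable {B : Type*} [Ring B] [Algebra k B]

/-- Universal property: an algebra map is given by matrices satisfying the RTT relation. -/
def lift (y : ι → ι → B)
    (hy : ∀ p r i j, ∑ a, ∑ b, R p r a b • (y a i * y b j) =
      ∑ a, ∑ b, R a b i j • (y p a * y r b)) : FRT R →ₐ[k] B :=
  RingQuot.liftAlgHom k ⟨FreeAlgebra.lift k (fun t : ι × ι => y t.1 t.2), by
    rintro _ _ ⟨p, r, i, j⟩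
    simpa using hy p r i j⟩

@[simp] theorem lift_x (y : ι → ι → B) (hy) (i j : ι) : lift (R := R) y hy (x R i j) = y i j := by
  unfold lift x
  erw [RingQuot.liftAlgHom_mkAlgHom_apply]
  simp

theorem algHom_ext {f g : FRT R →ₐ[k] B} (h : ∀ i j, f (x R i j) = g (x R i j)) : f = g := by
  apply RingQuot.ringQuot_ext'
  ext ⟨i, j⟩
  exact h i j

theorem adjoin_eq_top : Algebra.adjoin k (Set.range fun t : ι × ι => x R t.1 t.2) = ⊤ := by
  set S := Algebra.adjoin k (Set.range fun t : ι × ι => x R t.1 t.2)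
  have hx : ∀ i j, x R i j ∈ S := fun i j => Algebra.subset_adjoin ⟨(i, j), rfl⟩
  let f : FRT R →ₐ[k] S := lift (fun i j => ⟨x R i j, hx i j⟩) (by
    intro p r i j
    apply Subtype.ext
    simpa using rtt R p r i j)
  have : S.val.comp f = AlgHom.id k _ := algHom_ext (by intro i j; simp [f])
  rw [eq_top_iff]
  intro a _
  have := DFunLike.congr_fun this a
  simp only [AlgHom.coe_comp, Function.comp_apply, AlgHom.coe_id, id_eq] at this
  rw [← this]
  exact (f a).2

theorem induction {P : FRT R → Prop} (hx : ∀ i j, P (x R i j)) (hc : ∀ c : k, P (algebraMap k _ c))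
    (hadd : ∀ a b, P a → P b → P (a + b)) (hmul : ∀ a b, P a → P b → P (a * b)) (a : FRT R) :
    P a := by
  have ha : a ∈ Algebra.adjoin k (Set.range fun t : ι × ι => x R t.1 t.2) := by
    rw [adjoin_eq_top]; trivial
  induction ha using Algebra.adjoin_induction with
  | mem y hy => obtain ⟨t, rfl⟩ := hy; exact hx _ _
  | algebraMap r => exact hc r
  | add a b _ _ h1 h2 => exact hadd a b h1 h2
  | mul a b _ _ h1 h2 => exact hmul a b h1 h2

/-- The comultiplication `x_{ij} ↦ ∑_c x_{ic} ⊗ x_{cj}`. -/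
def comulHom : FRT R →ₐ[k] FRT R ⊗[k] FRT R :=
  lift (fun i j => ∑ c, x R i c ⊗ₜ[k] x R c j) (by
    intro p r i j
    have e1 : ∀ a b, (∑ c, x R a c ⊗ₜ[k] x R c i) * (∑ c, x R b c ⊗ₜ[k] x R c j) =
        ∑ c, ∑ d, (x R a c * x R b d) ⊗ₜ[k] (x R c i * x R d j) := by
      intro a b; simp [Finset.sum_mul_sum]
    have e2 : ∀ a b, (∑ c, x R p c ⊗ₜ[k] x R c a) * (∑ c, x R r c ⊗ₜ[k] x R c b) =
        ∑ c, ∑ d, (x R p c * x R r d) ⊗ₜ[k] (x R c a * x R d b) := by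
      intro a b; simp [Finset.sum_mul_sum]
    simp only [e1, e2, Finset.smul_sum]
    have l : ∑ a, ∑ b, ∑ c, ∑ d, R p r a b • ((x R a c * x R b d) ⊗ₜ[k] (x R c i * x R d j)) =
        ∑ c, ∑ d, (∑ a, ∑ b, R p r a b • (x R a c * x R b d)) ⊗ₜ[k] (x R c i * x R d j) := by
      simp only [TensorProduct.sum_tmul, TensorProduct.smul_tmul']
      rw [Finset.sum_congr rfl (fun a _ => Finset.sum_comm), Finset.sum_comm]
      refine Finset.sum_congr rfl fun c _ => ?_
      rw [Finset.sum_congr rfl (fun a _ => Finset.sum_comm), Finset.sum_comm]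
    have r' : ∑ a, ∑ b, ∑ c, ∑ d, R a b i j • ((x R p c * x R r d) ⊗ₜ[k] (x R c a * x R d b)) =
        ∑ c, ∑ d, (x R p c * x R r d) ⊗ₜ[k] (∑ a, ∑ b, R a b i j • (x R c a * x R d b)) := by
      simp only [TensorProduct.tmul_sum, TensorProduct.tmul_smul]
      rw [Finset.sum_congr rfl (fun a _ => Finset.sum_comm), Finset.sum_comm]
      refine Finset.sum_congr rfl fun c _ => ?_
      rw [Finset.sum_congr rfl (fun a _ => Finset.sum_comm), Finset.sum_comm]
    have h4 : ∀ (G : ι → ι → ι → ι → FRT R ⊗[k] FRT R),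
        ∑ a, ∑ b, ∑ c, ∑ d, G a b c d = ∑ c, ∑ d, ∑ a, ∑ b, G a b c d := by
      intro G
      rw [Finset.sum_congr rfl (fun a _ => Finset.sum_comm), Finset.sum_comm]
      refine Finset.sum_congr rfl fun c _ => ?_
      rw [Finset.sum_congr rfl (fun a _ => Finset.sum_comm), Finset.sum_comm]
    have l2 : ∀ c d, ∑ a, ∑ b, R p r a b • (x R a c * x R b d) =
        ∑ a, ∑ b, R a b c d • (x R p a * x R r b) := fun c d => rtt R p r c d
    have r2 : ∀ c d, ∑ a, ∑ b, R a b i j • (x R c a * x R d b) =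
        ∑ a, ∑ b, R c d a b • (x R a i * x R b j) := fun c d => (rtt R c d i j).symm
    rw [l, r']
    trans ∑ c, ∑ d, (∑ a, ∑ b, R a b c d • (x R p a * x R r b)) ⊗ₜ[k] (x R c i * x R d j)
    · refine Finset.sum_congr rfl fun c _ => Finset.sum_congr rfl fun d _ => ?_
      rw [l2 c d]
    trans ∑ c, ∑ d, (x R p c * x R r d) ⊗ₜ[k] (∑ a, ∑ b, R c d a b • (x R a i * x R b j))
    · simp only [TensorProduct.sum_tmul, TensorProduct.tmul_sum, ← TensorProduct.smul_tmul',
        TensorProduct.tmul_smul]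
      exact h4 _
    · refine Finset.sum_congr rfl fun c _ => Finset.sum_congr rfl fun d _ => ?_
      rw [r2 c d])

variable [DecidableEq ι]

/-- The counit `x_{ij} ↦ δ_{ij}`. -/
def counitHom : FRT R →ₐ[k] k :=
  lift (fun i j => if i = j then 1 else 0) (by
    intro p r i j
    simp)

@[simp] theorem comulHom_x (i j : ι) :
    comulHom (x R i j) = ∑ c, x R i c ⊗ₜ[k] x R c j := lift_x _ _ _ _

@[simp] theorem counitHom_x (i j : ι) :
    counitHom (x R i j) = if i = j then 1 else 0 := lift_x _ _ _ _

instance : Bialgebra k (FRT R) :=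
  Bialgebra.ofAlgHom comulHom counitHom
    (algHom_ext (by
      intro i j
      simp only [AlgHom.coe_comp, Function.comp_apply, comulHom_x, map_sum,
        Algebra.TensorProduct.map_tmul, AlgHom.id_apply, TensorProduct.sum_tmul,
        TensorProduct.tmul_sum]
      simp
      exact Finset.sum_comm))
    (algHom_ext (by
      intro i j
      simp [TensorProduct.ite_tmul]))
    (algHom_ext (by
      intro i j
      simp [TensorProduct.tmul_ite]))

theorem comul_x (i j : ι) :
    Coalgebra.comul (R := k) (x R i j) = ∑ c, x R i c ⊗ₜ[k] x R c j := comulHom_x i j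

theorem counit_x (i j : ι) :
    Coalgebra.counit (R := k) (x R i j) = if i = j then 1 else 0 := counitHom_x i j

end FRT
end FRT

namespace FRT

variable {k : Type u} [Field k] {ι : Type} [Fintype ι] [DecidableEq ι]
variable {R : ι → ι → ι → ι → k} (hR : YangBaxter R)

open WithConv

/-- The algebra map `A → Mat_ι(k)`, `(ell a) l m = 𝓡(a, x_{ml})`. -/
def ell : FRT R →ₐ[k] Matrix ι ι k :=
  lift (fun i j => Matrix.of fun l m => R i m l j) (by
    intro p r i j
    ext s t
    simp only [Matrix.sum_apply, Matrix.smul_apply, Matrix.mul_apply, Matrix.of_apply, smul_eq_mul,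
      Finset.mul_sum]
    have h := hR s i j p r t
    have e : ∀ G : ι → ι → ι → k, ∑ a, ∑ b, ∑ c, G a b c = ∑ a, ∑ c, ∑ b, G a b c :=
      fun G => Finset.sum_congr rfl fun a _ => Finset.sum_comm
    rw [e] at h
    rw [h, e])

theorem ell_x (i j l m : ι) : ell hR (x R i j) l m = R i m l j := by
  simp [ell]

/-- The functional `𝓡(-, x_{ij})` as an element of the convolution algebra. -/
def ellEntry (i j : ι) : WithConv (FRT R →ₗ[k] k) :=
  toConv ((Matrix.entryLinearMap k k j i) ∘ₗ (ell hR).toLinearMap)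

/-- The algebra map `a ↦ (𝓡(a₁, x_{-}) ⊗ 𝓡(a₂, x_{-}))`. -/
def ellKron : FRT R →ₐ[k] Matrix (ι × ι) (ι × ι) k :=
  ((Matrix.kroneckerAlgEquiv ι ι k).toAlgHom.comp
    (Algebra.TensorProduct.map (ell hR) (ell hR))).comp (Bialgebra.comulAlgHom k (FRT R))

theorem ellEntry_mul (a i b j : ι) (c : FRT R) :
    (ellEntry hR a i * ellEntry hR b j) c = ellKron hR c (i, j) (a, b) := by
  simp only [LinearMap.convMul_apply, ellKron, AlgHom.coe_comp, Function.comp_apply,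
    Bialgebra.comulAlgHom_apply]
  induction Coalgebra.comul (R := k) c using TensorProduct.induction_on with
  | zero => simp
  | tmul y z => simp [ellEntry, Matrix.kroneckerMap_apply]
  | add y z hy hz => simp only [map_add, hy, hz, Matrix.add_apply]

/-- `R` as a matrix. -/
def matR (R : ι → ι → ι → ι → k) : Matrix (ι × ι) (ι × ι) k := Matrix.of fun a b => R b.1 b.2 a.1 a.2

theorem ellKron_comm (c : FRT R) :
    ellKron hR c * matR R = matR R * ellKron hR c := by
  induction c using FRT.induction with
  | hx s t =>
    ext ⟨i, j⟩ ⟨p, r⟩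
    have h := hR i j t s p r
    simp only [Matrix.mul_apply, Fintype.sum_prod_type, matR, Matrix.of_apply, ← ellEntry_mul,
      LinearMap.convMul_apply, comul_x, map_sum, TensorProduct.map_tmul, LinearMap.mul'_apply]
    simp only [ellEntry, LinearMap.comp_apply, ofConv_toConv, Matrix.entryLinearMap_apply,
      AlgHom.toLinearMap_apply, ell_x, Finset.sum_mul, Finset.mul_sum]
    trans ∑ a, ∑ b, ∑ c, R a c j t * (R s b i a * R p r b c)
    · have e : ∀ G : ι → ι → ι → k, ∑ a, ∑ b, ∑ c, G a b c = ∑ b, ∑ c, ∑ a, G a b c := by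
        intro G
        rw [Finset.sum_comm]
        exact Finset.sum_congr rfl fun a _ => Finset.sum_comm
      rw [e, e]
      refine Finset.sum_congr rfl fun a _ => ?_
      refine Finset.sum_congr rfl fun b _ => Finset.sum_congr rfl fun c _ => ?_
      ring
    · rw [← h]
      refine Finset.sum_congr rfl fun a _ => Finset.sum_congr rfl fun b _ =>
        Finset.sum_congr rfl fun c _ => ?_
      ring
  | hc r => simp only [AlgHom.commutes]; exact Algebra.commutes r _
  | hadd a b ha hb => simp only [map_add, add_mul, mul_add, ha, hb]
  | hmul a b ha hb => rw [map_mul, mul_assoc, hb, ← mul_assoc, ha, mul_assoc]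

/-- `b ↦ 𝓡(-, b)`, as an algebra map to the convolution algebra. -/
def univHom : FRT R →ₐ[k] WithConv (FRT R →ₗ[k] k) :=
  lift (fun i j => ellEntry hR i j) (by
    intro p r i j
    ext c
    have h := congrFun (congrFun (ellKron_comm hR c) (i, j)) (p, r)
    simp only [Matrix.mul_apply, Fintype.sum_prod_type, matR, Matrix.of_apply] at h
    simp only [ofConv_sum, ofConv_smul, LinearMap.sum_apply, LinearMap.smul_apply, smul_eq_mul]
    trans ∑ x, ∑ y, (ellKron hR) c (i, j) (x, y) * R p r x y
    · refine Finset.sum_congr rfl fun a _ => Finset.sum_congr rfl fun b _ => ?_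
      rw [← ellEntry_mul, mul_comm]
    · rw [h]
      refine Finset.sum_congr rfl fun a _ => Finset.sum_congr rfl fun b _ => ?_
      rw [← ellEntry_mul])

/-- The universal form `𝓡 : A ⊗ A → k`: it is determined by `𝓡(x_{ij} ⊗ x_{kl}) = R^{ik}_{lj}`,
`𝓡(a b, c) = 𝓡(a, c₂) 𝓡(b, c₁)` and `𝓡(a, b c) = 𝓡(a₁, b) 𝓡(a₂, c)`. -/
def univR : FRT R ⊗[k] FRT R →ₗ[k] k :=
  TensorProduct.lift (LinearMap.flip
    ((WithConv.linearEquiv k (FRT R →ₗ[k] k)).toLinearMap ∘ₗ (univHom hR).toLinearMap))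

theorem univR_tmul (a b : FRT R) : univR hR (a ⊗ₜ b) = univHom hR b a := rfl

theorem univHom_x (i j : ι) (a : FRT R) : univHom hR (x R i j) a = ell hR a j i := by
  unfold univHom
  rw [lift_x]
  rfl

theorem univR_x (i j l m : ι) : univR hR (x R i j ⊗ₜ x R l m) = R i l m j := by
  rw [univR_tmul, univHom_x, ell_x]

/-! ### The commutation rule -/

/-- The convolution algebra of endomorphisms of `FRT R`. -/
abbrev Cv (R : ι → ι → ι → ι → k) : Type u := WithConv (FRT R →ₗ[k] FRT R)

/-- Auxiliary map for the commutation rule. -/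
def lam : FRT R →ₐ[k] Cv R :=
  AlgHom.ofLinearMap
    { toFun := fun y => toConv (LinearMap.toSpanSingleton k (FRT R) y ∘ₗ Coalgebra.counit)
      map_add' := by intro y z; ext a; simp [LinearMap.toSpanSingleton]
      map_smul' := by intro c y; ext a; exact smul_comm (Coalgebra.counit (R := k) a) c y }
    (by ext a; exact (Algebra.algebraMap_eq_smul_one (A := FRT R) (Coalgebra.counit (R := k) a)).symm)
    (by
      intro y z
      ext a
      simp only [LinearMap.coe_mk, AddHom.coe_mk]
      rw [(Coalgebra.Repr.arbitrary k a).convMul_apply]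
      simp only [ofConv_toConv, LinearMap.comp_apply, LinearMap.toSpanSingleton_apply,
        smul_mul_smul_comm, ← Finset.sum_smul]
      congr 1
      have h := Coalgebra.sum_counit_smul (Coalgebra.Repr.arbitrary k a)
      have := congrArg (Coalgebra.counit (R := k)) h
      simpa using this.symm)

theorem lam_mul (y : FRT R) (f : Cv R) (a : FRT R) : (lam y * f) a = y * f a := by
  rw [(Coalgebra.Repr.arbitrary k a).convMul_apply]
  conv_rhs => rw [← Coalgebra.sum_counit_smul (Coalgebra.Repr.arbitrary k a)]
  simp [lam, Finset.mul_sum]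

theorem mul_lam (y : FRT R) (f : Cv R) (a : FRT R) : (f * lam y) a = f a * y := by
  rw [(Coalgebra.Repr.arbitrary k a).convMul_apply]
  have h : ∑ i ∈ (Coalgebra.Repr.arbitrary k a).index,
      Coalgebra.counit (R := k) ((Coalgebra.Repr.arbitrary k a).right i) •
        (Coalgebra.Repr.arbitrary k a).left i = a := by
    have := congrArg (TensorProduct.rid k _)
      (Coalgebra.sum_tmul_counit_eq (Coalgebra.Repr.arbitrary k a))
    simpa only [map_sum, TensorProduct.rid_tmul, one_smul] using this
  conv_rhs => rw [← h]
  simp [lam, Finset.sum_mul]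

/-- Auxiliary map for the commutation rule. -/
def rhoHom : FRT R →ₐ[k] Cv R :=
  (AlgHom.ofLinearMap
    { toFun := fun f : WithConv (FRT R →ₗ[k] k) => (toConv (Algebra.linearMap k (FRT R) ∘ₗ f.ofConv) : Cv R)
      map_add' := by intro y z; ext a; simp
      map_smul' := by
        intro c y; ext a
        change algebraMap k (FRT R) (c • y a) = c • algebraMap k (FRT R) (y a)
        rw [smul_eq_mul, map_mul, Algebra.smul_def] }
    (by ext a; simp)
    (by
      intro f g
      have := LinearMap.algHom_comp_convMul_distrib (Algebra.ofId k (FRT R)) f g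
      exact congrArg toConv this)).comp (univHom hR)

theorem rhoHom_apply (b a : FRT R) : rhoHom hR b a = algebraMap k _ (univR hR (a ⊗ₜ b)) := rfl

theorem lam_rho_comm (y z : FRT R) : Commute (lam y) (rhoHom hR z) := by
  ext a
  rw [lam_mul, mul_lam, rhoHom_apply]
  exact (Algebra.commutes _ _).symm

/-- The identity as an element of the convolution algebra. -/
def idC : Cv R := toConv LinearMap.id

/-- Auxiliary map for the commutation rule. -/
def Lam : FRT R →ₐ[k] Cv R :=
  (Algebra.TensorProduct.lift lam (rhoHom hR) (lam_rho_comm hR)).comp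
    (Bialgebra.comulAlgHom k (FRT R))

/-- Auxiliary map for the commutation rule. -/
def Lam' : FRT R →ₐ[k] Cv R :=
  (Algebra.TensorProduct.lift (rhoHom hR) lam (fun y z => (lam_rho_comm hR z y).symm)).comp
    (Bialgebra.comulAlgHom k (FRT R))

/-- Auxiliary map for the commutation rule. -/
def leftM : FRT R →ₐ[k] Matrix ι ι (FRT R) :=
  ((matrixEquivTensor ι k (FRT R)).symm.toAlgHom.comp
    (Algebra.TensorProduct.map (AlgHom.id k _) (ell hR))).comp (Bialgebra.comulAlgHom k (FRT R))

/-- Auxiliary map for the commutation rule. -/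
def rightM : FRT R →ₐ[k] Matrix ι ι (FRT R) :=
  ((matrixEquivTensor ι k (FRT R)).symm.toAlgHom.comp
    ((Algebra.TensorProduct.comm k _ _).toAlgHom.comp
    (Algebra.TensorProduct.map (ell hR) (AlgHom.id k _)))).comp (Bialgebra.comulAlgHom k (FRT R))

theorem leftM_apply (a : FRT R) (l s : ι) : leftM hR a l s = (idC * rhoHom hR (x R s l) : Cv R).ofConv a := by
  simp only [LinearMap.convMul_apply, leftM, AlgHom.coe_comp, Function.comp_apply,
    Bialgebra.comulAlgHom_apply]
  induction Coalgebra.comul (R := k) a using TensorProduct.induction_on with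
  | zero => simp
  | tmul y z => 
    have : rhoHom hR (x R s l) z = algebraMap k _ (ell hR z l s) := by
      rw [rhoHom_apply, univR_tmul, univHom_x]
    simp [idC, this]
  | add y z hy hz => simp only [map_add, Matrix.add_apply, hy, hz]

theorem rightM_apply (a : FRT R) (s m : ι) : rightM hR a s m = (rhoHom hR (x R m s) * idC : Cv R).ofConv a := by
  simp only [LinearMap.convMul_apply, rightM, AlgHom.coe_comp, Function.comp_apply,
    Bialgebra.comulAlgHom_apply]
  induction Coalgebra.comul (R := k) a using TensorProduct.induction_on with
  | zero => simp
  | tmul y z => 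
    have : rhoHom hR (x R m s) y = algebraMap k _ (ell hR y s m) := by
      rw [rhoHom_apply, univR_tmul, univHom_x]
    simp [idC, this]
    exact (Algebra.commutes _ _).symm
  | add y z hy hz => simp only [map_add, Matrix.add_apply, hy, hz]

/-- The transposed matrix of generators. -/
def XT (R : ι → ι → ι → ι → k) : Matrix ι ι (FRT R) := Matrix.of fun l m => x R m l

theorem leftM_x (i j l s : ι) : leftM hR (x R i j) l s = ∑ c, R c s l j • x R i c := by
  simp [leftM, comul_x, Matrix.sum_apply, ell_x, Algebra.smul_def]
  refine Finset.sum_congr rfl fun c _ => (Algebra.commutes _ _).symm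

theorem rightM_x (i j s m : ι) : rightM hR (x R i j) s m = ∑ c, R i m s c • x R c j := by
  simp [rightM, comul_x, Matrix.sum_apply, ell_x, Algebra.smul_def]
  refine Finset.sum_congr rfl fun c _ => (Algebra.commutes _ _).symm

theorem leftM_XT (a : FRT R) : leftM hR a * XT R = XT R * rightM hR a := by
  induction a using FRT.induction with
  | hx i j =>
    ext l m
    simp only [Matrix.mul_apply, leftM_x, rightM_x, XT, Matrix.of_apply, Finset.sum_mul,
      Finset.mul_sum, smul_mul_assoc, mul_smul_comm]
    rw [rtt R i m l j, Finset.sum_comm]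
  | hc r => simp only [AlgHom.commutes]; exact Algebra.commutes r _
  | hadd a b ha hb => simp only [map_add, add_mul, mul_add, ha, hb]
  | hmul a b ha hb => rw [map_mul, mul_assoc, hb, ← mul_assoc, ha, mul_assoc, map_mul]

theorem idC_Lam (b : FRT R) : idC * Lam hR b = Lam' hR b * idC := by
  induction b using FRT.induction with
  | hx m l =>
    ext a
    have h := congrFun (congrFun (leftM_XT hR a) l) m
    simp only [Matrix.mul_apply, leftM_apply, rightM_apply, XT, Matrix.of_apply] at h
    simp only [Lam, Lam', AlgHom.coe_comp, Function.comp_apply, Bialgebra.comulAlgHom_apply,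
      comul_x, map_sum, Algebra.TensorProduct.lift_tmul, Finset.sum_mul, Finset.mul_sum,
      ofConv_sum, LinearMap.sum_apply]
    trans ∑ s, (idC * rhoHom hR (x R s l) : Cv R).ofConv a * x R m s
    · refine Finset.sum_congr rfl fun s _ => ?_
      rw [(lam_rho_comm hR _ _).eq, ← mul_assoc, mul_lam]
    · rw [h]
      refine Finset.sum_congr rfl fun s _ => ?_
      rw [← (lam_rho_comm hR _ _).eq, mul_assoc, lam_mul]
  | hc r => simp only [AlgHom.commutes]; exact (Algebra.commutes r _).symm
  | hadd a b ha hb => simp only [map_add, add_mul, mul_add, ha, hb]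
  | hmul a b ha hb => rw [map_mul, ← mul_assoc, ha, mul_assoc, hb, ← mul_assoc, map_mul]



/-- The commutation rule `a₁ b₁ 𝓡(a₂, b₂) = 𝓡(a₁, b₁) b₂ a₂`. -/
theorem univR_comm {μ ν : Type} [Fintype μ] [Fintype ν] (a b : FRT R) (a₁ a₂ : μ → FRT R)
    (b₁ b₂ : ν → FRT R) (ha : Coalgebra.comul (R := k) a = ∑ m, a₁ m ⊗ₜ[k] a₂ m)
    (hb : Coalgebra.comul (R := k) b = ∑ m, b₁ m ⊗ₜ[k] b₂ m) :
    ∑ m, ∑ i, univR hR (a₂ m ⊗ₜ b₂ i) • (a₁ m * b₁ i) =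
      ∑ m, ∑ i, univR hR (a₁ m ⊗ₜ b₁ i) • (b₂ i * a₂ m) := by
  have h := congrArg (fun f : Cv R => f.ofConv a) (idC_Lam hR b)
  have hl : Lam hR b = ∑ i, lam (b₁ i) * rhoHom hR (b₂ i) := by
    simp [Lam, hb]
  have hr : Lam' hR b = ∑ i, rhoHom hR (b₁ i) * lam (b₂ i) := by
    simp [Lam', hb]
  simp only [LinearMap.convMul_apply, ha, map_sum, TensorProduct.map_tmul, LinearMap.mul'_apply] at h
  rw [hl, hr] at h
  simp only [ofConv_sum, LinearMap.sum_apply, lam_mul, mul_lam, rhoHom_apply, idC, ofConv_toConv,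
    LinearMap.id_apply, Finset.mul_sum, Finset.sum_mul] at h
  simp only [Algebra.smul_def]
  refine Eq.trans ?_ (h.trans ?_)
  · refine Finset.sum_congr rfl fun m _ => Finset.sum_congr rfl fun i _ => ?_
    rw [Algebra.commutes, mul_assoc]
  · refine Finset.sum_congr rfl fun m _ => Finset.sum_congr rfl fun i _ => ?_
    rw [mul_assoc]

end FRT

/-! ### Comodules -/
section Comodule

variable {k : Type u} [Field k] {A : Type u} [Ring A] [Bialgebra k A]
variable {V W U : Type u} [AddCommGroup V] [Module k V] [AddCommGroup W] [Module k W]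
  [AddCommGroup U] [Module k U]

/-- `ρ : V → V ⊗ A` is a coaction: it is coassociative and counital. -/
structure IsCoaction (ρ : V →ₗ[k] V ⊗[k] A) : Prop where
  coassoc : (TensorProduct.assoc k V A A).toLinearMap ∘ₗ ρ.rTensor A ∘ₗ ρ =
    (Coalgebra.comul (R := k) (A := A)).lTensor V ∘ₗ ρ
  counit : (TensorProduct.rid k V).toLinearMap ∘ₗ (Coalgebra.counit (R := k) (A := A)).lTensor V ∘ₗ ρ =
    LinearMap.id

/-- The coaction on the tensor product of two comodules:
`v ⊗ w ↦ v₀ ⊗ w₀ ⊗ v₁ w₁`. -/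
def tensorCoaction (ρ : V →ₗ[k] V ⊗[k] A) (σ : W →ₗ[k] W ⊗[k] A) :
    V ⊗[k] W →ₗ[k] (V ⊗[k] W) ⊗[k] A :=
  (LinearMap.mul' k A).lTensor (V ⊗[k] W) ∘ₗ
    (TensorProduct.tensorTensorTensorComm k V A W A).toLinearMap ∘ₗ TensorProduct.map ρ σ

/-- The braiding `R_{V,W} = (1 ⊗ 1 ⊗ 𝓡) (1 ⊗ τ ⊗ 1) (Δ_W ⊗ Δ_V) τ` of comodules, that is
`v ⊗ w ↦ 𝓡(w₁, v₁) w₀ ⊗ v₀`. -/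
def comoduleBraiding (𝓡 : A ⊗[k] A →ₗ[k] k) (ρ : V →ₗ[k] V ⊗[k] A) (σ : W →ₗ[k] W ⊗[k] A) :
    V ⊗[k] W →ₗ[k] W ⊗[k] V :=
  (TensorProduct.rid k (W ⊗[k] V)).toLinearMap ∘ₗ 𝓡.lTensor (W ⊗[k] V) ∘ₗ
    (TensorProduct.tensorTensorTensorComm k W A V A).toLinearMap ∘ₗ TensorProduct.map σ ρ ∘ₗ
    (TensorProduct.comm k V W).toLinearMap

theorem exists_coeff [FiniteDimensional k V] (ρ : V →ₗ[k] V ⊗[k] A) :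
    ∃ t : Fin (Module.finrank k V) → Fin (Module.finrank k V) → A,
      ∀ j, ρ (Module.finBasis k V j) = ∑ i, Module.finBasis k V i ⊗ₜ[k] t i j := by
  refine ⟨fun i j => TensorProduct.equivFinsuppOfBasisLeft (Module.finBasis k V)
    (ρ (Module.finBasis k V j)) i, fun j => ?_⟩
  conv_lhs => rw [← (TensorProduct.equivFinsuppOfBasisLeft (N := A) (Module.finBasis k V)).symm_apply_apply
    (ρ (Module.finBasis k V j))]
  rw [TensorProduct.equivFinsuppOfBasisLeft_symm_apply, Finsupp.sum_fintype _ _ (by simp)]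

theorem sum_basis_tmul_inj {ι : Type*} [Fintype ι] (b : Module.Basis ι k V) {B : Type*} [AddCommGroup B]
    [Module k B] (f g : ι → B) (h : ∑ i, b i ⊗ₜ[k] f i = ∑ i, b i ⊗ₜ[k] g i) : f = g := by
  classical
  have := congrArg (TensorProduct.equivFinsuppOfBasisLeft b) h
  ext i
  have := DFunLike.congr_fun this i
  simpa [TensorProduct.equivFinsuppOfBasisLeft_apply_tmul_apply, Finsupp.finsetSum_apply,
    Finsupp.single_apply] using this

theorem IsCoaction.coeff_comul [FiniteDimensional k V] {ρ : V →ₗ[k] V ⊗[k] A} (hρ : IsCoaction ρ)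
    {t : Fin (Module.finrank k V) → Fin (Module.finrank k V) → A}
    (ht : ∀ j, ρ (Module.finBasis k V j) = ∑ i, Module.finBasis k V i ⊗ₜ[k] t i j) (i j) :
    Coalgebra.comul (R := k) (t i j) = ∑ l, t i l ⊗ₜ[k] t l j := by
  have h := DFunLike.congr_fun hρ.coassoc (Module.finBasis k V j)
  simp only [LinearMap.comp_apply, ht, map_sum, LinearMap.rTensor_tmul, LinearMap.lTensor_tmul,
    TensorProduct.sum_tmul, LinearEquiv.coe_coe, TensorProduct.assoc_tmul] at h
  rw [Finset.sum_comm] at h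
  simp only [← TensorProduct.tmul_sum] at h
  exact (congrFun (sum_basis_tmul_inj _ _ _ h) i).symm

theorem comoduleBraiding_colinear [FiniteDimensional k V] [FiniteDimensional k W]
    {𝓡 : A ⊗[k] A →ₗ[k] k} {ρ : V →ₗ[k] V ⊗[k] A} {σ : W →ₗ[k] W ⊗[k] A}
    (hρ : IsCoaction ρ) (hσ : IsCoaction σ)
    (h𝓡 : ∀ {μ ν : Type} [Fintype μ] [Fintype ν] (a b : A) (a₁ a₂ : μ → A) (b₁ b₂ : ν → A),
      Coalgebra.comul (R := k) a = ∑ m, a₁ m ⊗ₜ[k] a₂ m →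
      Coalgebra.comul (R := k) b = ∑ m, b₁ m ⊗ₜ[k] b₂ m →
      ∑ m, ∑ i, 𝓡 (a₂ m ⊗ₜ b₂ i) • (a₁ m * b₁ i) = ∑ m, ∑ i, 𝓡 (a₁ m ⊗ₜ b₁ i) • (b₂ i * a₂ m)) :
    tensorCoaction σ ρ ∘ₗ comoduleBraiding 𝓡 ρ σ =
      (comoduleBraiding 𝓡 ρ σ).rTensor A ∘ₗ tensorCoaction ρ σ := by
  obtain ⟨t, ht⟩ := exists_coeff ρ
  obtain ⟨s, hs⟩ := exists_coeff σ
  have hb : ∀ j l, comoduleBraiding 𝓡 ρ σ (Module.finBasis k V j ⊗ₜ Module.finBasis k W l) =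
      ∑ m, ∑ i, 𝓡 (s m l ⊗ₜ t i j) • (Module.finBasis k W m ⊗ₜ[k] Module.finBasis k V i) := by
    intro j l
    simp [comoduleBraiding, ht, hs, TensorProduct.sum_tmul, TensorProduct.tmul_sum]
    exact Finset.sum_comm
  have hc : ∀ j l, tensorCoaction ρ σ (Module.finBasis k V j ⊗ₜ Module.finBasis k W l) =
      ∑ i, ∑ m, (Module.finBasis k V i ⊗ₜ[k] Module.finBasis k W m) ⊗ₜ[k] (t i j * s m l) := by
    intro j l
    simp [tensorCoaction, ht, hs, TensorProduct.sum_tmul, TensorProduct.tmul_sum]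
    try exact Finset.sum_comm
  have hc' : ∀ j l, tensorCoaction σ ρ (Module.finBasis k W l ⊗ₜ Module.finBasis k V j) =
      ∑ m, ∑ i, (Module.finBasis k W m ⊗ₜ[k] Module.finBasis k V i) ⊗ₜ[k] (s m l * t i j) := by
    intro j l
    simp [tensorCoaction, ht, hs, TensorProduct.sum_tmul, TensorProduct.tmul_sum]
    try exact Finset.sum_comm
  refine Module.Basis.ext ((Module.finBasis k V).tensorProduct (Module.finBasis k W)) ?_
  rintro ⟨j, l⟩
  simp only [Module.Basis.tensorProduct_apply, LinearMap.comp_apply, hb, hc, map_sum, map_smul, hc',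
    LinearMap.rTensor_tmul, TensorProduct.sum_tmul, Finset.smul_sum]
  have key := fun m i => h𝓡 (s m l) (t i j) _ _ _ _ (hσ.coeff_comul hs m l) (hρ.coeff_comul ht i j)
  have e : ∀ {α β γ δ : Type} [Fintype α] [Fintype β] [Fintype γ] [Fintype δ]
      (G : α → β → γ → δ → (W ⊗[k] V) ⊗[k] A),
        ∑ a, ∑ b, ∑ c, ∑ d, G a b c d = ∑ c, ∑ d, ∑ a, ∑ b, G a b c d := by
    intro α β γ δ _ _ _ _ G
    rw [Finset.sum_congr rfl (fun a _ => Finset.sum_comm), Finset.sum_comm]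
    refine Finset.sum_congr rfl fun c _ => ?_
    rw [Finset.sum_congr rfl (fun a _ => Finset.sum_comm), Finset.sum_comm]
  trans ∑ m, ∑ i, (Module.finBasis k W m ⊗ₜ[k] Module.finBasis k V i) ⊗ₜ[k]
    ∑ a, ∑ b, 𝓡 (s a l ⊗ₜ t b j) • (s m a * t i b)
  · rw [e]
    simp only [TensorProduct.tmul_sum, TensorProduct.tmul_smul]
  · simp only [key]
    simp only [TensorProduct.tmul_sum, TensorProduct.tmul_smul, ← TensorProduct.smul_tmul']
    rw [e]
    exact Finset.sum_comm

theorem mem_range_of_slices {K M N : Type*} [AddCommGroup K] [Module k K] [AddCommGroup M] [Module k M]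
    [AddCommGroup N] [Module k N] (ι : K →ₗ[k] M) (z : M ⊗[k] N)
    (h : ∀ φ : Module.Dual k N, ∃ y, ι y = TensorProduct.rid k M (φ.lTensor M z)) :
    ∃ y : K ⊗[k] N, ι.rTensor N y = z := by
  let b := Module.Basis.ofVectorSpace k N
  classical
  have hz := (TensorProduct.equivFinsuppOfBasisRight (M := M) b).symm_apply_apply z
  rw [TensorProduct.equivFinsuppOfBasisRight_symm_apply] at hz
  have hm : ∀ i, ∃ y, ι y = TensorProduct.equivFinsuppOfBasisRight (M := M) b z i := by
    intro i
    rw [TensorProduct.equivFinsuppOfBasisRight_apply]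
    exact h _
  choose g hg using hm
  refine ⟨∑ i ∈ (TensorProduct.equivFinsuppOfBasisRight (M := M) b z).support, g i ⊗ₜ[k] b i, ?_⟩
  conv_rhs => rw [← hz]
  simp [Finsupp.sum, hg]

end Comodule

/-- The algebra `A_q(n,n)` of quantum `n × n` matrices. -/
abbrev QMat {k : Type u} [Field k] (q : kˣ) (n : ℕ) : Type u := FRT (stdR q n)

/-- The degree `e` part `A_q(n,n)_e`, spanned by the products of `e` generators. -/
def QMat.deg {k : Type u} [Field k] (q : kˣ) (n e : ℕ) : Submodule k (QMat q n) :=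
  (Submodule.span k (Set.range fun t : Fin n × Fin n => FRT.x (stdR q n) t.1 t.2)) ^ e

/-- The universal form `𝓡` of `A_q(n,n)`, with `𝓡(x_{ij} ⊗ x_{kl}) = (R_n)^{ik}_{lj}`. -/
def QMat.univR {k : Type u} [Field k] (q : kˣ) (n : ℕ) : QMat q n ⊗[k] QMat q n →ₗ[k] k :=
  FRT.univR (stdR_yangBaxter q n)

/-- An `e`-Hecke pair: a finite dimensional `A_q(n,n)`-comodule `V`, for some `n ≥ 1`, whose
coaction takes values in `V ⊗ A_q(n,n)_e`. -/
structure EHeckePair (k : Type u) [Field k] (q : kˣ) (e : ℕ) : Type (u + 1) where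
  n : ℕ
  n_pos : 0 < n
  carrier : Type u
  [addCommGroup : AddCommGroup carrier]
  [module : Module k carrier]
  [finite : FiniteDimensional k carrier]
  coaction : carrier →ₗ[k] carrier ⊗[k] QMat q n
  isCoaction : IsCoaction coaction
  coaction_mem : ∀ v, coaction v ∈ LinearMap.range ((QMat.deg q n e).subtype.lTensor carrier)

attribute [instance] EHeckePair.addCommGroup EHeckePair.module EHeckePair.finite

section TensorPower

variable {k : Type u} [Field k] (V : Type u) [AddCommGroup V] [Module k V]

/-- The isomorphism `V^{⊗ a} ⊗ V^{⊗ b} ≃ V^{⊗ d}` (concatenation) for `a + b = d`. -/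
def mulE (a b d : ℕ) (h : a + b = d) : (⨂[k]^a V) ⊗[k] (⨂[k]^b V) ≃ₗ[k] (⨂[k]^d V) :=
  PiTensorProduct.tmulEquiv k V ≪≫ₗ PiTensorProduct.reindex k (fun _ => V)
    (finSumFinEquiv.trans (finCongr h))

variable {V}

theorem mulE_tprod (a b d : ℕ) (h : a + b = d) (x : Fin a → V) (y : Fin b → V) :
    mulE (k := k) V a b d h (PiTensorProduct.tprod k x ⊗ₜ PiTensorProduct.tprod k y) =
      PiTensorProduct.tprod k (fun i : Fin d =>
        if hi : i.1 < a then x ⟨i.1, hi⟩ else y ⟨i.1 - a, by omega⟩) := by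
  subst h
  simp only [mulE, LinearEquiv.trans_apply, PiTensorProduct.tmulEquiv_apply]
  erw [PiTensorProduct.reindex_tprod]
  congr 1
  funext i
  refine Fin.addCases (fun j => ?_) (fun j => ?_) i <;> simp

theorem mulE_assoc (a b c ab bc d : ℕ) (h1 : a + b = ab) (h2 : ab + c = d) (h3 : b + c = bc)
    (h4 : a + bc = d) (x : ⨂[k]^a V) (y : ⨂[k]^b V) (z : ⨂[k]^c V) :
    mulE V ab c d h2 (mulE V a b ab h1 (x ⊗ₜ y) ⊗ₜ z) =
      mulE V a bc d h4 (x ⊗ₜ mulE V b c bc h3 (y ⊗ₜ z)) := by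
  induction x using PiTensorProduct.induction_on with
  | add x x' hx hx' => simp only [map_add, TensorProduct.add_tmul, hx, hx']
  | smul_tprod r x =>
  induction y using PiTensorProduct.induction_on with
  | add x x' hx hx' => simp only [map_add, TensorProduct.add_tmul, TensorProduct.tmul_add, hx, hx']
  | smul_tprod r' y =>
  induction z using PiTensorProduct.induction_on with
  | add x x' hx hx' => simp only [map_add, TensorProduct.tmul_add, hx, hx']
  | smul_tprod r'' z =>
  simp only [TensorProduct.tmul_smul, ← TensorProduct.smul_tmul', map_smul, mulE_tprod]
  congr 4
  funext i
  split_ifs <;> first | rfl | omega | (congr 1; simp; omega)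

variable (V)

/-- The isomorphism `V ≃ V^{⊗ 1}`. -/
def consE : V ≃ₗ[k] ⨂[k]^1 V :=
  (PiTensorProduct.subsingletonEquiv (R := k) (s := fun _ : Fin 1 => V) (0 : Fin 1)).symm

/-- The isomorphism `V ⊗ V ≃ V^{⊗ 2}`. -/
def pairE : V ⊗[k] V ≃ₗ[k] ⨂[k]^2 V :=
  TensorProduct.congr (consE V) (consE V) ≪≫ₗ mulE V 1 1 2 rfl

/-- The splitting `V^{⊗ i} ⊗ ((V ⊗ V) ⊗ V^{⊗ c}) ≃ V^{⊗ d}`. -/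
def splitE (i c d : ℕ) (h : i + (2 + c) = d) :
    (⨂[k]^i V) ⊗[k] ((V ⊗[k] V) ⊗[k] (⨂[k]^c V)) ≃ₗ[k] ⨂[k]^d V :=
  TensorProduct.congr (LinearEquiv.refl k _)
    (TensorProduct.congr (pairE V) (LinearEquiv.refl k _) ≪≫ₗ mulE V 2 c (2 + c) rfl) ≪≫ₗ
    mulE V i (2 + c) d h

variable {V}

/-- The operator `1_{V^{⊗ i}} ⊗ T ⊗ 1_{V^{⊗ c}}`. -/
def braidGen (T : V ⊗[k] V →ₗ[k] V ⊗[k] V) (i c d : ℕ) (h : i + (2 + c) = d) :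
    (⨂[k]^d V) →ₗ[k] (⨂[k]^d V) :=
  (splitE V i c d h).toLinearMap ∘ₗ ((T.rTensor (⨂[k]^c V)).lTensor (⨂[k]^i V)) ∘ₗ
    (splitE V i c d h).symm.toLinearMap

theorem braidGen_splitE (T : V ⊗[k] V →ₗ[k] V ⊗[k] V) (i c d : ℕ) (h : i + (2 + c) = d)
    (x : ⨂[k]^i V) (v : V ⊗[k] V) (z : ⨂[k]^c V) :
    braidGen T i c d h (splitE V i c d h (x ⊗ₜ (v ⊗ₜ z))) = splitE V i c d h (x ⊗ₜ (T v ⊗ₜ z)) := by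
  simp [braidGen]

theorem splitE_tmul (i c d : ℕ) (h : i + (2 + c) = d)
    (x : ⨂[k]^i V) (v : V ⊗[k] V) (z : ⨂[k]^c V) :
    splitE V i c d h (x ⊗ₜ (v ⊗ₜ z)) =
      mulE V i (2 + c) d h (x ⊗ₜ mulE V 2 c (2 + c) rfl (pairE V v ⊗ₜ z)) := by
  simp [splitE]

theorem splitE_ext {M : Type*} [AddCommGroup M] [Module k M] {i c d : ℕ} (h : i + (2 + c) = d)
    {f g : (⨂[k]^d V) →ₗ[k] M}
    (hfg : ∀ x v z, f (splitE V i c d h (x ⊗ₜ (v ⊗ₜ z))) = g (splitE V i c d h (x ⊗ₜ (v ⊗ₜ z)))) :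
    f = g := by
  have : f ∘ₗ (splitE V i c d h).toLinearMap = g ∘ₗ (splitE V i c d h).toLinearMap := by
    refine TensorProduct.ext' fun x y => ?_
    induction y using TensorProduct.induction_on with
    | zero => simp
    | tmul v z => exact hfg x v z
    | add y z hy hz => simp only [TensorProduct.tmul_add, map_add, hy, hz]
  ext1
  ext y
  have := DFunLike.congr_fun this ((splitE V i c d h).symm (PiTensorProduct.tprod k y))
  simpa using this

theorem braidGen_mulE_left (T : V ⊗[k] V →ₗ[k] V ⊗[k] V) (i c a b d : ℕ) (h : i + (2 + c) = a)
    (h' : a + b = d) (x : ⨂[k]^a V) (y : ⨂[k]^b V) :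
    braidGen T i (c + b) d (by omega) (mulE V a b d h' (x ⊗ₜ y)) =
      mulE V a b d h' (braidGen T i c a h x ⊗ₜ y) := by
  obtain ⟨x, rfl⟩ := (splitE V i c a h).surjective x
  induction x using TensorProduct.induction_on with
  | zero => simp
  | add x x' hx hx' => simp only [map_add, TensorProduct.add_tmul, hx, hx']
  | tmul x w =>
  induction w using TensorProduct.induction_on with
  | zero => simp
  | add x x' hx hx' => simp only [map_add, TensorProduct.add_tmul, TensorProduct.tmul_add, hx, hx']
  | tmul v z =>
  have e : ∀ v, mulE V a b d h' (splitE V i c a h (x ⊗ₜ (v ⊗ₜ z)) ⊗ₜ y) =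
      splitE V i (c + b) d (by omega) (x ⊗ₜ (v ⊗ₜ mulE V c b (c + b) rfl (z ⊗ₜ y))) := by
    intro v
    rw [splitE_tmul, splitE_tmul, mulE_assoc i (2 + c) b a (2 + (c + b)) d h h' (by omega) (by omega),
      mulE_assoc 2 c b (2 + c) (c + b) (2 + (c + b)) rfl (by omega) rfl rfl]
  rw [braidGen_splitE, e, braidGen_splitE, e]

theorem braidGen_mulE_right (T : V ⊗[k] V →ₗ[k] V ⊗[k] V) (i c a b d : ℕ) (h : i + (2 + c) = b)
    (h' : a + b = d) (x : ⨂[k]^a V) (y : ⨂[k]^b V) :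
    braidGen T (a + i) c d (by omega) (mulE V a b d h' (x ⊗ₜ y)) =
      mulE V a b d h' (x ⊗ₜ braidGen T i c b h y) := by
  obtain ⟨y, rfl⟩ := (splitE V i c b h).surjective y
  induction y using TensorProduct.induction_on with
  | zero => simp
  | add x x' hx hx' => simp only [map_add, TensorProduct.tmul_add, hx, hx']
  | tmul y w =>
  induction w using TensorProduct.induction_on with
  | zero => simp
  | add x x' hx hx' => simp only [map_add, TensorProduct.tmul_add, hx, hx']
  | tmul v z =>
  have e : ∀ v, mulE V a b d h' (x ⊗ₜ splitE V i c b h (y ⊗ₜ (v ⊗ₜ z))) =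
      splitE V (a + i) c d (by omega) (mulE V a i (a + i) rfl (x ⊗ₜ y) ⊗ₜ (v ⊗ₜ z)) := by
    intro v
    rw [splitE_tmul, splitE_tmul, mulE_assoc a i (2 + c) (a + i) b d rfl (by omega) h h']
  rw [braidGen_splitE, e, braidGen_splitE, e]

end TensorPower

section TensorPowerCoaction
variable {k : Type u} [Field k] {A : Type u} [Ring A] [Bialgebra k A]
variable {V : Type u} [AddCommGroup V] [Module k V]

/-- The isomorphism `V^{⊗ d} ⊗ V ≃ V^{⊗ (d + 1)}`. -/
def snocE (d : ℕ) : (⨂[k]^d V) ⊗[k] V ≃ₗ[k] ⨂[k]^(d + 1) V :=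
  TensorProduct.congr (LinearEquiv.refl k _) (consE V) ≪≫ₗ mulE V d 1 (d + 1) rfl

/-- The coaction on the tensor power `V^{⊗ d}`. -/
def tpowCoaction (ρ : V →ₗ[k] V ⊗[k] A) : (d : ℕ) → (⨂[k]^d V) →ₗ[k] (⨂[k]^d V) ⊗[k] A
  | 0 => (TensorProduct.mk k (⨂[k]^0 V) A).flip 1
  | d + 1 => (snocE d).toLinearMap.rTensor A ∘ₗ tensorCoaction (tpowCoaction ρ d) ρ ∘ₗ
      (snocE d).symm.toLinearMap

theorem tpowCoaction_snocE (ρ : V →ₗ[k] V ⊗[k] A) (d : ℕ) (x : ⨂[k]^d V) (v : V) :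
    tpowCoaction ρ (d + 1) (snocE d (x ⊗ₜ v)) =
      (snocE d).toLinearMap.rTensor A (tensorCoaction (tpowCoaction ρ d) ρ (x ⊗ₜ v)) := by
  simp [tpowCoaction]

end TensorPowerCoaction

section TensorPowerCoaction
variable {k : Type u} [Field k] {A : Type u} [Ring A] [Bialgebra k A]
variable {V W U : Type u} [AddCommGroup V] [Module k V] [AddCommGroup W] [Module k W]
  [AddCommGroup U] [Module k U]

/-- The map `(v ⊗ a) ⊗ (w ⊗ b) ↦ (v ⊗ w) ⊗ a b`. -/
def tmulA (V W A : Type u) [Ring A] [Bialgebra k A] [AddCommGroup V] [Module k V]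
    [AddCommGroup W] [Module k W] : (V ⊗[k] A) ⊗[k] (W ⊗[k] A) →ₗ[k] (V ⊗[k] W) ⊗[k] A :=
  (LinearMap.mul' k A).lTensor (V ⊗[k] W) ∘ₗ
    (TensorProduct.tensorTensorTensorComm k V A W A).toLinearMap

@[simp] theorem tmulA_tmul (v : V) (a : A) (w : W) (b : A) :
    tmulA (k := k) V W A ((v ⊗ₜ a) ⊗ₜ (w ⊗ₜ b)) = (v ⊗ₜ w) ⊗ₜ (a * b) := by
  simp [tmulA]

theorem tensorCoaction_tmul (ρ : V →ₗ[k] V ⊗[k] A) (σ : W →ₗ[k] W ⊗[k] A) (v : V) (w : W) :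
    tensorCoaction ρ σ (v ⊗ₜ w) = tmulA V W A (ρ v ⊗ₜ σ w) := by
  simp [tensorCoaction, tmulA]

theorem tpowCoaction_mulE (ρ : V →ₗ[k] V ⊗[k] A) (a b d : ℕ) (h : a + b = d)
    (x : ⨂[k]^a V) (y : ⨂[k]^b V) :
    tpowCoaction ρ d (mulE V a b d h (x ⊗ₜ y)) =
      (mulE V a b d h).toLinearMap.rTensor A
        (tmulA _ _ A (tpowCoaction ρ a x ⊗ₜ tpowCoaction ρ b y)) := by
  induction b generalizing d with
  | zero =>
    subst h
    have key : ∀ x : ⨂[k]^a V, mulE V a 0 (a + 0) rfl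
        (x ⊗ₜ PiTensorProduct.tprod k (Fin.elim0 : Fin 0 → V)) = x := by
      intro x
      induction x using PiTensorProduct.induction_on with
      | add x x' hx hx' => simp only [map_add, TensorProduct.add_tmul, hx, hx']
      | smul_tprod r x =>
        simp only [← TensorProduct.smul_tmul', map_smul, mulE_tprod]
        congr 2
        funext i
        simp
    induction y using PiTensorProduct.induction_on with
    | add x x' hx hx' => simp only [map_add, TensorProduct.tmul_add, hx, hx']
    | smul_tprod r y =>
      obtain rfl : y = Fin.elim0 := Subsingleton.elim _ _
      simp only [TensorProduct.tmul_smul, map_smul, key]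
      congr 1
      change tpowCoaction ρ a x = _
      change _ = (mulE V a 0 (a + 0) rfl).toLinearMap.rTensor A (tmulA _ _ A (tpowCoaction ρ a x ⊗ₜ
        (PiTensorProduct.tprod k (Fin.elim0 : Fin 0 → V) ⊗ₜ (1 : A))))
      induction tpowCoaction ρ a x using TensorProduct.induction_on with
      | zero => simp
      | add X Y hX hY => simp only [map_add, TensorProduct.add_tmul, ← hX, ← hY]
      | tmul v t =>
        simp only [tmulA_tmul, LinearMap.rTensor_tmul, LinearEquiv.coe_coe, key, mul_one]
  | succ b ih =>
    obtain ⟨y, rfl⟩ := (snocE b).surjective y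
    induction y using TensorProduct.induction_on with
    | zero => simp
    | add x x' hx hx' => simp only [map_add, TensorProduct.tmul_add, hx, hx']
    | tmul y v =>
    obtain rfl : d = (a + b) + 1 := by omega
    have key : ∀ (x : ⨂[k]^a V) (y : ⨂[k]^b V) v, mulE V a (b + 1) (a + b + 1) h
        (x ⊗ₜ snocE b (y ⊗ₜ v)) = snocE (a + b) (mulE V a b (a + b) rfl (x ⊗ₜ y) ⊗ₜ v) := by
      intro x y v
      simp only [snocE, LinearEquiv.trans_apply, TensorProduct.congr_tmul, LinearEquiv.refl_apply]
      rw [mulE_assoc a b 1 (a + b) (b + 1) (a + b + 1) rfl rfl rfl h]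
    rw [key, tpowCoaction_snocE, tpowCoaction_snocE, tensorCoaction_tmul, tensorCoaction_tmul,
      ih (a + b) rfl]
    induction tpowCoaction ρ a x using TensorProduct.induction_on with
    | zero => simp
    | add X Y hX hY => simp only [map_add, TensorProduct.add_tmul, hX, hY]
    | tmul x s =>
    induction tpowCoaction ρ b y using TensorProduct.induction_on with
    | zero => simp
    | add X Y hX hY => simp only [map_add, TensorProduct.add_tmul, TensorProduct.tmul_add, hX, hY]
    | tmul y t =>
    induction ρ v using TensorProduct.induction_on with
    | zero => simp
    | add X Y hX hY => simp only [map_add, TensorProduct.tmul_add, hX, hY]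
    | tmul v r =>
    simp only [tmulA_tmul, LinearMap.rTensor_tmul, LinearEquiv.coe_coe, key, mul_assoc]

theorem tpowCoaction_consE (ρ : V →ₗ[k] V ⊗[k] A) (v : V) :
    tpowCoaction ρ 1 (consE V v) = (consE V).toLinearMap.rTensor A (ρ v) := by
  have key : ∀ v : V, snocE 0 (PiTensorProduct.tprod k (Fin.elim0 : Fin 0 → V) ⊗ₜ v) =
      consE (k := k) V v := by
    intro v
    simp only [snocE, LinearEquiv.trans_apply, TensorProduct.congr_tmul, LinearEquiv.refl_apply,
      consE, PiTensorProduct.subsingletonEquiv_symm_apply, mulE_tprod]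
    congr 1
  rw [← key, tpowCoaction_snocE, tensorCoaction_tmul]
  change (snocE 0).toLinearMap.rTensor A (tmulA _ _ A
    ((PiTensorProduct.tprod k (Fin.elim0 : Fin 0 → V) ⊗ₜ (1 : A)) ⊗ₜ _)) = _
  induction ρ v using TensorProduct.induction_on with
  | zero => simp
  | add X Y hX hY => simp only [map_add, TensorProduct.tmul_add, hX, hY]
  | tmul v r =>
    simp only [tmulA_tmul, LinearMap.rTensor_tmul, LinearEquiv.coe_coe, key, one_mul]

theorem tpowCoaction_pairE (ρ : V →ₗ[k] V ⊗[k] A) (v : V ⊗[k] V) :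
    tpowCoaction ρ 2 (pairE V v) = (pairE V).toLinearMap.rTensor A (tensorCoaction ρ ρ v) := by
  induction v using TensorProduct.induction_on with
  | zero => simp
  | add X Y hX hY => simp only [map_add, hX, hY]
  | tmul v w =>
    rw [tensorCoaction_tmul]
    simp only [pairE, LinearEquiv.trans_apply, TensorProduct.congr_tmul]
    rw [tpowCoaction_mulE, tpowCoaction_consE, tpowCoaction_consE]
    induction ρ v using TensorProduct.induction_on with
    | zero => simp
    | add X Y hX hY => simp only [map_add, TensorProduct.add_tmul, hX, hY]
    | tmul v r =>
    induction ρ w using TensorProduct.induction_on with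
    | zero => simp
    | add X Y hX hY => simp only [map_add, TensorProduct.tmul_add, hX, hY]
    | tmul w s =>
    simp

theorem tpowCoaction_splitE (ρ : V →ₗ[k] V ⊗[k] A) (i c d : ℕ) (h : i + (2 + c) = d)
    (x : ⨂[k]^i V) (v : V ⊗[k] V) (z : ⨂[k]^c V) :
    tpowCoaction ρ d (splitE V i c d h (x ⊗ₜ (v ⊗ₜ z))) =
      (splitE V i c d h).toLinearMap.rTensor A (tmulA _ _ A (tpowCoaction ρ i x ⊗ₜ
        tmulA _ _ A (tensorCoaction ρ ρ v ⊗ₜ tpowCoaction ρ c z))) := by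
  rw [splitE_tmul, tpowCoaction_mulE, tpowCoaction_mulE, tpowCoaction_pairE]
  induction tpowCoaction ρ i x using TensorProduct.induction_on with
  | zero => simp
  | add X Y hX hY => simp only [map_add, TensorProduct.add_tmul, hX, hY]
  | tmul x r =>
  induction tensorCoaction ρ ρ v using TensorProduct.induction_on with
  | zero => simp
  | add X Y hX hY => simp only [map_add, TensorProduct.add_tmul, TensorProduct.tmul_add, hX, hY]
  | tmul v r =>
  induction tpowCoaction ρ c z using TensorProduct.induction_on with
  | zero => simp
  | add X Y hX hY => simp only [map_add, TensorProduct.tmul_add, hX, hY]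
  | tmul z s =>
  simp [splitE_tmul]

theorem braidGen_colinear (ρ : V →ₗ[k] V ⊗[k] A) (T : V ⊗[k] V →ₗ[k] V ⊗[k] V)
    (hT : tensorCoaction ρ ρ ∘ₗ T = T.rTensor A ∘ₗ tensorCoaction ρ ρ)
    (i c d : ℕ) (h : i + (2 + c) = d) :
    tpowCoaction ρ d ∘ₗ braidGen T i c d h = (braidGen T i c d h).rTensor A ∘ₗ tpowCoaction ρ d := by
  refine splitE_ext h fun x v z => ?_
  have hv := DFunLike.congr_fun hT v
  simp only [LinearMap.comp_apply] at hv ⊢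
  rw [braidGen_splitE, tpowCoaction_splitE, tpowCoaction_splitE, hv]
  induction tpowCoaction ρ i x using TensorProduct.induction_on with
  | zero => simp
  | add X Y hX hY => simp only [map_add, TensorProduct.add_tmul, hX, hY]
  | tmul x r =>
  induction tensorCoaction ρ ρ v using TensorProduct.induction_on with
  | zero => simp
  | add X Y hX hY => simp only [map_add, TensorProduct.add_tmul, TensorProduct.tmul_add, hX, hY]
  | tmul v r =>
  induction tpowCoaction ρ c z using TensorProduct.induction_on with
  | zero => simp
  | add X Y hX hY => simp only [map_add, TensorProduct.tmul_add, hX, hY]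
  | tmul z s =>
  simp [braidGen_splitE]

end TensorPowerCoaction

namespace EHeckePair

variable {k : Type u} [Field k] {q : kˣ} {e : ℕ}

/-- The `R`-matrix `R_V = R_{V,V}` of an `e`-Hecke pair. -/
def braiding (V : EHeckePair k q e) : V.carrier ⊗[k] V.carrier →ₗ[k] V.carrier ⊗[k] V.carrier :=
  comoduleBraiding (QMat.univR q V.n) V.coaction V.coaction

theorem braiding_colinear (V : EHeckePair k q e) :
    tensorCoaction V.coaction V.coaction ∘ₗ V.braiding =
      V.braiding.rTensor _ ∘ₗ tensorCoaction V.coaction V.coaction :=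
  comoduleBraiding_colinear V.isCoaction V.isCoaction
    (fun a b a₁ a₂ b₁ b₂ ha hb => FRT.univR_comm _ a b a₁ a₂ b₁ b₂ ha hb)

/-- `Hom_{B_d}(V^{⊗ d}, W^{⊗ d})`: the linear maps that commute with all the operators
`1 ⊗ R ⊗ 1` by which the generators of the braid group `B_d` act. -/
def braidHom (d : ℕ) (V W : EHeckePair k q e) :
    Submodule k ((⨂[k]^d V.carrier) →ₗ[k] (⨂[k]^d W.carrier)) where
  carrier := {f | ∀ (i c : ℕ) (h : i + (2 + c) = d),
    f ∘ₗ braidGen V.braiding i c d h = braidGen W.braiding i c d h ∘ₗ f}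
  add_mem' := by
    intro f g hf hg i c h
    rw [LinearMap.add_comp, LinearMap.comp_add, hf, hg]
  zero_mem' := by intro i c h; simp
  smul_mem' := by
    intro r f hf i c h
    rw [LinearMap.smul_comp, LinearMap.comp_smul, hf]

/-- The space of morphisms `V → W` of the quantum divided power category of degree `d`: the
linear maps `V^{⊗ d} → W^{⊗ d}` that commute with the action of the braid group. -/
def BHom (d : ℕ) (V W : EHeckePair k q e) : Type u := ↥(braidHom d V W)

instance (d : ℕ) (V W : EHeckePair k q e) : AddCommGroup (BHom d V W) :=
  inferInstanceAs (AddCommGroup ↥(braidHom d V W))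

instance (d : ℕ) (V W : EHeckePair k q e) : Module k (BHom d V W) :=
  inferInstanceAs (Module k ↥(braidHom d V W))

/-- The linear map `V^{⊗ d} → W^{⊗ d}` underlying a morphism. -/
def BHom.val {d : ℕ} {V W : EHeckePair k q e} :
    BHom d V W →ₗ[k] ((⨂[k]^d V.carrier) →ₗ[k] (⨂[k]^d W.carrier)) :=
  (braidHom d V W).subtype

theorem BHom.val_injective {d : ℕ} {V W : EHeckePair k q e} :
    Function.Injective (BHom.val (d := d) (V := V) (W := W)) :=
  Submodule.subtype_injective _

theorem BHom.val_mem {d : ℕ} {V W : EHeckePair k q e} (f : BHom d V W) : f.val ∈ braidHom d V W :=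
  Subtype.property f

/-- A morphism from a linear map that commutes with the braid group. -/
def BHom.mk {d : ℕ} {V W : EHeckePair k q e} (f : (⨂[k]^d V.carrier) →ₗ[k] (⨂[k]^d W.carrier))
    (hf : f ∈ braidHom d V W) : BHom d V W := ⟨f, hf⟩

@[simp] theorem BHom.val_mk {d : ℕ} {V W : EHeckePair k q e}
    (f : (⨂[k]^d V.carrier) →ₗ[k] (⨂[k]^d W.carrier)) (hf : f ∈ braidHom d V W) :
    (BHom.mk f hf).val = f := rfl

theorem id_mem (d : ℕ) (V : EHeckePair k q e) : LinearMap.id ∈ braidHom d V V := fun _ _ _ => rfl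

theorem comp_mem {d : ℕ} {V W U : EHeckePair k q e} {g : (⨂[k]^d W.carrier) →ₗ[k] (⨂[k]^d U.carrier)}
    {f : (⨂[k]^d V.carrier) →ₗ[k] (⨂[k]^d W.carrier)}
    (hg : g ∈ braidHom d W U) (hf : f ∈ braidHom d V W) : g ∘ₗ f ∈ braidHom d V U := by
  intro i c h
  rw [LinearMap.comp_assoc, hf, ← LinearMap.comp_assoc, hg, LinearMap.comp_assoc]

theorem exists_univ (d : ℕ) (V : EHeckePair k q e) :
    ∃ y : (BHom d V V) ⊗[k] (QMat q V.n), TensorProduct.rTensorHomToHomRTensor (.id k) _ _ _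
      ((BHom.val (V := V) (W := V)).rTensor _ y) = tpowCoaction V.coaction d := by
  obtain ⟨z, hz⟩ := (rTensorHomEquivHomRTensor k (⨂[k]^d V.carrier) (⨂[k]^d V.carrier)
    (QMat q V.n)).surjective (tpowCoaction V.coaction d)
  have hz' : TensorProduct.rTensorHomToHomRTensor (.id k) _ _ _ z = tpowCoaction V.coaction d := by
    rw [← hz, ← rTensorHomEquivHomRTensor_toLinearMap]; rfl
  have hs : ∀ (z : ((⨂[k]^d V.carrier) →ₗ[k] (⨂[k]^d V.carrier)) ⊗[k] QMat q V.n)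
      (φ : Module.Dual k (QMat q V.n)), TensorProduct.rid k _ (φ.lTensor _ z) =
      (TensorProduct.rid k _).toLinearMap ∘ₗ φ.lTensor _ ∘ₗ
        TensorProduct.rTensorHomToHomRTensor (.id k) _ _ _ z := by
    intro z φ
    induction z using TensorProduct.induction_on with
    | zero => simp
    | tmul f a => ext x; simp
    | add x y hx hy => simp only [map_add, hx, hy, LinearMap.comp_add]
  obtain ⟨y, hy⟩ := mem_range_of_slices (BHom.val (d := d) (V := V) (W := V)) z (by
    intro φ
    refine ⟨BHom.mk _ ?_, BHom.val_mk _ _⟩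
    intro i c h
    rw [hs, hz']
    have hc := braidGen_colinear V.coaction V.braiding V.braiding_colinear i c d h
    rw [LinearMap.comp_assoc, LinearMap.comp_assoc, hc]
    simp only [← LinearMap.comp_assoc]
    congr 1
    refine TensorProduct.ext' fun x y => ?_
    simp)
  exact ⟨y, by rw [hy, hz']⟩

/-- The action of `A_q(n,n)` on `V^{⊗ d}` in universal form: the unique element of
`End_{B_d}(V^{⊗ d}) ⊗ A_q(n,n)` that corresponds to the coaction on `V^{⊗ d}` under
`End(V^{⊗ d}) ⊗ A ≃ Hom(V^{⊗ d}, V^{⊗ d} ⊗ A)` (unique because this map is injective). -/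
def univ (d : ℕ) (V : EHeckePair k q e) : (BHom d V V) ⊗[k] (QMat q V.n) :=
  (exists_univ d V).choose

theorem univ_spec (d : ℕ) (V : EHeckePair k q e) :
    TensorProduct.rTensorHomToHomRTensor (.id k) _ _ _
      ((BHom.val (V := V) (W := V)).rTensor _ (univ d V)) = tpowCoaction V.coaction d :=
  (exists_univ d V).choose_spec

end EHeckePair

section LinAlg
variable {k : Type u} [Field k]

theorem mem_range_of_slices₂ {K L X Y : Type*} [AddCommGroup K] [Module k K] [AddCommGroup L]
    [Module k L] [AddCommGroup X] [Module k X] [AddCommGroup Y] [Module k Y]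
    (ι : K →ₗ[k] X) (hι : Function.Injective ι) (κ : L →ₗ[k] Y) (z : X ⊗[k] Y)
    (h1 : ∀ φ : Module.Dual k Y, ∃ y, ι y = TensorProduct.rid k X (φ.lTensor X z))
    (h2 : ∀ φ : Module.Dual k X, ∃ y, κ y = TensorProduct.lid k Y (φ.rTensor Y z)) :
    ∃ y : K ⊗[k] L, TensorProduct.map ι κ y = z := by
  obtain ⟨y, rfl⟩ := mem_range_of_slices ι z h1
  obtain ⟨w, hw⟩ := mem_range_of_slices κ (TensorProduct.comm k K Y y) (by
    intro φ
    obtain ⟨g, hg⟩ := LinearMap.exists_leftInverse_of_injective ι (LinearMap.ker_eq_bot.2 hι)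
    obtain ⟨x, hx⟩ := h2 (φ ∘ₗ g)
    refine ⟨x, hx.trans ?_⟩
    clear h1 h2 hx
    have hg' : ∀ x, g (ι x) = x := fun x => DFunLike.congr_fun hg x
    induction y using TensorProduct.induction_on with
    | zero => simp
    | tmul x y => simp [hg']
    | add x y hx hy => simp only [map_add, hx, hy])
  refine ⟨TensorProduct.comm k L K w, ?_⟩
  have hy : y = TensorProduct.comm k Y K (κ.rTensor K w) := by
    rw [hw]; simp
  rw [hy]
  clear hw hy h1 h2
  induction w using TensorProduct.induction_on with
  | zero => simp
  | tmul x y => simp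
  | add x y hx hy => simp only [map_add, hx, hy]

theorem homTensorHomMap_injective (M N P Q : Type u) [AddCommGroup M] [Module k M] [AddCommGroup N]
    [Module k N] [AddCommGroup P] [Module k P] [AddCommGroup Q] [Module k Q]
    [FiniteDimensional k M] [FiniteDimensional k N] :
    Function.Injective (TensorProduct.homTensorHomMap (.id k) M N P Q) := by
  rw [← homTensorHomEquiv_toLinearMap]
  exact (homTensorHomEquiv k M N P Q).injective

theorem slice_left (M N P Q : Type u) [AddCommGroup M] [Module k M] [AddCommGroup N]
    [Module k N] [AddCommGroup P] [Module k P] [AddCommGroup Q] [Module k Q]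
    [FiniteDimensional k M] [FiniteDimensional k N] (S : M →ₗ[k] M) (T : P →ₗ[k] P)
    (z : (M →ₗ[k] P) ⊗[k] (N →ₗ[k] Q))
    (hz : TensorProduct.homTensorHomMap (.id k) M N P Q z ∘ₗ S.rTensor N =
      T.rTensor Q ∘ₗ TensorProduct.homTensorHomMap (.id k) M N P Q z)
    (φ : Module.Dual k (N →ₗ[k] Q)) :
    TensorProduct.rid k (M →ₗ[k] P) (φ.lTensor _ z) ∘ₗ S =
      T ∘ₗ TensorProduct.rid k (M →ₗ[k] P) (φ.lTensor _ z) := by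
  have e1 : ∀ z, TensorProduct.homTensorHomMap (.id k) M N P Q
      ((LinearMap.lcomp k P S).rTensor _ z) =
      TensorProduct.homTensorHomMap (.id k) M N P Q z ∘ₗ S.rTensor N := by
    intro z
    induction z using TensorProduct.induction_on with
    | zero => simp
    | tmul x y => refine TensorProduct.ext' fun u v => ?_; simp
    | add x y hx hy => simp only [map_add, hx, hy, LinearMap.add_comp]
  have e2 : ∀ z, TensorProduct.homTensorHomMap (.id k) M N P Q
      ((LinearMap.llcomp k M P P T).rTensor _ z) =
      T.rTensor Q ∘ₗ TensorProduct.homTensorHomMap (.id k) M N P Q z := by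
    intro z
    induction z using TensorProduct.induction_on with
    | zero => simp
    | tmul x y => refine TensorProduct.ext' fun u v => ?_; simp
    | add x y hx hy => simp only [map_add, hx, hy, LinearMap.comp_add]
  have hh : ∀ (D : (M →ₗ[k] P) →ₗ[k] (M →ₗ[k] P)) z,
      D (TensorProduct.rid k _ (φ.lTensor _ z)) =
        TensorProduct.rid k _ (φ.lTensor _ (D.rTensor _ z)) := by
    intro D z
    induction z using TensorProduct.induction_on with
    | zero => simp
    | tmul x y => simp
    | add x y hx hy => simp only [map_add, hx, hy]
  have := homTensorHomMap_injective M N P Q ((e1 z).trans (hz.trans (e2 z).symm))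
  have h1 := hh (LinearMap.lcomp k P S) z
  have h2 := hh (LinearMap.llcomp k M P P T) z
  rw [this, ← h2] at h1
  exact h1

theorem slice_right (M N P Q : Type u) [AddCommGroup M] [Module k M] [AddCommGroup N]
    [Module k N] [AddCommGroup P] [Module k P] [AddCommGroup Q] [Module k Q]
    [FiniteDimensional k M] [FiniteDimensional k N] (S : N →ₗ[k] N) (T : Q →ₗ[k] Q)
    (z : (M →ₗ[k] P) ⊗[k] (N →ₗ[k] Q))
    (hz : TensorProduct.homTensorHomMap (.id k) M N P Q z ∘ₗ S.lTensor M =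
      T.lTensor P ∘ₗ TensorProduct.homTensorHomMap (.id k) M N P Q z)
    (φ : Module.Dual k (M →ₗ[k] P)) :
    TensorProduct.lid k (N →ₗ[k] Q) (φ.rTensor _ z) ∘ₗ S =
      T ∘ₗ TensorProduct.lid k (N →ₗ[k] Q) (φ.rTensor _ z) := by
  have e1 : ∀ z, TensorProduct.homTensorHomMap (.id k) M N P Q
      ((LinearMap.lcomp k Q S).lTensor _ z) =
      TensorProduct.homTensorHomMap (.id k) M N P Q z ∘ₗ S.lTensor M := by
    intro z
    induction z using TensorProduct.induction_on with
    | zero => simp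
    | tmul x y => refine TensorProduct.ext' fun u v => ?_; simp
    | add x y hx hy => simp only [map_add, hx, hy, LinearMap.add_comp]
  have e2 : ∀ z, TensorProduct.homTensorHomMap (.id k) M N P Q
      ((LinearMap.llcomp k N Q Q T).lTensor _ z) =
      T.lTensor P ∘ₗ TensorProduct.homTensorHomMap (.id k) M N P Q z := by
    intro z
    induction z using TensorProduct.induction_on with
    | zero => simp
    | tmul x y => refine TensorProduct.ext' fun u v => ?_; simp
    | add x y hx hy => simp only [map_add, hx, hy, LinearMap.comp_add]
  have hh : ∀ (D : (N →ₗ[k] Q) →ₗ[k] (N →ₗ[k] Q)) z,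
      D (TensorProduct.lid k _ (φ.rTensor _ z)) =
        TensorProduct.lid k _ (φ.rTensor _ (D.lTensor _ z)) := by
    intro D z
    induction z using TensorProduct.induction_on with
    | zero => simp
    | tmul x y => simp
    | add x y hx hy => simp only [map_add, hx, hy]
  have := homTensorHomMap_injective M N P Q ((e1 z).trans (hz.trans (e2 z).symm))
  have h1 := hh (LinearMap.lcomp k Q S) z
  have h2 := hh (LinearMap.llcomp k N Q Q T) z
  rw [this, ← h2] at h1
  exact h1

theorem arrowCongr_injective {M N P Q : Type u} [AddCommGroup M] [Module k M] [AddCommGroup N]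
    [Module k N] [AddCommGroup P] [Module k P] [AddCommGroup Q] [Module k Q]
    (E : M ≃ₗ[k] N) (E' : P ≃ₗ[k] Q) : 
    Function.Injective (LinearEquiv.arrowCongr E E' : (M →ₗ[k] P) ≃ₗ[k] (N →ₗ[k] Q)) :=
  LinearEquiv.injective _

theorem map_injective' {X Y X' Y' : Type u} [AddCommGroup X] [Module k X] [AddCommGroup Y]
    [Module k Y] [AddCommGroup X'] [Module k X'] [AddCommGroup Y'] [Module k Y']
    {f : X →ₗ[k] X'} {g : Y →ₗ[k] Y'} (hf : Function.Injective f) (hg : Function.Injective g) :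
    Function.Injective (TensorProduct.map f g) :=
  TensorProduct.map_injective_of_flat_flat _ _ hf hg

end LinAlg

namespace EHeckePair
variable {k : Type u} [Field k] {q : kˣ} {e : ℕ}

section Res
variable {a b d : ℕ} (h : a + b = d)

/-- The inclusion `Hom_{B_a} ⊗ Hom_{B_b} → Hom(V^{⊗ d}, W^{⊗ d})`. -/
def inclHom (V W : EHeckePair k q e) :
    (BHom a V W) ⊗[k] (BHom b V W) →ₗ[k] ((⨂[k]^d V.carrier) →ₗ[k] (⨂[k]^d W.carrier)) :=
  (LinearEquiv.arrowCongr (mulE V.carrier a b d h) (mulE W.carrier a b d h)).toLinearMap ∘ₗ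
    TensorProduct.homTensorHomMap (.id k) _ _ _ _ ∘ₗ
    TensorProduct.map BHom.val BHom.val

theorem inclHom_tmul (V W : EHeckePair k q e) (f : BHom a V W) (g : BHom b V W)
    (x : ⨂[k]^a V.carrier) (y : ⨂[k]^b V.carrier) :
    inclHom h V W (f ⊗ₜ g) (mulE V.carrier a b d h (x ⊗ₜ y)) =
      mulE W.carrier a b d h (f.val x ⊗ₜ g.val y) := by
  simp [inclHom, LinearEquiv.arrowCongr_apply]

theorem inclHom_injective (V W : EHeckePair k q e) :
    Function.Injective (inclHom (a := a) (b := b) h V W) := by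
  have h1 := arrowCongr_injective (k := k) (mulE V.carrier a b d h) (mulE W.carrier a b d h)
  have h2 := homTensorHomMap_injective (k := k) (⨂[k]^a V.carrier) (⨂[k]^b V.carrier)
    (⨂[k]^a W.carrier) (⨂[k]^b W.carrier)
  exact h1.comp (h2.comp (map_injective' (BHom.val_injective (V := V) (W := W)) (BHom.val_injective (V := V) (W := W))))

theorem mulE_ext {V : Type u} [AddCommGroup V] [Module k V] {M : Type*} [AddCommGroup M] [Module k M]
    {f g : (⨂[k]^d V) →ₗ[k] M}
    (hfg : ∀ x y, f (mulE V a b d h (x ⊗ₜ y)) = g (mulE V a b d h (x ⊗ₜ y))) : f = g := by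
  have : f ∘ₗ (mulE V a b d h).toLinearMap = g ∘ₗ (mulE V a b d h).toLinearMap :=
    TensorProduct.ext' hfg
  ext1
  ext y
  have := DFunLike.congr_fun this ((mulE V a b d h).symm (PiTensorProduct.tprod k y))
  simpa using this

theorem braidHom_le_range (V W : EHeckePair k q e) :
    LinearMap.range (BHom.val (d := d) (V := V) (W := W)) ≤
      LinearMap.range (inclHom (a := a) (b := b) h V W) := by
  rintro _ ⟨f, rfl⟩
  have hf := f.val_mem
  generalize f.val = f at hf
  obtain ⟨z, hz⟩ := (homTensorHomEquiv k (⨂[k]^a V.carrier) (⨂[k]^b V.carrier) (⨂[k]^a W.carrier)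
    (⨂[k]^b W.carrier)).surjective
    ((LinearEquiv.arrowCongr (mulE V.carrier a b d h) (mulE W.carrier a b d h)).symm f)
  replace hz : TensorProduct.homTensorHomMap (.id k) _ _ _ _ z =
      ((LinearEquiv.arrowCongr (mulE V.carrier a b d h) (mulE W.carrier a b d h)).symm f) := by
    rw [← hz, ← homTensorHomEquiv_toLinearMap]; rfl
  have hz' : ∀ x y, mulE W.carrier a b d h (TensorProduct.homTensorHomMap (.id k) _ _ _ _ z (x ⊗ₜ y)) =
      f (mulE V.carrier a b d h (x ⊗ₜ y)) := by
    intro x y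
    rw [hz]
    simp [LinearEquiv.arrowCongr_symm_apply]
  obtain ⟨y, hy⟩ := mem_range_of_slices₂ (BHom.val (d := a) (V := V) (W := W)) BHom.val_injective
    (BHom.val (d := b) (V := V) (W := W)) z (by
    intro φ
    refine ⟨BHom.mk _ ?_, BHom.val_mk _ _⟩
    intro i c hi
    apply slice_left
    refine TensorProduct.ext' fun x y => ?_
    apply (mulE W.carrier a b d h).injective
    simp only [LinearMap.comp_apply, LinearMap.rTensor_tmul, hz']
    rw [← braidGen_mulE_left]
    have := DFunLike.congr_fun (hf i (c + b) (by omega)) (mulE V.carrier a b d h (x ⊗ₜ y))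
    simp only [LinearMap.comp_apply] at this
    rw [this, ← hz']
    generalize TensorProduct.homTensorHomMap (.id k) _ _ _ _ z (x ⊗ₜ[k] y) = w
    induction w using TensorProduct.induction_on with
    | zero => simp
    | tmul x y => rw [braidGen_mulE_left _ _ _ _ _ _ hi]; simp
    | add x y hx hy => simp only [map_add, hx, hy]) (by
    intro φ
    refine ⟨BHom.mk _ ?_, BHom.val_mk _ _⟩
    intro i c hi
    apply slice_right
    refine TensorProduct.ext' fun x y => ?_
    apply (mulE W.carrier a b d h).injective
    simp only [LinearMap.comp_apply, LinearMap.lTensor_tmul, hz']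
    rw [← braidGen_mulE_right]
    have := DFunLike.congr_fun (hf (a + i) c (by omega)) (mulE V.carrier a b d h (x ⊗ₜ y))
    simp only [LinearMap.comp_apply] at this
    rw [this, ← hz']
    generalize TensorProduct.homTensorHomMap (.id k) _ _ _ _ z (x ⊗ₜ[k] y) = w
    induction w using TensorProduct.induction_on with
    | zero => simp
    | tmul x y => rw [braidGen_mulE_right _ _ _ _ _ _ hi]; simp
    | add x y hx hy => simp only [map_add, hx, hy])
  refine ⟨y, ?_⟩
  simp only [inclHom, LinearMap.comp_apply, hy, hz]
  simp

/-- Restriction along `B_a × B_b ⊂ B_d`, as a map `Hom_{B_d} → Hom_{B_a} ⊗ Hom_{B_b}`: every linear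
map `V^{⊗ d} → W^{⊗ d}` commuting with `B_a × B_b` comes from a unique element of the right-hand
side. -/
def res (V W : EHeckePair k q e) : BHom d V W →ₗ[k] (BHom a V W) ⊗[k] (BHom b V W) :=
  (LinearEquiv.ofInjective _ (inclHom_injective (a := a) (b := b) h V W)).symm.toLinearMap ∘ₗ
    BHom.val.codRestrict (LinearMap.range (inclHom (a := a) (b := b) h V W))
      (fun f => braidHom_le_range h V W ⟨f, rfl⟩)

theorem inclHom_res (V W : EHeckePair k q e) (f : BHom d V W) :
    inclHom (a := a) (b := b) h V W (res h V W f) = f.val := by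
  have := LinearEquiv.apply_symm_apply
    (LinearEquiv.ofInjective _ (inclHom_injective (a := a) (b := b) h V W))
    (BHom.val.codRestrict (LinearMap.range (inclHom (a := a) (b := b) h V W))
      (fun f => braidHom_le_range h V W ⟨f, rfl⟩) f)
  exact congrArg Subtype.val this

theorem res_eq {V W : EHeckePair k q e} {f : BHom d V W}
    {s : (BHom a V W) ⊗[k] (BHom b V W)} (hs : inclHom h V W s = f.val) :
    res h V W f = s :=
  inclHom_injective h V W (by rw [inclHom_res, hs])

end Res

/-- The identity morphism. -/
def BHom.id (d : ℕ) (V : EHeckePair k q e) : BHom d V V := BHom.mk LinearMap.id (id_mem d V)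

/-- Composition of morphisms, as a bilinear map. -/
def compHom (d : ℕ) (V W U : EHeckePair k q e) :
    BHom d W U →ₗ[k] BHom d V W →ₗ[k] BHom d V U :=
  LinearMap.mk₂ k (fun g f => BHom.mk (g.val ∘ₗ f.val) (comp_mem g.val_mem f.val_mem))
    (by intros; apply BHom.val_injective; simp [LinearMap.add_comp])
    (by intros; apply BHom.val_injective; simp [LinearMap.smul_comp])
    (by intros; apply BHom.val_injective; simp [LinearMap.comp_add])
    (by intros; apply BHom.val_injective; simp [LinearMap.comp_smul])

theorem compHom_val {d : ℕ} {V W U : EHeckePair k q e} (g : BHom d W U) (f : BHom d V W) :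
    (compHom d V W U g f).val = g.val ∘ₗ f.val := rfl

theorem res_id {a b d : ℕ} (h : a + b = d) (V : EHeckePair k q e) :
    res h V V (BHom.id d V) = BHom.id a V ⊗ₜ BHom.id b V := by
  apply res_eq
  refine mulE_ext h fun x y => ?_
  rw [inclHom_tmul]
  rfl

theorem res_comp {a b d : ℕ} (h : a + b = d) {V W U : EHeckePair k q e} (g : BHom d W U)
    (f : BHom d V W) : res h V U (compHom d V W U g f) =
      TensorProduct.map₂ (compHom a V W U) (compHom b V W U) (res h W U g) (res h V W f) := by
  apply res_eq
  have key : ∀ s t, inclHom h V U (TensorProduct.map₂ (compHom a V W U) (compHom b V W U) s t) =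
      inclHom h W U s ∘ₗ inclHom h V W t := by
    intro s t
    induction s using TensorProduct.induction_on with
    | zero => simp
    | add x y hx hy => simp only [map_add, LinearMap.add_apply, hx, hy, LinearMap.add_comp]
    | tmul s s' =>
    induction t using TensorProduct.induction_on with
    | zero => simp
    | add x y hx hy => simp only [map_add, hx, hy, LinearMap.comp_add]
    | tmul t t' =>
    refine mulE_ext h fun x y => ?_
    rw [TensorProduct.map₂_apply_tmul, TensorProduct.map_tmul, inclHom_tmul, LinearMap.comp_apply, inclHom_tmul, inclHom_tmul]
    rfl
  rw [key, inclHom_res, inclHom_res]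
  rfl

theorem res_assoc {a b c ab bc d : ℕ} (h1 : a + b = ab) (h2 : ab + c = d) (h3 : b + c = bc)
    (h4 : a + bc = d) {V W : EHeckePair k q e} (f : BHom d V W) :
    TensorProduct.assoc k _ _ _ ((res h1 V W).rTensor _ (res h2 V W f)) =
      (res h3 V W).lTensor _ (res h4 V W f) := by
  let I : (BHom a V W) ⊗[k] ((BHom b V W) ⊗[k] (BHom c V W)) →ₗ[k]
      ((⨂[k]^d V.carrier) →ₗ[k] (⨂[k]^d W.carrier)) :=
    (LinearEquiv.arrowCongr (mulE V.carrier a bc d h4) (mulE W.carrier a bc d h4)).toLinearMap ∘ₗ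
    TensorProduct.homTensorHomMap (.id k) _ _ _ _ ∘ₗ
    TensorProduct.map (BHom.val (d := a) (V := V) (W := W)) (inclHom h3 V W)
  have hI : ∀ f s x y, I (f ⊗ₜ s) (mulE V.carrier a bc d h4 (x ⊗ₜ y)) =
      mulE W.carrier a bc d h4 (f.val x ⊗ₜ inclHom h3 V W s y) := by
    intro f s x y
    simp [I, LinearEquiv.arrowCongr_apply]
  have hinj : Function.Injective I := by
    have h1 := arrowCongr_injective (k := k) (mulE V.carrier a bc d h4) (mulE W.carrier a bc d h4)
    have h2 := homTensorHomMap_injective (k := k) (⨂[k]^a V.carrier) (⨂[k]^bc V.carrier)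
      (⨂[k]^a W.carrier) (⨂[k]^bc W.carrier)
    have h5 : Function.Injective (TensorProduct.map (BHom.val (d := a) (V := V) (W := W))
        (inclHom (a := b) (b := c) h3 V W)) :=
      map_injective' BHom.val_injective (inclHom_injective h3 V W)
    exact h1.comp (h2.comp h5)
  have hl : ∀ s, I ((res h3 V W).lTensor _ s) = inclHom h4 V W s := by
    intro s
    induction s using TensorProduct.induction_on with
    | zero => simp
    | add x y hx hy => simp only [map_add, hx, hy]
    | tmul s t =>
      refine mulE_ext h4 fun x y => ?_
      rw [LinearMap.lTensor_tmul, hI, inclHom_tmul, inclHom_res]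
  have hr0 : ∀ (s : (BHom a V W) ⊗[k] (BHom b V W)) (w : BHom c V W) x y z,
      I (TensorProduct.assoc k _ _ _ (s ⊗ₜ w)) (mulE V.carrier ab c d h2
        (mulE V.carrier a b ab h1 (x ⊗ₜ y) ⊗ₜ z)) =
      mulE W.carrier ab c d h2 (inclHom h1 V W s (mulE V.carrier a b ab h1 (x ⊗ₜ y)) ⊗ₜ w.val z) := by
    intro s w x y z
    induction s using TensorProduct.induction_on with
    | zero => simp
    | add s s' hs hs' =>
      simp only [map_add, TensorProduct.add_tmul, LinearMap.add_apply, hs, hs']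
    | tmul s t =>
      rw [TensorProduct.assoc_tmul, mulE_assoc a b c ab bc d h1 h2 h3 h4, hI, inclHom_tmul,
        inclHom_tmul, mulE_assoc a b c ab bc d h1 h2 h3 h4]
  have hr : ∀ s, I (TensorProduct.assoc k _ _ _ ((res h1 V W).rTensor _ s)) = inclHom h2 V W s := by
    intro s
    induction s using TensorProduct.induction_on with
    | zero => simp
    | add x y hx hy => simp only [map_add, hx, hy]
    | tmul s t =>
      refine mulE_ext h2 fun x z => ?_
      obtain ⟨x, rfl⟩ := (mulE V.carrier a b ab h1).surjective x
      induction x using TensorProduct.induction_on with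
      | zero => simp
      | add x y hx hy => simp only [map_add, TensorProduct.add_tmul, hx, hy]
      | tmul x y => rw [LinearMap.rTensor_tmul, hr0, inclHom_res, inclHom_tmul]
  apply hinj
  rw [hl, hr, inclHom_res, inclHom_res]

end EHeckePair

/-- The objects of the quantum divided power category `Γ^d_{q,e}` are the `e`-Hecke pairs. -/
structure Gamma (k : Type u) [Field k] (q : kˣ) (e d : ℕ) : Type (u + 1) where
  pair : EHeckePair k q e

namespace Gamma
open EHeckePair
variable {k : Type u} [Field k] {q : kˣ} {e d : ℕ}

instance : Category.{u} (Gamma k q e d) where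
  Hom V W := BHom d V.pair W.pair
  id V := BHom.id d V.pair
  comp f g := compHom d _ _ _ g f
  id_comp _ := BHom.val_injective rfl
  comp_id _ := BHom.val_injective rfl
  assoc _ _ _ := BHom.val_injective rfl

instance : Preadditive (Gamma k q e d) where
  homGroup V W := inferInstanceAs (AddCommGroup (BHom d V.pair W.pair))
  add_comp V W U f g h := LinearMap.map_add (compHom d V.pair W.pair U.pair h) f g
  comp_add V W U f g h := LinearMap.map_add₂ (compHom d V.pair W.pair U.pair) g h f

instance : Linear k (Gamma k q e d) where
  homModule V W := inferInstanceAs (Module k (BHom d V.pair W.pair))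
  smul_comp V W U r f g := LinearMap.map_smul (compHom d V.pair W.pair U.pair g) r f
  comp_smul V W U f r g := LinearMap.map_smul₂ (compHom d V.pair W.pair U.pair) r g f

end Gamma

/-- The `k`-linear functors (additive functors that preserve scalar multiplication). -/
def IsPolynomial (k : Type u) [Field k] (q : kˣ) (e d : ℕ) :
    ObjectProperty (Gamma k q e d ⥤ FGModuleCat.{u} k) :=
  fun F => F.Additive ∧ F.Linear k

/-- The category `P^d_{q,e}` of quantum polynomial functors of degree `d` on `e`-Hecke pairs:
linear functors to finite dimensional vector spaces, with natural transformations. -/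
abbrev PolyFun (k : Type u) [Field k] (q : kˣ) (e d : ℕ) : Type (u + 1) :=
  (IsPolynomial k q e d).FullSubcategory

namespace PolyFun
open EHeckePair
variable {k : Type u} [Field k] {q : kˣ} {e d : ℕ}

/-- The vector space `F(V)`. -/
def sp (F : PolyFun k q e d) (V : EHeckePair k q e) : Type u := (F.obj.obj ⟨V⟩).obj

instance (F : PolyFun k q e d) (V : EHeckePair k q e) : AddCommGroup (F.sp V) :=
  inferInstanceAs (AddCommGroup (F.obj.obj ⟨V⟩).obj)

instance (F : PolyFun k q e d) (V : EHeckePair k q e) : Module k (F.sp V) :=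
  inferInstanceAs (Module k (F.obj.obj ⟨V⟩).obj)

instance (F : PolyFun k q e d) (V : EHeckePair k q e) : FiniteDimensional k (F.sp V) :=
  (F.obj.obj ⟨V⟩).property

/-- The linear map `F_{V,W} : Hom(V, W) → Hom(F(V), F(W))`. -/
def act (F : PolyFun k q e d) (V W : EHeckePair k q e) : BHom d V W →ₗ[k] (F.sp V →ₗ[k] F.sp W) where
  toFun f := (F.obj.map (X := ⟨V⟩) (Y := ⟨W⟩) f).hom.hom
  map_add' f g := by
    have := F.property.1
    exact congrArg (fun h => h.hom.hom) (F.obj.map_add (X := ⟨V⟩) (Y := ⟨W⟩) (f := f) (g := g))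
  map_smul' r f := congrArg (fun h => h.hom.hom) (F.property.2.map_smul (X := ⟨V⟩) (Y := ⟨W⟩) f r)

theorem act_id (F : PolyFun k q e d) (V : EHeckePair k q e) (x : F.sp V) :
    F.act V V (BHom.id d V) x = x :=
  DFunLike.congr_fun (congrArg (fun h => h.hom.hom) (F.obj.map_id ⟨V⟩)) x

theorem act_comp (F : PolyFun k q e d) {V W U : EHeckePair k q e} (g : BHom d W U) (f : BHom d V W)
    (x : F.sp V) : F.act V U (compHom d V W U g f) x = F.act W U g (F.act V W f x) :=
  DFunLike.congr_fun (congrArg (fun h => h.hom.hom)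
    (F.obj.map_comp (X := ⟨V⟩) (Y := ⟨W⟩) (Z := ⟨U⟩) f g)) x

/-- Build a polynomial functor from spaces and linear actions. -/
def ofAct (S : EHeckePair k q e → Type u) [∀ V, AddCommGroup (S V)] [∀ V, Module k (S V)]
    [∀ V, FiniteDimensional k (S V)]
    (act : ∀ V W, BHom d V W →ₗ[k] (S V →ₗ[k] S W))
    (hid : ∀ V, act V V (BHom.id d V) = LinearMap.id)
    (hcomp : ∀ V W U g f, act V U (compHom d V W U g f) = act W U g ∘ₗ act V W f) :
    PolyFun k q e d where
  obj :=
    { obj := fun V => FGModuleCat.of k (S V.pair)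
      map := fun f => FGModuleCat.ofHom (act _ _ f)
      map_id := fun V => FGModuleCat.hom_ext (hid V.pair)
      map_comp := fun f g => FGModuleCat.hom_ext (hcomp _ _ _ g f) }
  property := by
    refine ⟨⟨fun {V W f g} => FGModuleCat.hom_ext (LinearMap.map_add (act V.pair W.pair) f g)⟩,
      ⟨fun {V W} f r => FGModuleCat.hom_ext (LinearMap.map_smul (act V.pair W.pair) r f)⟩⟩

section ofAct
variable {S : EHeckePair k q e → Type u} [∀ V, AddCommGroup (S V)] [∀ V, Module k (S V)]
    [∀ V, FiniteDimensional k (S V)]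
    {act : ∀ V W, BHom d V W →ₗ[k] (S V →ₗ[k] S W)}
    {hid : ∀ V, act V V (BHom.id d V) = LinearMap.id}
    {hcomp : ∀ V W U g f, act V U (compHom d V W U g f) = act W U g ∘ₗ act V W f}

/-- The value of `ofAct S` at `V` is `S V`. -/
def ofActE (hid : ∀ V, act V V (BHom.id d V) = LinearMap.id)
    (hcomp : ∀ V W U g f, act V U (compHom d V W U g f) = act W U g ∘ₗ act V W f)
    (V : EHeckePair k q e) : S V ≃ₗ[k] (ofAct S act hid hcomp).sp V :=
  LinearEquiv.refl k (S V)

theorem ofAct_act (V W : EHeckePair k q e) (f : BHom d V W) (x : S V) :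
    (ofAct S act hid hcomp).act V W f (ofActE hid hcomp V x) = ofActE hid hcomp W (act V W f x) :=
  rfl

end ofAct

variable {F G H : PolyFun k q e d}

/-- The component `F(V) → G(V)` of a natural transformation. -/
def app (α : F ⟶ G) (V : EHeckePair k q e) : F.sp V →ₗ[k] G.sp V := (α.hom.app ⟨V⟩).hom.hom

theorem app_act (α : F ⟶ G) {V W : EHeckePair k q e} (f : BHom d V W) (x : F.sp V) :
    app α W (F.act V W f x) = G.act V W f (app α V x) :=
  DFunLike.congr_fun (congrArg (fun h => h.hom.hom) (α.hom.naturality (X := ⟨V⟩) (Y := ⟨W⟩) f)) x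

@[simp] theorem app_id (V : EHeckePair k q e) (x : F.sp V) : app (𝟙 F) V x = x := rfl

@[simp] theorem app_comp (α : F ⟶ G) (β : G ⟶ H) (V : EHeckePair k q e) (x : F.sp V) :
    app (α ≫ β) V x = app β V (app α V x) := rfl

/-- A natural transformation from its components. -/
def mkHom (η : ∀ V, F.sp V →ₗ[k] G.sp V)
    (hη : ∀ {V W : EHeckePair k q e} (f : BHom d V W), η W ∘ₗ F.act V W f = G.act V W f ∘ₗ η V) :
    F ⟶ G :=
  ObjectProperty.homMk
    { app := fun V => InducedCategory.homMk (ModuleCat.ofHom (η V.pair))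
      naturality := fun _ _ f => FGModuleCat.hom_ext (hη f) }

@[simp] theorem app_mkHom (η : ∀ V, F.sp V →ₗ[k] G.sp V)
    (hη : ∀ {V W : EHeckePair k q e} (f : BHom d V W), η W ∘ₗ F.act V W f = G.act V W f ∘ₗ η V)
    (V : EHeckePair k q e) : app (mkHom η hη) V = η V := rfl

theorem hom_ext {α β : F ⟶ G} (h : ∀ V, app α V = app β V) : α = β := by
  apply ObjectProperty.hom_ext
  apply NatTrans.ext
  funext V
  exact FGModuleCat.hom_ext (h V.pair)

/-- The coaction of `A_q(n,n)` on `F(V)`: if the coaction on `V^{⊗ d}` corresponds to `∑ f_i ⊗ a_i`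
with `f_i ∈ End_{B_d}(V^{⊗ d})`, then the coaction on `F(V)` is `x ↦ ∑ F(f_i)(x) ⊗ a_i`. -/
def coaction (F : PolyFun k q e d) (V : EHeckePair k q e) : F.sp V →ₗ[k] F.sp V ⊗[k] QMat q V.n :=
  TensorProduct.rTensorHomToHomRTensor (.id k) _ _ _ ((F.act V V).rTensor (QMat q V.n) (univ d V))

end PolyFun

open EHeckePair PolyFun

/-- The category `P_{q,e} = ⊕_d P^d_{q,e}`: an object is a family of functors `F_d` in `P^d_{q,e}`
that vanish for all but finitely many `d`, and a morphism is a family of natural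
transformations. -/
structure QPoly (k : Type u) [Field k] (q : kˣ) (e : ℕ) : Type (u + 1) where
  deg : ∀ d : ℕ, PolyFun k q e d
  bounded : ∃ N, ∀ d, N < d → ∀ V, Subsingleton ((deg d).sp V)

namespace QPoly
variable {k : Type u} [Field k] {q : kˣ} {e : ℕ}

instance : Category.{u + 1} (QPoly k q e) where
  Hom F G := ∀ d, F.deg d ⟶ G.deg d
  id F := fun d => 𝟙 (F.deg d)
  comp f g := fun d => f d ≫ g d

/-- The component in degree `d` at `V` of a morphism. -/
def ap {F G : QPoly k q e} (α : F ⟶ G) (d : ℕ) (V : EHeckePair k q e) :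
    (F.deg d).sp V →ₗ[k] (G.deg d).sp V := app (α d) V

@[simp] theorem ap_id (F : QPoly k q e) (d : ℕ) (V : EHeckePair k q e) (x : (F.deg d).sp V) :
    ap (𝟙 F) d V x = x := rfl

@[simp] theorem ap_comp {F G H : QPoly k q e} (α : F ⟶ G) (β : G ⟶ H) (d : ℕ)
    (V : EHeckePair k q e) (x : (F.deg d).sp V) :
    ap (α ≫ β) d V x = ap β d V (ap α d V x) := rfl

theorem ap_act {F G : QPoly k q e} (α : F ⟶ G) (d : ℕ) {V W : EHeckePair k q e} (f : BHom d V W)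
    (x : (F.deg d).sp V) :
    ap α d W ((F.deg d).act V W f x) = (G.deg d).act V W f (ap α d V x) := app_act _ _ _

theorem qhom_ext {F G : QPoly k q e} {α β : F ⟶ G} (h : ∀ d V, ap α d V = ap β d V) : α = β :=
  funext fun d => PolyFun.hom_ext (h d)

/-- A morphism from its components. -/
def qmk {F G : QPoly k q e} (η : ∀ d V, (F.deg d).sp V →ₗ[k] (G.deg d).sp V)
    (hη : ∀ d {V W : EHeckePair k q e} (f : BHom d V W),
      η d W ∘ₗ (F.deg d).act V W f = (G.deg d).act V W f ∘ₗ η d V) : F ⟶ G :=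
  fun d => mkHom (η d) (hη d)

@[simp] theorem ap_qmk {F G : QPoly k q e} (η : ∀ d V, (F.deg d).sp V →ₗ[k] (G.deg d).sp V)
    (hη : ∀ d {V W : EHeckePair k q e} (f : BHom d V W),
      η d W ∘ₗ (F.deg d).act V W f = (G.deg d).act V W f ∘ₗ η d V) (d : ℕ) (V : EHeckePair k q e) :
    ap (qmk η hη) d V = η d V := rfl

/-- An isomorphism from natural, mutually inverse linear maps. -/
def qiso {F G : QPoly k q e} (η : ∀ d V, (F.deg d).sp V →ₗ[k] (G.deg d).sp V)
    (hη : ∀ d {V W : EHeckePair k q e} (f : BHom d V W),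
      η d W ∘ₗ (F.deg d).act V W f = (G.deg d).act V W f ∘ₗ η d V)
    (θ : ∀ d V, (G.deg d).sp V →ₗ[k] (F.deg d).sp V)
    (h1 : ∀ d V x, θ d V (η d V x) = x) (h2 : ∀ d V x, η d V (θ d V x) = x) : F ≅ G where
  hom := qmk η hη
  inv := qmk θ (by
    intro d V W f
    ext x
    have := DFunLike.congr_fun (hη d f) (θ d V x)
    simp only [LinearMap.comp_apply, h2] at this ⊢
    rw [← this, h1])
  hom_inv_id := qhom_ext fun d V => LinearMap.ext fun x => h1 d V x
  inv_hom_id := qhom_ext fun d V => LinearMap.ext fun x => h2 d V x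

/-! ### Tensor product -/

section Tensor

/-- The action of `Hom_{B_a} ⊗ Hom_{B_b}` on `F(V) ⊗ G(V)`: `f ⊗ g` acts by `F(f) ⊗ G(g)`. -/
def eact {a b : ℕ} (F : PolyFun k q e a) (G : PolyFun k q e b) (V W : EHeckePair k q e) :
    (BHom a V W) ⊗[k] (BHom b V W) →ₗ[k] (F.sp V ⊗[k] G.sp V →ₗ[k] F.sp W ⊗[k] G.sp W) :=
  TensorProduct.homTensorHomMap (.id k) _ _ _ _ ∘ₗ TensorProduct.map (F.act V W) (G.act V W)

@[simp] theorem eact_tmul {a b : ℕ} (F : PolyFun k q e a) (G : PolyFun k q e b)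
    (V W : EHeckePair k q e) (f : BHom a V W) (g : BHom b V W) (x : F.sp V) (y : G.sp V) :
    eact F G V W (f ⊗ₜ g) (x ⊗ₜ y) = F.act V W f x ⊗ₜ G.act V W g y := by
  simp [eact]

variable (F G : QPoly k q e)

/-- The vector space `⊕_{a + b = d} F_a(V) ⊗ G_b(V)`. -/
abbrev dsum (d : ℕ) (V : EHeckePair k q e) : Type u :=
  DirectSum (Finset.HasAntidiagonal.antidiagonal d) fun p => (F.deg p.1.1).sp V ⊗[k] (G.deg p.1.2).sp V

theorem adj {d : ℕ} (p : Finset.HasAntidiagonal.antidiagonal d) : p.1.1 + p.1.2 = d := Finset.HasAntidiagonal.mem_antidiagonal.1 p.2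

/-- The map `⊕_p F_{p.1}(V) ⊗ G_{p.2}(V) → ⊕_p F_{p.1}(W) ⊗ G_{p.2}(W)` induced by `f`: on the
summand `p` it is given by the restriction of `f` along `B_{p.1} × B_{p.2} ⊂ B_d`. -/
def dact (d : ℕ) (V W : EHeckePair k q e) :
    BHom d V W →ₗ[k] (dsum F G d V →ₗ[k] dsum F G d W) where
  toFun f := DirectSum.toModule k _ _ fun p =>
    DirectSum.lof k (Finset.HasAntidiagonal.antidiagonal d)
      (fun p => (F.deg p.1.1).sp W ⊗[k] (G.deg p.1.2).sp W) p ∘ₗ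
      eact (F.deg p.1.1) (G.deg p.1.2) V W (res (adj p) V W f)
  map_add' f g := by
    apply DirectSum.linearMap_ext
    intro p
    refine LinearMap.ext fun z => ?_
    simp only [LinearMap.comp_apply, LinearMap.add_apply, DirectSum.toModule_lof, map_add]
  map_smul' r f := by
    apply DirectSum.linearMap_ext
    intro p
    refine LinearMap.ext fun z => ?_
    simp only [LinearMap.comp_apply, LinearMap.smul_apply, DirectSum.toModule_lof, map_smul,
      RingHom.id_apply]

theorem dact_lof (d : ℕ) (V W : EHeckePair k q e) (f : BHom d V W) (p : Finset.HasAntidiagonal.antidiagonal d)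
    (z : (F.deg p.1.1).sp V ⊗[k] (G.deg p.1.2).sp V) :
    dact F G d V W f (DirectSum.lof k _ (fun p : Finset.HasAntidiagonal.antidiagonal d =>
      (F.deg p.1.1).sp V ⊗[k] (G.deg p.1.2).sp V) p z) =
    DirectSum.lof k _ (fun p : Finset.HasAntidiagonal.antidiagonal d =>
      (F.deg p.1.1).sp W ⊗[k] (G.deg p.1.2).sp W) p
      (eact (F.deg p.1.1) (G.deg p.1.2) V W (res (adj p) V W f) z) := by
  simp only [dact, LinearMap.coe_mk, AddHom.coe_mk, DirectSum.toModule_lof, LinearMap.comp_apply]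

theorem eact_id {a b : ℕ} (F : PolyFun k q e a) (G : PolyFun k q e b)
    (V : EHeckePair k q e) :
    eact F G V V (BHom.id a V ⊗ₜ BHom.id b V) = LinearMap.id := by
  refine TensorProduct.ext' fun x y => ?_
  simp [act_id]

theorem eact_comp {a b : ℕ} (F : PolyFun k q e a) (G : PolyFun k q e b)
    (V W U : EHeckePair k q e) (s : (BHom a W U) ⊗[k] (BHom b W U))
    (t : (BHom a V W) ⊗[k] (BHom b V W)) :
    eact F G V U (TensorProduct.map₂ (compHom a V W U) (compHom b V W U) s t) =
      eact F G W U s ∘ₗ eact F G V W t := by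
  induction s using TensorProduct.induction_on with
  | zero => simp
  | add x y hx hy => simp only [map_add, LinearMap.add_apply, hx, hy, LinearMap.add_comp]
  | tmul s s' =>
  induction t using TensorProduct.induction_on with
  | zero => simp
  | add x y hx hy => simp only [map_add, hx, hy, LinearMap.comp_add]
  | tmul t t' =>
  refine TensorProduct.ext' fun x y => ?_
  rw [TensorProduct.map₂_apply_tmul, TensorProduct.map_tmul, LinearMap.comp_apply]
  simp [act_comp]

theorem eact_app {a b : ℕ} {F F' : PolyFun k q e a} {G G' : PolyFun k q e b} (α : F ⟶ F')
    (β : G ⟶ G') (V W : EHeckePair k q e) (t : (BHom a V W) ⊗[k] (BHom b V W)) :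
    TensorProduct.map (app α W) (app β W) ∘ₗ eact F G V W t =
      eact F' G' V W t ∘ₗ TensorProduct.map (app α V) (app β V) := by
  induction t using TensorProduct.induction_on with
  | zero => simp
  | add x y hx hy => simp only [map_add, hx, hy, LinearMap.comp_add, LinearMap.add_comp]
  | tmul t t' =>
  refine TensorProduct.ext' fun x y => ?_
  simp [app_act]

/-- The degree `d` component of `F ⊗ G`. -/
def tdeg (d : ℕ) : PolyFun k q e d :=
  ofAct (dsum F G d) (dact F G d)
    (by
      intro V
      apply DirectSum.linearMap_ext
      intro p
      refine LinearMap.ext fun z => ?_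
      simp only [LinearMap.comp_apply, dact_lof, res_id, eact_id, LinearMap.id_apply])
    (by
      intro V W U g f
      apply DirectSum.linearMap_ext
      intro p
      refine LinearMap.ext fun z => ?_
      simp only [LinearMap.comp_apply, dact_lof, res_comp, eact_comp])

/-- The tensor product `F ⊗ G`, with `(F ⊗ G)_d (V) = ⊕_{a + b = d} F_a(V) ⊗ G_b(V)`. -/
def tensor : QPoly k q e where
  deg := tdeg F G
  bounded := by
    obtain ⟨N, hN⟩ := F.bounded
    obtain ⟨M, hM⟩ := G.bounded
    refine ⟨N + M, fun d hd V => ?_⟩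
    have key : (LinearMap.id : dsum F G d V →ₗ[k] _) = 0 := by
      apply DirectSum.linearMap_ext
      intro p
      refine TensorProduct.ext' fun x y => ?_
      have hp := adj p
      rcases lt_or_ge N p.1.1 with ha | ha
      · have := hN p.1.1 ha V
        rw [Subsingleton.elim x 0]; simp
      · have := hM p.1.2 (by omega) V
        rw [Subsingleton.elim y 0]; simp
    have : Subsingleton (dsum F G d V) := ⟨fun x y => by
      rw [← LinearMap.id_apply (R := k) x, ← LinearMap.id_apply (R := k) y, key]; simp⟩
    exact this

/-- The value of `(F ⊗ G)_d` at `V`. -/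
def tensorE (d : ℕ) (V : EHeckePair k q e) : dsum F G d V ≃ₗ[k] ((tensor F G).deg d).sp V :=
  LinearEquiv.refl k (dsum F G d V)

theorem tensorE_act (d : ℕ) {V W : EHeckePair k q e} (f : BHom d V W) (x : dsum F G d V) :
    ((tensor F G).deg d).act V W f (tensorE F G d V x) = tensorE F G d W (dact F G d V W f x) :=
  rfl

/-- The inclusion of the summand `F_a(V) ⊗ G_b(V)` into `(F ⊗ G)_d (V)`, for `a + b = d`. -/
def incl {a b d : ℕ} (h : a + b = d) (V : EHeckePair k q e) :
    (F.deg a).sp V ⊗[k] (G.deg b).sp V →ₗ[k] ((tensor F G).deg d).sp V :=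
  (tensorE F G d V).toLinearMap ∘ₗ
    DirectSum.lof k _ (fun p : Finset.HasAntidiagonal.antidiagonal d =>
      (F.deg p.1.1).sp V ⊗[k] (G.deg p.1.2).sp V)
      ⟨(a, b), Finset.HasAntidiagonal.mem_antidiagonal.2 h⟩

variable {F G}

/-- The linear map on `(F ⊗ G)_d (V)` with given restrictions to the summands. -/
def desc {d : ℕ} {V : EHeckePair k q e} {M : Type*} [AddCommGroup M] [Module k M]
    (φ : ∀ a b, a + b = d → ((F.deg a).sp V ⊗[k] (G.deg b).sp V →ₗ[k] M)) :
    ((tensor F G).deg d).sp V →ₗ[k] M :=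
  DirectSum.toModule k (Finset.HasAntidiagonal.antidiagonal d) M
    (fun p => φ p.1.1 p.1.2 (adj p)) ∘ₗ (tensorE F G d V).symm.toLinearMap

@[simp] theorem desc_incl {d : ℕ} {V : EHeckePair k q e} {M : Type*} [AddCommGroup M] [Module k M]
    (φ : ∀ a b, a + b = d → ((F.deg a).sp V ⊗[k] (G.deg b).sp V →ₗ[k] M)) {a b : ℕ} (h : a + b = d)
    (z : (F.deg a).sp V ⊗[k] (G.deg b).sp V) : desc φ (incl F G h V z) = φ a b h z := by
  rw [desc, incl, LinearMap.comp_apply, LinearMap.comp_apply]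
  erw [LinearEquiv.symm_apply_apply, DirectSum.toModule_lof]

theorem tensor_act {a b d : ℕ} (h : a + b = d) {V W : EHeckePair k q e} (f : BHom d V W)
    (z : (F.deg a).sp V ⊗[k] (G.deg b).sp V) :
    ((tensor F G).deg d).act V W f (incl F G h V z) =
      incl F G h W (eact (F.deg a) (G.deg b) V W (res h V W f) z) := by
  rw [incl, LinearMap.comp_apply]
  erw [tensorE_act, dact_lof]
  rfl

theorem tensor_ext' {d : ℕ} {V : EHeckePair k q e} {M : Type*} [AddCommGroup M] [Module k M]
    {φ ψ : ((tensor F G).deg d).sp V →ₗ[k] M}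
    (h : ∀ a b (h : a + b = d) z, φ (incl F G h V z) = ψ (incl F G h V z)) : φ = ψ := by
  have : φ ∘ₗ (tensorE F G d V).toLinearMap = ψ ∘ₗ (tensorE F G d V).toLinearMap := by
    apply DirectSum.linearMap_ext
    rintro ⟨⟨a, b⟩, hp⟩
    exact LinearMap.ext fun z => h a b (Finset.HasAntidiagonal.mem_antidiagonal.1 hp) z
  refine LinearMap.ext fun x => ?_
  exact DFunLike.congr_fun this x

theorem tensor_ext {d : ℕ} {V : EHeckePair k q e} {M : Type*} [AddCommGroup M] [Module k M]
    {φ ψ : ((tensor F G).deg d).sp V →ₗ[k] M}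
    (h : ∀ a b (h : a + b = d) x y, φ (incl F G h V (x ⊗ₜ y)) = ψ (incl F G h V (x ⊗ₜ y))) :
    φ = ψ := by
  refine tensor_ext' fun a b hab z => ?_
  have : φ ∘ₗ incl F G hab V = ψ ∘ₗ incl F G hab V := TensorProduct.ext' (h a b hab)
  exact DFunLike.congr_fun this z

variable {F' G' : QPoly k q e}

/-- The tensor product of two morphisms. -/
def tmap (α : F ⟶ F') (β : G ⟶ G') : tensor F G ⟶ tensor F' G' :=
  qmk (F := tensor F G) (G := tensor F' G')
    (fun d V => desc fun a b h => incl F' G' h V ∘ₗ TensorProduct.map (ap α a V) (ap β b V))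
    (by
      intro d V W f
      refine tensor_ext' fun a b h z => ?_
      simp only [LinearMap.comp_apply]
      rw [tensor_act, desc_incl, desc_incl, LinearMap.comp_apply, LinearMap.comp_apply, tensor_act]
      exact congrArg _ (DFunLike.congr_fun (eact_app (α a) (β b) V W (res h V W f)) z))

@[simp] theorem tmap_incl (α : F ⟶ F') (β : G ⟶ G') {a b d : ℕ} (h : a + b = d)
    (V : EHeckePair k q e) (x : (F.deg a).sp V) (y : (G.deg b).sp V) :
    ap (tmap α β) d V (incl F G h V (x ⊗ₜ y)) = incl F' G' h V (ap α a V x ⊗ₜ ap β b V y) := by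
  rw [tmap, ap_qmk, desc_incl, LinearMap.comp_apply, TensorProduct.map_tmul]

end Tensor

end QPoly

open EHeckePair PolyFun

namespace QPoly
variable {k : Type u} [Field k] {q : kˣ} {e : ℕ}

section Assoc
variable {F G H K : QPoly k q e}

theorem tensor_ext_left {d : ℕ} {V : EHeckePair k q e} {M : Type*} [AddCommGroup M] [Module k M]
    {φ ψ : ((tensor (tensor F G) H).deg d).sp V →ₗ[k] M}
    (h : ∀ a b ab c (h1 : a + b = ab) (h2 : ab + c = d) x y z,
      φ (incl (tensor F G) H h2 V (incl F G h1 V (x ⊗ₜ y) ⊗ₜ z)) =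
      ψ (incl (tensor F G) H h2 V (incl F G h1 V (x ⊗ₜ y) ⊗ₜ z))) : φ = ψ := by
  refine tensor_ext fun ab c h2 w z => ?_
  have : (φ ∘ₗ incl (tensor F G) H h2 V) ∘ₗ (TensorProduct.mk k _ _).flip z =
      (ψ ∘ₗ incl (tensor F G) H h2 V) ∘ₗ (TensorProduct.mk k _ _).flip z :=
    tensor_ext fun a b h1 x y => h a b ab c h1 h2 x y z
  exact DFunLike.congr_fun this w

theorem tensor_ext_right {d : ℕ} {V : EHeckePair k q e} {M : Type*} [AddCommGroup M] [Module k M]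
    {φ ψ : ((tensor F (tensor G H)).deg d).sp V →ₗ[k] M}
    (h : ∀ a b c bc (h3 : b + c = bc) (h4 : a + bc = d) x y z,
      φ (incl F (tensor G H) h4 V (x ⊗ₜ incl G H h3 V (y ⊗ₜ z))) =
      ψ (incl F (tensor G H) h4 V (x ⊗ₜ incl G H h3 V (y ⊗ₜ z)))) : φ = ψ := by
  refine tensor_ext fun a bc h4 x w => ?_
  have : (φ ∘ₗ incl F (tensor G H) h4 V) ∘ₗ TensorProduct.mk k _ _ x =
      (ψ ∘ₗ incl F (tensor G H) h4 V) ∘ₗ TensorProduct.mk k _ _ x :=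
    tensor_ext fun b c h3 y z => h a b c bc h3 h4 x y z
  exact DFunLike.congr_fun this w

theorem tensor_ext_four {d : ℕ} {V : EHeckePair k q e} {M : Type*} [AddCommGroup M] [Module k M]
    {φ ψ : ((tensor (tensor (tensor F G) H) K).deg d).sp V →ₗ[k] M}
    (h : ∀ a b ab c abc l (h1 : a + b = ab) (h2 : ab + c = abc) (h3 : abc + l = d) x y z w,
      φ (incl (tensor (tensor F G) H) K h3 V (incl (tensor F G) H h2 V
        (incl F G h1 V (x ⊗ₜ y) ⊗ₜ z) ⊗ₜ w)) =
      ψ (incl (tensor (tensor F G) H) K h3 V (incl (tensor F G) H h2 V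
        (incl F G h1 V (x ⊗ₜ y) ⊗ₜ z) ⊗ₜ w))) : φ = ψ := by
  refine tensor_ext fun abc l h3 v w => ?_
  have : (φ ∘ₗ incl (tensor (tensor F G) H) K h3 V) ∘ₗ (TensorProduct.mk k _ _).flip w =
      (ψ ∘ₗ incl (tensor (tensor F G) H) K h3 V) ∘ₗ (TensorProduct.mk k _ _).flip w :=
    tensor_ext_left fun a b ab c h1 h2 x y z => h a b ab c abc l h1 h2 h3 x y z w
  exact DFunLike.congr_fun this v

variable (F G H)

/-- The associator on values: `(x ⊗ y) ⊗ z ↦ x ⊗ (y ⊗ z)`. -/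
def assocLin (d : ℕ) (V : EHeckePair k q e) :
    ((tensor (tensor F G) H).deg d).sp V →ₗ[k] ((tensor F (tensor G H)).deg d).sp V :=
  desc fun ab c h2 => TensorProduct.lift (desc fun a b h1 => TensorProduct.curry
    (incl F (tensor G H) (b := b + c) (by omega) V ∘ₗ
      (incl G H rfl V).lTensor ((F.deg a).sp V) ∘ₗ
      (TensorProduct.assoc k ((F.deg a).sp V) ((G.deg b).sp V) ((H.deg c).sp V)).toLinearMap))

/-- `x ⊗ (y ⊗ z) ↦ (x ⊗ y) ⊗ z` -/
def assocInvLin (d : ℕ) (V : EHeckePair k q e) :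
    ((tensor F (tensor G H)).deg d).sp V →ₗ[k] ((tensor (tensor F G) H).deg d).sp V :=
  desc fun a bc h4 => TensorProduct.lift (desc fun b c h3 => TensorProduct.curry
    (incl (tensor F G) H (a := a + b) (by omega) V ∘ₗ
      (incl F G rfl V).rTensor ((H.deg c).sp V) ∘ₗ
      (TensorProduct.assoc k ((F.deg a).sp V) ((G.deg b).sp V) ((H.deg c).sp V)).symm.toLinearMap ∘ₗ
      (TensorProduct.comm k _ _).toLinearMap)) ∘ₗ (TensorProduct.comm k _ _).toLinearMap

theorem assocLin_incl {a b c ab bc d : ℕ} (h1 : a + b = ab) (h2 : ab + c = d) (h3 : b + c = bc)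
    (h4 : a + bc = d) (V : EHeckePair k q e) (x : (F.deg a).sp V) (y : (G.deg b).sp V)
    (z : (H.deg c).sp V) :
    assocLin F G H d V (incl (tensor F G) H h2 V (incl F G h1 V (x ⊗ₜ y) ⊗ₜ z)) =
      incl F (tensor G H) h4 V (x ⊗ₜ incl G H h3 V (y ⊗ₜ z)) := by
  subst h3
  rw [assocLin, desc_incl, TensorProduct.lift.tmul, desc_incl, TensorProduct.curry_apply]
  simp

theorem assocInvLin_incl {a b c ab bc d : ℕ} (h1 : a + b = ab) (h2 : ab + c = d) (h3 : b + c = bc)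
    (h4 : a + bc = d) (V : EHeckePair k q e) (x : (F.deg a).sp V) (y : (G.deg b).sp V)
    (z : (H.deg c).sp V) :
    assocInvLin F G H d V (incl F (tensor G H) h4 V (x ⊗ₜ incl G H h3 V (y ⊗ₜ z))) =
      incl (tensor F G) H h2 V (incl F G h1 V (x ⊗ₜ y) ⊗ₜ z) := by
  subst h1
  rw [assocInvLin, desc_incl, LinearMap.comp_apply, LinearEquiv.coe_coe, TensorProduct.comm_tmul,
    TensorProduct.lift.tmul, desc_incl, TensorProduct.curry_apply]
  simp

/-- The action of `Hom_{B_a} ⊗ (Hom_{B_b} ⊗ Hom_{B_c})`. -/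
def eact₃ {a b c : ℕ} (F : PolyFun k q e a) (G : PolyFun k q e b) (H : PolyFun k q e c)
    (V W : EHeckePair k q e) :
    (BHom a V W) ⊗[k] ((BHom b V W) ⊗[k] (BHom c V W)) →ₗ[k]
      (F.sp V ⊗[k] (G.sp V ⊗[k] H.sp V) →ₗ[k] F.sp W ⊗[k] (G.sp W ⊗[k] H.sp W)) :=
  TensorProduct.homTensorHomMap (.id k) _ _ _ _ ∘ₗ TensorProduct.map (F.act V W) (eact G H V W)

@[simp] theorem eact₃_tmul {a b c : ℕ} (F : PolyFun k q e a) (G : PolyFun k q e b)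
    (H : PolyFun k q e c) (V W : EHeckePair k q e) (f : BHom a V W)
    (g : (BHom b V W) ⊗[k] (BHom c V W)) (x : F.sp V) (y : G.sp V ⊗[k] H.sp V) :
    eact₃ F G H V W (f ⊗ₜ g) (x ⊗ₜ y) = F.act V W f x ⊗ₜ eact G H V W g y := by
  simp [eact₃]

theorem assocLin_eact {a b c ab bc d : ℕ} (h1 : a + b = ab) (h2 : ab + c = d) (h3 : b + c = bc)
    (h4 : a + bc = d) (V W : EHeckePair k q e) (x : (F.deg a).sp V) (y : (G.deg b).sp V)
    (z : (H.deg c).sp V) (t : (BHom ab V W) ⊗[k] (BHom c V W)) :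
    assocLin F G H d W (incl (tensor F G) H h2 W
      (eact ((tensor F G).deg ab) (H.deg c) V W t (incl F G h1 V (x ⊗ₜ y) ⊗ₜ z))) =
    incl F (tensor G H) h4 W ((incl G H h3 W).lTensor _ (eact₃ (F.deg a) (G.deg b) (H.deg c) V W
      (TensorProduct.assoc k _ _ _ ((res h1 V W).rTensor _ t)) (x ⊗ₜ (y ⊗ₜ z)))) := by
  induction t using TensorProduct.induction_on with
  | zero => simp
  | add t t' h h' => simp only [map_add, LinearMap.add_apply, h, h']
  | tmul f g =>
  rw [eact_tmul, tensor_act, LinearMap.rTensor_tmul]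
  generalize res h1 V W f = s
  induction s using TensorProduct.induction_on with
  | zero => simp
  | add s s' h h' => simp only [map_add, LinearMap.add_apply, TensorProduct.add_tmul, h, h']
  | tmul f f' =>
  rw [eact_tmul, assocLin_incl F G H h1 h2 h3 h4, TensorProduct.assoc_tmul, eact₃_tmul, eact_tmul,
    LinearMap.lTensor_tmul]

theorem incl_eact {a b c bc d : ℕ} (h3 : b + c = bc)
    (h4 : a + bc = d) (V W : EHeckePair k q e) (x : (F.deg a).sp V) (y : (G.deg b).sp V)
    (z : (H.deg c).sp V) (t : (BHom a V W) ⊗[k] (BHom bc V W)) :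
    incl F (tensor G H) h4 W
      (eact (F.deg a) ((tensor G H).deg bc) V W t (x ⊗ₜ incl G H h3 V (y ⊗ₜ z))) =
    incl F (tensor G H) h4 W ((incl G H h3 W).lTensor _ (eact₃ (F.deg a) (G.deg b) (H.deg c) V W
      ((res h3 V W).lTensor _ t) (x ⊗ₜ (y ⊗ₜ z)))) := by
  induction t using TensorProduct.induction_on with
  | zero => simp
  | add t t' h h' => simp only [map_add, LinearMap.add_apply, h, h']
  | tmul f g =>
  rw [eact_tmul, tensor_act, LinearMap.lTensor_tmul, eact₃_tmul, LinearMap.lTensor_tmul]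

theorem assocLin_act (d : ℕ) {V W : EHeckePair k q e} (f : BHom d V W) :
    assocLin F G H d W ∘ₗ ((tensor (tensor F G) H).deg d).act V W f =
      ((tensor F (tensor G H)).deg d).act V W f ∘ₗ assocLin F G H d V := by
  refine tensor_ext_left fun a b ab c h1 h2 x y z => ?_
  have h4 : a + (b + c) = d := by omega
  rw [LinearMap.comp_apply, LinearMap.comp_apply, assocLin_incl F G H h1 h2 rfl h4, tensor_act,
    tensor_act, assocLin_eact F G H h1 h2 rfl h4, incl_eact, res_assoc h1 h2 rfl h4]

/-- The associator. -/
def assocIso : tensor (tensor F G) H ≅ tensor F (tensor G H) :=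
  qiso (assocLin F G H) (assocLin_act F G H) (assocInvLin F G H)
    (by
      intro d V x
      have : assocInvLin F G H d V ∘ₗ assocLin F G H d V = LinearMap.id := by
        refine tensor_ext_left fun a b ab c h1 h2 x y z => ?_
        rw [LinearMap.comp_apply, assocLin_incl F G H h1 h2 rfl (by omega),
          assocInvLin_incl F G H h1 h2 rfl (by omega), LinearMap.id_apply]
      exact DFunLike.congr_fun this x)
    (by
      intro d V x
      have : assocLin F G H d V ∘ₗ assocInvLin F G H d V = LinearMap.id := by
        refine tensor_ext_right fun a b c bc h3 h4 x y z => ?_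
        rw [LinearMap.comp_apply, assocInvLin_incl F G H rfl (by omega) h3 h4,
          assocLin_incl F G H rfl (by omega) h3 h4, LinearMap.id_apply]
      exact DFunLike.congr_fun this x)

theorem assocIso_incl {a b c ab bc d : ℕ} (h1 : a + b = ab) (h2 : ab + c = d) (h3 : b + c = bc)
    (h4 : a + bc = d) (V : EHeckePair k q e) (x : (F.deg a).sp V) (y : (G.deg b).sp V)
    (z : (H.deg c).sp V) :
    ap (assocIso F G H).hom d V (incl (tensor F G) H h2 V (incl F G h1 V (x ⊗ₜ y) ⊗ₜ z)) =
      incl F (tensor G H) h4 V (x ⊗ₜ incl G H h3 V (y ⊗ₜ z)) :=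
  assocLin_incl F G H h1 h2 h3 h4 V x y z

end Assoc

section Unit

/-- The scalar by which a map `V^{⊗ 0} → W^{⊗ 0}` acts, under `V^{⊗ 0} = k = W^{⊗ 0}`. -/
def scal (V W : EHeckePair k q e) : BHom 0 V W →ₗ[k] k :=
  (PiTensorProduct.isEmptyEquiv (R := k) (s := fun _ => W.carrier) (Fin 0)).toLinearMap ∘ₗ
    LinearMap.applyₗ (PiTensorProduct.tprod k Fin.elim0) ∘ₗ BHom.val

theorem val_eq_scal {V W : EHeckePair k q e} (f : BHom 0 V W) :
    f.val (PiTensorProduct.tprod k Fin.elim0) = scal V W f • PiTensorProduct.tprod k Fin.elim0 := by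
  apply (PiTensorProduct.isEmptyEquiv (R := k) (s := fun _ => W.carrier) (Fin 0)).injective
  simp [scal]

theorem scal_id (V : EHeckePair k q e) : scal V V (BHom.id 0 V) = 1 := by
  simp [scal, BHom.id]

theorem scal_comp {V W U : EHeckePair k q e} (g : BHom 0 W U) (f : BHom 0 V W) :
    scal V U (compHom 0 V W U g f) = scal W U g * scal V W f := by
  have : (compHom 0 V W U g f).val (PiTensorProduct.tprod k Fin.elim0) =
      (scal V W f * scal W U g) • PiTensorProduct.tprod k Fin.elim0 := by
    rw [compHom_val, LinearMap.comp_apply, val_eq_scal, map_smul, val_eq_scal, smul_smul]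
  rw [mul_comm]
  simp [scal] at this ⊢
  rw [this]
  simp

variable (k q e) in
/-- The components of the unit object: the constant functor `k` in degree `0`, and zero in
positive degrees. A morphism `V → W` of degree `0` is a scalar and acts by it. -/
def unitDeg : (d : ℕ) → PolyFun k q e d
  | 0 => ofAct (fun _ => k) (fun V W => LinearMap.lsmul k k ∘ₗ scal V W)
      (by intro V; ext; simp [scal_id]) (by intro V W U g f; ext; simp [scal_comp])
  | _ + 1 => ofAct (fun _ => PUnit.{u + 1}) (fun _ _ => 0)
      (by intros; ext) (by intros; ext)

instance (d : ℕ) (V : EHeckePair k q e) : Subsingleton ((unitDeg k q e (d + 1)).sp V) :=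
  inferInstanceAs (Subsingleton PUnit.{u + 1})

variable (k q e) in
/-- The unit object: the constant functor `k`, in degree `0`. -/
def unit : QPoly k q e where
  deg := unitDeg k q e
  bounded := ⟨0, fun d hd V => by
    cases d with
    | zero => omega
    | succ d => exact inferInstanceAs (Subsingleton ((unitDeg k q e (d + 1)).sp V))⟩

instance (d : ℕ) (V : EHeckePair k q e) : Subsingleton (((unit k q e).deg (d + 1)).sp V) :=
  inferInstanceAs (Subsingleton ((unitDeg k q e (d + 1)).sp V))

/-- The value of the unit object at `V` in degree `0` is `k`. -/
def unitE (V : EHeckePair k q e) : k ≃ₗ[k] ((unit k q e).deg 0).sp V := LinearEquiv.refl k k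

theorem unit_act {V W : EHeckePair k q e} (f : BHom 0 V W) (c : k) :
    ((unit k q e).deg 0).act V W f (unitE V c) = unitE W (scal V W f * c) := rfl

variable (F : QPoly k q e)

theorem unit_res_left {d : ℕ} (h : 0 + d = d) {V W : EHeckePair k q e} (f : BHom d V W) :
    TensorProduct.lid k _ ((scal V W).rTensor _ (res h V W f)) = f := by
  apply BHom.val_injective
  rw [← inclHom_res h V W f]
  generalize res h V W f = t
  induction t using TensorProduct.induction_on with
  | zero => simp
  | add s t hs ht => simp only [map_add, hs, ht]
  | tmul g f =>
  have key : ∀ (U : EHeckePair k q e) (y : ⨂[k]^d U.carrier),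
      mulE U.carrier 0 d d h (PiTensorProduct.tprod k Fin.elim0 ⊗ₜ y) = y := by
    intro U y
    induction y using PiTensorProduct.induction_on with
    | add x x' hx hx' => simp only [map_add, TensorProduct.tmul_add, hx, hx']
    | smul_tprod r y =>
      simp only [TensorProduct.tmul_smul, map_smul, mulE_tprod]
      congr 2
  refine LinearMap.ext fun y => ?_
  conv_rhs => rw [← key V y]
  rw [inclHom_tmul, val_eq_scal, ← TensorProduct.smul_tmul', map_smul, key]
  simp

theorem unit_res_right {d : ℕ} (h : d + 0 = d) {V W : EHeckePair k q e} (f : BHom d V W) :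
    TensorProduct.rid k _ ((scal V W).lTensor _ (res h V W f)) = f := by
  apply BHom.val_injective
  rw [← inclHom_res h V W f]
  generalize res h V W f = t
  induction t using TensorProduct.induction_on with
  | zero => simp
  | add s t hs ht => simp only [map_add, hs, ht]
  | tmul f g =>
  have key : ∀ (U : EHeckePair k q e) (y : ⨂[k]^d U.carrier),
      mulE U.carrier d 0 d h (y ⊗ₜ PiTensorProduct.tprod k Fin.elim0) = y := by
    intro U y
    induction y using PiTensorProduct.induction_on with
    | add x x' hx hx' => simp only [map_add, TensorProduct.add_tmul, hx, hx']
    | smul_tprod r y =>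
      simp only [← TensorProduct.smul_tmul', map_smul, mulE_tprod]
      congr 2
      funext i
      simp
  refine LinearMap.ext fun y => ?_
  conv_rhs => rw [← key V y]
  rw [inclHom_tmul, val_eq_scal, TensorProduct.tmul_smul, map_smul, key]
  simp

/-- Components of the left unitor: `c ⊗ x ↦ c x` in degree `0`. -/
def leftPart (V : EHeckePair k q e) : (a b d : ℕ) → a + b = d →
    (((unit k q e).deg a).sp V ⊗[k] (F.deg b).sp V →ₗ[k] (F.deg d).sp V)
  | 0, b, d, h => by
      obtain rfl : b = d := by omega
      exact (TensorProduct.lid k _).toLinearMap ∘ₗ (unitE V).symm.toLinearMap.rTensor _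
  | _ + 1, _, _, _ => 0

/-- Components of the right unitor: `x ⊗ c ↦ c x` in degree `0`. -/
def rightPart (V : EHeckePair k q e) : (b a d : ℕ) → a + b = d →
    ((F.deg a).sp V ⊗[k] ((unit k q e).deg b).sp V →ₗ[k] (F.deg d).sp V)
  | 0, a, d, h => by
      obtain rfl : a = d := by omega
      exact (TensorProduct.rid k _).toLinearMap ∘ₗ (unitE V).symm.toLinearMap.lTensor _
  | _ + 1, _, _, _ => 0

/-- The left unitor on values. -/
def leftLin (d : ℕ) (V : EHeckePair k q e) :
    ((tensor (unit k q e) F).deg d).sp V →ₗ[k] (F.deg d).sp V :=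
  desc fun a b h => leftPart F V a b d h

/-- The right unitor on values. -/
def rightLin (d : ℕ) (V : EHeckePair k q e) :
    ((tensor F (unit k q e)).deg d).sp V →ₗ[k] (F.deg d).sp V :=
  desc fun a b h => rightPart F V b a d h

theorem leftLin_incl {d : ℕ} (h : 0 + d = d) (V : EHeckePair k q e) (c : k) (x : (F.deg d).sp V) :
    leftLin F d V (incl (unit k q e) F h V (unitE V c ⊗ₜ x)) = c • x := by
  rw [leftLin, desc_incl]
  simp [leftPart]

theorem rightLin_incl {d : ℕ} (h : d + 0 = d) (V : EHeckePair k q e) (c : k) (x : (F.deg d).sp V) :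
    rightLin F d V (incl F (unit k q e) h V (x ⊗ₜ unitE V c)) = c • x := by
  rw [rightLin, desc_incl]
  simp [rightPart]

variable {F}

theorem left_ext {d : ℕ} {V : EHeckePair k q e} {M : Type*} [AddCommGroup M] [Module k M]
    {φ ψ : ((tensor (unit k q e) F).deg d).sp V →ₗ[k] M}
    (h : ∀ h c x, φ (incl (unit k q e) F (a := 0) (b := d) h V (unitE V c ⊗ₜ x)) =
      ψ (incl (unit k q e) F (a := 0) (b := d) h V (unitE V c ⊗ₜ x))) : φ = ψ := by
  refine tensor_ext fun a b hab x y => ?_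
  cases a with
  | zero =>
    obtain rfl : b = d := by omega
    obtain ⟨c, rfl⟩ := (unitE V).surjective x
    exact h _ _ _
  | succ a => rw [Subsingleton.elim x 0]; simp

theorem right_ext {d : ℕ} {V : EHeckePair k q e} {M : Type*} [AddCommGroup M] [Module k M]
    {φ ψ : ((tensor F (unit k q e)).deg d).sp V →ₗ[k] M}
    (h : ∀ h c x, φ (incl F (unit k q e) (a := d) (b := 0) h V (x ⊗ₜ unitE V c)) =
      ψ (incl F (unit k q e) (a := d) (b := 0) h V (x ⊗ₜ unitE V c))) : φ = ψ := by
  refine tensor_ext fun a b hab x y => ?_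
  cases b with
  | zero =>
    obtain rfl : a = d := by omega
    obtain ⟨c, rfl⟩ := (unitE V).surjective y
    exact h _ _ _
  | succ b => rw [Subsingleton.elim y 0]; simp

variable (F)

theorem leftLin_act (d : ℕ) {V W : EHeckePair k q e} (f : BHom d V W) :
    leftLin F d W ∘ₗ ((tensor (unit k q e) F).deg d).act V W f =
      (F.deg d).act V W f ∘ₗ leftLin F d V := by
  refine left_ext fun h c x => ?_
  rw [LinearMap.comp_apply, LinearMap.comp_apply, leftLin_incl, tensor_act]
  conv_rhs => rw [← unit_res_left h f]
  generalize res h V W f = t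
  induction t using TensorProduct.induction_on with
  | zero => simp
  | add s t hs ht => simp only [map_add, LinearMap.add_apply, hs, ht]
  | tmul g f =>
  rw [eact_tmul, unit_act, leftLin_incl]
  simp [smul_smul, mul_comm]

theorem rightLin_act (d : ℕ) {V W : EHeckePair k q e} (f : BHom d V W) :
    rightLin F d W ∘ₗ ((tensor F (unit k q e)).deg d).act V W f =
      (F.deg d).act V W f ∘ₗ rightLin F d V := by
  refine right_ext fun h c x => ?_
  rw [LinearMap.comp_apply, LinearMap.comp_apply, rightLin_incl, tensor_act]
  conv_rhs => rw [← unit_res_right h f]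
  generalize res h V W f = t
  induction t using TensorProduct.induction_on with
  | zero => simp
  | add s t hs ht => simp only [map_add, LinearMap.add_apply, hs, ht]
  | tmul g f =>
  rw [eact_tmul, unit_act, rightLin_incl]
  simp [smul_smul, mul_comm]

/-- The left unitor. -/
def leftIso : tensor (unit k q e) F ≅ F :=
  qiso (leftLin F) (leftLin_act F)
    (fun d V => incl (unit k q e) F (Nat.zero_add d) V ∘ₗ TensorProduct.mk k _ _ (unitE V 1))
    (by
      intro d V x
      have : (incl (unit k q e) F (Nat.zero_add d) V ∘ₗ TensorProduct.mk k _ _ (unitE V 1)) ∘ₗ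
          leftLin F d V = LinearMap.id := by
        refine left_ext fun h c x => ?_
        rw [LinearMap.comp_apply, leftLin_incl, map_smul, LinearMap.comp_apply,
          TensorProduct.mk_apply, ← map_smul, TensorProduct.smul_tmul', ← map_smul, smul_eq_mul,
          mul_one]
        rfl
      exact DFunLike.congr_fun this x)
    (by
      intro d V x
      rw [LinearMap.comp_apply, TensorProduct.mk_apply, leftLin_incl, one_smul])

/-- The right unitor. -/
def rightIso : tensor F (unit k q e) ≅ F :=
  qiso (rightLin F) (rightLin_act F)
    (fun d V => incl F (unit k q e) (Nat.add_zero d) V ∘ₗ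
      (TensorProduct.mk k _ _).flip (unitE V 1))
    (by
      intro d V x
      have : (incl F (unit k q e) (Nat.add_zero d) V ∘ₗ
          (TensorProduct.mk k _ _).flip (unitE V 1)) ∘ₗ rightLin F d V = LinearMap.id := by
        refine right_ext fun h c x => ?_
        rw [LinearMap.comp_apply, rightLin_incl, map_smul, LinearMap.comp_apply,
          LinearMap.flip_apply, TensorProduct.mk_apply, ← map_smul, ← TensorProduct.tmul_smul,
          ← map_smul, smul_eq_mul, mul_one]
        rfl
      exact DFunLike.congr_fun this x)
    (by
      intro d V x
      rw [LinearMap.comp_apply, LinearMap.flip_apply, TensorProduct.mk_apply, rightLin_incl,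
        one_smul])

theorem leftIso_incl {d : ℕ} (h : 0 + d = d) (V : EHeckePair k q e) (c : k) (x : (F.deg d).sp V) :
    ap (leftIso F).hom d V (incl (unit k q e) F h V (unitE V c ⊗ₜ x)) = c • x :=
  leftLin_incl F h V c x

theorem rightIso_incl {d : ℕ} (h : d + 0 = d) (V : EHeckePair k q e) (c : k) (x : (F.deg d).sp V) :
    ap (rightIso F).hom d V (incl F (unit k q e) h V (x ⊗ₜ unitE V c)) = c • x :=
  rightLin_incl F h V c x

end Unit

section Monoidal
variable {F G H K F' G' H' : QPoly k q e}

theorem tmap_id : tmap (𝟙 F) (𝟙 G) = 𝟙 (tensor F G) := by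
  refine qhom_ext fun d V => tensor_ext fun a b h x y => ?_
  rw [tmap_incl, ap_id, ap_id, ap_id]

theorem tmap_comp {F'' G'' : QPoly k q e} (α₁ : F ⟶ F') (α₂ : G ⟶ G') (β₁ : F' ⟶ F'')
    (β₂ : G' ⟶ G'') : tmap α₁ α₂ ≫ tmap β₁ β₂ = tmap (α₁ ≫ β₁) (α₂ ≫ β₂) := by
  refine qhom_ext fun d V => tensor_ext fun a b h x y => ?_
  rw [ap_comp, tmap_incl, tmap_incl, tmap_incl, ap_comp, ap_comp]

theorem assoc_naturality (α₁ : F ⟶ F') (α₂ : G ⟶ G') (α₃ : H ⟶ H') :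
    tmap (tmap α₁ α₂) α₃ ≫ (assocIso F' G' H').hom =
      (assocIso F G H).hom ≫ tmap α₁ (tmap α₂ α₃) := by
  refine qhom_ext fun d V => tensor_ext_left fun a b ab c h1 h2 x y z => ?_
  have h4 : a + (b + c) = d := by omega
  rw [ap_comp, ap_comp, tmap_incl, tmap_incl, assocIso_incl _ _ _ h1 h2 rfl h4,
    assocIso_incl _ _ _ h1 h2 rfl h4, tmap_incl, tmap_incl]

theorem left_naturality (α : F ⟶ G) :
    tmap (𝟙 (unit k q e)) α ≫ (leftIso G).hom = (leftIso F).hom ≫ α := by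
  refine qhom_ext fun d V => left_ext fun h c x => ?_
  rw [ap_comp, ap_comp, tmap_incl, ap_id, leftIso_incl, leftIso_incl, map_smul]

theorem right_naturality (α : F ⟶ G) :
    tmap α (𝟙 (unit k q e)) ≫ (rightIso G).hom = (rightIso F).hom ≫ α := by
  refine qhom_ext fun d V => right_ext fun h c x => ?_
  rw [ap_comp, ap_comp, tmap_incl, ap_id, rightIso_incl, rightIso_incl, map_smul]

variable (F G H K) in
theorem assoc_pentagon :
    tmap (assocIso F G H).hom (𝟙 K) ≫ (assocIso F (tensor G H) K).hom ≫
      tmap (𝟙 F) (assocIso G H K).hom =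
    (assocIso (tensor F G) H K).hom ≫ (assocIso F G (tensor H K)).hom := by
  refine qhom_ext fun d V => tensor_ext_four fun a b ab c abc l h1 h2 h3 x y z w => ?_
  have e1 : a + (b + c) = abc := by omega
  have e2 : a + (b + c + l) = d := by omega
  have e3 : b + (c + l) = b + c + l := by omega
  have e4 : ab + (c + l) = d := by omega
  rw [ap_comp, ap_comp, ap_comp, tmap_incl, assocIso_incl F G H h1 h2 rfl e1, ap_id,
    assocIso_incl F (tensor G H) K e1 h3 rfl e2, tmap_incl, ap_id,
    assocIso_incl G H K rfl rfl rfl e3, assocIso_incl (tensor F G) H K h2 h3 rfl e4,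
    assocIso_incl F G (tensor H K) h1 e4 e3 e2]

variable (F G) in
theorem unit_triangle :
    (assocIso F (unit k q e) G).hom ≫ tmap (𝟙 F) (leftIso G).hom =
      tmap (rightIso F).hom (𝟙 G) := by
  refine qhom_ext fun d V => tensor_ext fun ab c h2 w z => ?_
  have := right_ext (F := F) (d := ab) (V := V)
    (φ := ap (tmap (𝟙 F) (leftIso G).hom) d V ∘ₗ ap (assocIso F (unit k q e) G).hom d V ∘ₗ
      incl (tensor F (unit k q e)) G h2 V ∘ₗ (TensorProduct.mk k _ _).flip z)
    (ψ := ap (tmap (rightIso F).hom (𝟙 G)) d V ∘ₗ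
      incl (tensor F (unit k q e)) G h2 V ∘ₗ (TensorProduct.mk k _ _).flip z) (by
        intro h r x
        simp only [LinearMap.comp_apply, LinearMap.flip_apply, TensorProduct.mk_apply]
        rw [assocIso_incl F (unit k q e) G h h2 (Nat.zero_add c) h2, tmap_incl, tmap_incl,
          rightIso_incl, leftIso_incl, ap_id, ap_id, TensorProduct.smul_tmul])
  exact DFunLike.congr_fun this w

instance : MonoidalCategoryStruct (QPoly k q e) where
  tensorObj F G := tensor F G
  whiskerLeft F _ _ β := tmap (𝟙 F) β
  whiskerRight α G := tmap α (𝟙 G)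
  tensorHom α β := tmap α β
  tensorUnit := unit k q e
  associator F G H := assocIso F G H
  leftUnitor F := leftIso F
  rightUnitor F := rightIso F

instance : MonoidalCategory (QPoly k q e) :=
  MonoidalCategory.ofTensorHom
    (id_tensorHom_id := fun _ _ => tmap_id)
    (id_tensorHom := fun _ _ _ _ => rfl)
    (tensorHom_id := fun _ _ => rfl)
    (tensorHom_comp_tensorHom := fun α₁ α₂ β₁ β₂ => tmap_comp α₁ α₂ β₁ β₂)
    (associator_naturality := fun α₁ α₂ α₃ => assoc_naturality α₁ α₂ α₃)
    (leftUnitor_naturality := fun α => left_naturality α)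
    (rightUnitor_naturality := fun α => right_naturality α)
    (pentagon := fun F G H K => assoc_pentagon F G H K)
    (triangle := fun F G => unit_triangle F G)

end Monoidal

end QPoly

end QuantumPoly

end

/-! At a single pair `V` the theorem is the standard fact that comodules over a coquasitriangular
bialgebra `A` are braided: the two multiplicativity rules of `𝓡` give the two hexagons, and an
inverse of `𝓡` for convolution makes the braiding bijective. What is not formal is that the maps
`R_{F(V), G(V)}` are natural in `V`. A morphism `f` from `V` to `W` is only a linear map `V^{⊗ d} →
W^{⊗ d}` that commutes with the braid group, and `V` and `W` may be comodules over quantum matrices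
of different sizes. So `F(f)` is not a map of comodules, and naturality of the braiding for colinear
maps says nothing about it.

The remedy is the universal element `univ d V` of `End_{B_d}(V^{⊗ d}) ⊗ A`. It produces the coaction
on `V^{⊗ d}` through the tautological representation and the coaction on `F(V)` through `F`. The
tautological representation is faithful, so an identity between coactions on tensor powers is an
identity between universal elements (`coact_injective`), and it survives the application of any
polynomial functor. In this way `F(V)` is a comodule (`coaction_isCoaction`), and the summand
`F_a(V) ⊗ G_b(V)` of the tensor product sits inside it colinearly (`res_univ`, `coaction_incl`).

The same device treats the braiding. Contracting the universal elements of degrees `b` and `a` with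
`𝓡` gives the element `twist` of `End_{B_b}(V^{⊗ b}) ⊗ End_{B_a}(V^{⊗ a})`. Preceded by the flip, it
acts on `V^{⊗ a} ⊗ V^{⊗ b}` as `R_{V^{⊗ a}, V^{⊗ b}}` and on `F_a(V) ⊗ G_b(V)` as `R_{F_a(V),
G_b(V)}`. Naturality in `V` therefore reduces to the claim that `f` commutes with `R_{V^{⊗ a}, V^{⊗
b}}` (`val_powR`, `twist_res`, `partBraiding_eact`). By the hexagon identities that operator is a
composite of operators `1 ⊗ R_V ⊗ 1`, the generators of the braid group action, and `f` commutes
with these by definition.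

For the inverse, the Hecke relation `R - R⁻¹ = q - q⁻¹` shows that `R⁻¹` is the `R`-matrix of `q⁻¹`
with the order of the basis reversed. Hence the universal form of `A_{q⁻¹}(n,n)`, pulled back along
the reversal of indices, is inverse to `𝓡` on generators (after exchanging the arguments of `𝓡`),
and multiplicativity extends this to the whole algebra (`skewPairing_convolution`). -/

noncomputable section

namespace QuantumPoly

universe u

/-! ### Braidings of comodules attached to a skew pairing -/

section ComoduleBraiding

variable {k : Type u} [Field k] {A : Type u} [Ring A] [Bialgebra k A]
variable {X Y Z X' Y' : Type u} [AddCommGroup X] [Module k X] [AddCommGroup Y] [Module k Y]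
  [AddCommGroup Z] [Module k Z] [AddCommGroup X'] [Module k X'] [AddCommGroup Y'] [Module k Y']

/-- The contraction `(y ⊗ b) ⊗ (x ⊗ a) ↦ 𝓡(b, a) y ⊗ x`. -/
def formContract (𝓡 : A ⊗[k] A →ₗ[k] k) (Y X : Type u) [AddCommGroup X] [Module k X]
    [AddCommGroup Y] [Module k Y] : (Y ⊗[k] A) ⊗[k] (X ⊗[k] A) →ₗ[k] Y ⊗[k] X :=
  (TensorProduct.rid k (Y ⊗[k] X)).toLinearMap ∘ₗ 𝓡.lTensor (Y ⊗[k] X) ∘ₗ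
    (TensorProduct.tensorTensorTensorComm k Y A X A).toLinearMap

@[simp] theorem formContract_tmul (𝓡 : A ⊗[k] A →ₗ[k] k) (y : Y) (b : A) (x : X) (a : A) :
    formContract 𝓡 Y X ((y ⊗ₜ b) ⊗ₜ (x ⊗ₜ a)) = 𝓡 (b ⊗ₜ a) • (y ⊗ₜ x) := by
  simp [formContract]

theorem comoduleBraiding_tmul (𝓡 : A ⊗[k] A →ₗ[k] k) (ρ : X →ₗ[k] X ⊗[k] A)
    (σ : Y →ₗ[k] Y ⊗[k] A) (x : X) (y : Y) :
    comoduleBraiding 𝓡 ρ σ (x ⊗ₜ y) = formContract 𝓡 Y X (σ y ⊗ₜ ρ x) := rfl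

/-- The braiding contracts only the `A`-legs of the two coactions, and a colinear map leaves these
legs alone. Besides naturality in `F` and `G`, this is what allows a braiding to be computed on a
summand or after concatenation of tensor powers, because the inclusions and `mulE` are colinear. -/
theorem comoduleBraiding_naturality (𝓡 : A ⊗[k] A →ₗ[k] k) {ρ : X →ₗ[k] X ⊗[k] A}
    {σ : Y →ₗ[k] Y ⊗[k] A} {ρ' : X' →ₗ[k] X' ⊗[k] A} {σ' : Y' →ₗ[k] Y' ⊗[k] A}
    {φ : X →ₗ[k] X'} {ψ : Y →ₗ[k] Y'} (hφ : ∀ x, ρ' (φ x) = φ.rTensor A (ρ x))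
    (hψ : ∀ y, σ' (ψ y) = ψ.rTensor A (σ y)) (z : X ⊗[k] Y) :
    comoduleBraiding 𝓡 ρ' σ' (TensorProduct.map φ ψ z) =
      TensorProduct.map ψ φ (comoduleBraiding 𝓡 ρ σ z) := by
  induction z using TensorProduct.induction_on with
  | zero => simp
  | add z z' h h' => simp only [map_add, h, h']
  | tmul x y =>
  rw [TensorProduct.map_tmul, comoduleBraiding_tmul, comoduleBraiding_tmul, hφ, hψ]
  induction ρ x using TensorProduct.induction_on with
  | zero => simp
  | add u u' h h' => simp only [map_add, TensorProduct.tmul_add, h, h']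
  | tmul x a =>
  induction σ y using TensorProduct.induction_on with
  | zero => simp
  | add u u' h h' => simp only [map_add, TensorProduct.add_tmul, h, h']
  | tmul y b => simp

/-- The multiplicativity rules `𝓡(a, b c) = 𝓡(a₁, b) 𝓡(a₂, c)` and
`𝓡(a b, c) = 𝓡(b, c₁) 𝓡(a, c₂)`. -/
structure IsSkewPairing (𝓡 : A ⊗[k] A →ₗ[k] k) : Prop where
  tmul_mul : ∀ a b c, 𝓡 (a ⊗ₜ (b * c)) = LinearMap.mul' k k (TensorProduct.map
    ((TensorProduct.curry 𝓡).flip b) ((TensorProduct.curry 𝓡).flip c)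
    (Coalgebra.comul (R := k) a))
  mul_tmul : ∀ a b c, 𝓡 ((a * b) ⊗ₜ c) = LinearMap.mul' k k (TensorProduct.map
    (TensorProduct.curry 𝓡 b) (TensorProduct.curry 𝓡 a) (Coalgebra.comul (R := k) c))

theorem IsCoaction.coassoc_apply {ρ : X →ₗ[k] X ⊗[k] A} (h : IsCoaction ρ) (x : X) :
    TensorProduct.assoc k X A A (ρ.rTensor A (ρ x)) =
      (Coalgebra.comul (R := k) (A := A)).lTensor X (ρ x) :=
  DFunLike.congr_fun h.coassoc x

theorem IsCoaction.counit_apply {ρ : X →ₗ[k] X ⊗[k] A} (h : IsCoaction ρ) (x : X) :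
    TensorProduct.rid k X ((Coalgebra.counit (R := k) (A := A)).lTensor X (ρ x)) = x :=
  DFunLike.congr_fun h.counit x

/-- `R_{X ⊗ Y, Z} = (R_{X, Z} ⊗ 1) (1 ⊗ R_{Y, Z})`. -/
theorem comoduleBraiding_tensor_left {𝓡 : A ⊗[k] A →ₗ[k] k} (h𝓡 : IsSkewPairing 𝓡)
    (ρ : X →ₗ[k] X ⊗[k] A) (σ : Y →ₗ[k] Y ⊗[k] A) {τ : Z →ₗ[k] Z ⊗[k] A} (hτ : IsCoaction τ)
    (x : X) (y : Y) (z : Z) :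
    comoduleBraiding 𝓡 (tensorCoaction ρ σ) τ ((x ⊗ₜ y) ⊗ₜ z) =
      TensorProduct.assoc k Z X Y ((comoduleBraiding 𝓡 ρ τ).rTensor Y
        ((TensorProduct.assoc k X Z Y).symm (x ⊗ₜ comoduleBraiding 𝓡 σ τ (y ⊗ₜ z)))) := by
  have e : ∀ w : Z ⊗[k] Y, (comoduleBraiding 𝓡 ρ τ).rTensor Y
        ((TensorProduct.assoc k X Z Y).symm (x ⊗ₜ w)) =
      (formContract 𝓡 Z X ∘ₗ (TensorProduct.mk k _ _).flip (ρ x) ∘ₗ τ).rTensor Y w := by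
    intro w
    induction w using TensorProduct.induction_on with
    | zero => simp
    | add w w' h h' => simp only [map_add, TensorProduct.tmul_add, h, h']
    | tmul z y => simp [comoduleBraiding_tmul]
  rw [e, comoduleBraiding_tmul, comoduleBraiding_tmul, tensorCoaction_tmul]
  clear e
  induction ρ x using TensorProduct.induction_on with
  | zero => simp [LinearMap.zero_comp, LinearMap.comp_zero]
  | add u u' h h' =>
    simp only [map_add, TensorProduct.tmul_add, TensorProduct.add_tmul, LinearMap.add_comp,
      LinearMap.comp_add, LinearMap.rTensor_add, LinearMap.add_apply, h, h']
  | tmul x a =>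
  induction σ y using TensorProduct.induction_on with
  | zero => simp
  | add u u' h h' => simp only [map_add, TensorProduct.tmul_add, h, h']
  | tmul y b =>
  -- Both sides are `Θ` applied to a twofold coaction of `z`, namely `𝓡(z₁, a) 𝓡(z₂, b) z₀ ⊗ (x ⊗
  -- y)`. The left side reaches it through `Δ`, by multiplicativity of `𝓡` in the second argument.
  -- The right side reaches it by coacting twice: the braiding with `y` takes the outer leg first,
  -- which leaves the inner one for `x`. Coassociativity of `τ` identifies the two.
  let Θ : Z ⊗[k] (A ⊗[k] A) →ₗ[k] Z ⊗[k] (X ⊗[k] Y) :=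
    (LinearMap.toSpanSingleton k _ (x ⊗ₜ[k] y) ∘ₗ LinearMap.mul' k k ∘ₗ TensorProduct.map
      ((TensorProduct.curry 𝓡).flip a) ((TensorProduct.curry 𝓡).flip b)).lTensor Z
  have c1 : ∀ w : Z ⊗[k] A, formContract 𝓡 Z (X ⊗[k] Y) (w ⊗ₜ ((x ⊗ₜ y) ⊗ₜ (a * b))) =
      Θ ((Coalgebra.comul (R := k) (A := A)).lTensor Z w) := by
    intro w
    induction w using TensorProduct.induction_on with
    | zero => simp
    | add w w' h h' => simp only [map_add, TensorProduct.add_tmul, h, h']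
    | tmul z c =>
      rw [formContract_tmul, h𝓡.tmul_mul]
      simp [Θ]
  have c2 : ∀ w : Z ⊗[k] A, TensorProduct.assoc k Z X Y
      ((formContract 𝓡 Z X ∘ₗ (TensorProduct.mk k _ _).flip (x ⊗ₜ a) ∘ₗ τ).rTensor Y
        (formContract 𝓡 Z Y (w ⊗ₜ (y ⊗ₜ b)))) =
      Θ (TensorProduct.assoc k Z A A (τ.rTensor A w)) := by
    intro w
    induction w using TensorProduct.induction_on with
    | zero => simp
    | add w w' h h' => simp only [map_add, TensorProduct.add_tmul, h, h']
    | tmul z c =>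
      simp only [formContract_tmul, map_smul, LinearMap.rTensor_tmul, LinearMap.comp_apply,
        LinearMap.flip_apply, TensorProduct.mk_apply]
      induction τ z using TensorProduct.induction_on with
      | zero => simp
      | add w w' h h' => simp only [map_add, TensorProduct.add_tmul, smul_add, h, h']
      | tmul z c' =>
        simp [Θ, smul_smul, mul_comm, ← TensorProduct.smul_tmul']
  rw [tmulA_tmul, c1, c2, hτ.coassoc_apply]

/-- `R_{X, Y ⊗ Z} = (1 ⊗ R_{X, Z}) (R_{X, Y} ⊗ 1)`. -/
theorem comoduleBraiding_tensor_right {𝓡 : A ⊗[k] A →ₗ[k] k} (h𝓡 : IsSkewPairing 𝓡)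
    {ρ : X →ₗ[k] X ⊗[k] A} (hρ : IsCoaction ρ) (σ : Y →ₗ[k] Y ⊗[k] A) (τ : Z →ₗ[k] Z ⊗[k] A)
    (x : X) (y : Y) (z : Z) :
    comoduleBraiding 𝓡 ρ (tensorCoaction σ τ) (x ⊗ₜ (y ⊗ₜ z)) =
      (TensorProduct.assoc k Y Z X).symm ((comoduleBraiding 𝓡 ρ τ).lTensor Y
        (TensorProduct.assoc k Y X Z (comoduleBraiding 𝓡 ρ σ (x ⊗ₜ y) ⊗ₜ z))) := by
  have e : ∀ w : Y ⊗[k] X, (comoduleBraiding 𝓡 ρ τ).lTensor Y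
        (TensorProduct.assoc k Y X Z (w ⊗ₜ z)) =
      (formContract 𝓡 Z X ∘ₗ TensorProduct.mk k _ _ (τ z) ∘ₗ ρ).lTensor Y w := by
    intro w
    induction w using TensorProduct.induction_on with
    | zero => simp
    | add w w' h h' => simp only [map_add, TensorProduct.add_tmul, h, h']
    | tmul z y => simp [comoduleBraiding_tmul]
  rw [e, comoduleBraiding_tmul, comoduleBraiding_tmul, tensorCoaction_tmul]
  clear e
  induction τ z using TensorProduct.induction_on with
  | zero => simp [LinearMap.zero_comp, LinearMap.comp_zero]
  | add u u' h h' =>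
    simp only [map_add, TensorProduct.tmul_add, TensorProduct.add_tmul, LinearMap.add_comp,
      LinearMap.comp_add, LinearMap.lTensor_add, LinearMap.add_apply, h, h']
  | tmul z c =>
  induction σ y using TensorProduct.induction_on with
  | zero => simp
  | add u u' h h' => simp only [map_add, TensorProduct.add_tmul, h, h']
  | tmul y b =>
  -- Now `x` coacts twice, and the common value is `𝓡(c, x₁) 𝓡(b, x₂) (y ⊗ z) ⊗ x₀`. The braiding
  -- with `y` comes first and uses the outer leg `x₂`; this is why `𝓡(b c, -)` has to expand with
  -- the factors in reversed order, as in `mul_tmul`.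
  let Θ : X ⊗[k] (A ⊗[k] A) →ₗ[k] (Y ⊗[k] Z) ⊗[k] X :=
    (TensorProduct.comm k _ _).toLinearMap ∘ₗ
    (LinearMap.toSpanSingleton k _ (y ⊗ₜ[k] z) ∘ₗ LinearMap.mul' k k ∘ₗ TensorProduct.map
      (TensorProduct.curry 𝓡 c) (TensorProduct.curry 𝓡 b)).lTensor X
  have c1 : ∀ w : X ⊗[k] A, formContract 𝓡 (Y ⊗[k] Z) X (((y ⊗ₜ z) ⊗ₜ (b * c)) ⊗ₜ w) =
      Θ ((Coalgebra.comul (R := k) (A := A)).lTensor X w) := by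
    intro w
    induction w using TensorProduct.induction_on with
    | zero => simp
    | add w w' h h' => simp only [map_add, TensorProduct.tmul_add, h, h']
    | tmul x a =>
      rw [formContract_tmul, h𝓡.mul_tmul]
      simp [Θ, TensorProduct.smul_tmul']
  have c2 : ∀ w : X ⊗[k] A, (TensorProduct.assoc k Y Z X).symm
      ((formContract 𝓡 Z X ∘ₗ TensorProduct.mk k _ _ (z ⊗ₜ c) ∘ₗ ρ).lTensor Y
        (formContract 𝓡 Y X ((y ⊗ₜ b) ⊗ₜ w))) =
      Θ (TensorProduct.assoc k X A A (ρ.rTensor A w)) := by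
    intro w
    induction w using TensorProduct.induction_on with
    | zero => simp
    | add w w' h h' => simp only [map_add, TensorProduct.tmul_add, h, h']
    | tmul x a =>
      simp only [formContract_tmul, map_smul, LinearMap.lTensor_tmul, LinearMap.comp_apply,
        TensorProduct.mk_apply, LinearMap.rTensor_tmul]
      induction ρ x using TensorProduct.induction_on with
      | zero => simp
      | add w w' h h' =>
        simp only [map_add, TensorProduct.tmul_add, TensorProduct.add_tmul, smul_add, h, h']
      | tmul x a' => simp [Θ, TensorProduct.smul_tmul', smul_smul, mul_comm]
  rw [tmulA_tmul, c1, c2, hρ.coassoc_apply]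

/-- If `𝓢(a₁, b₁) 𝓡(b₂, a₂) = ε(a) ε(b)`, then the braiding of `𝓢` is a left inverse of the
braiding of `𝓡`. -/
theorem comoduleBraiding_leftInverse {𝓡 𝓢 : A ⊗[k] A →ₗ[k] k}
    (h : ∀ a b : A, LinearMap.mul' k k (TensorProduct.map 𝓢 (𝓡 ∘ₗ (TensorProduct.comm k A A).toLinearMap)
      (TensorProduct.tensorTensorTensorComm k A A A A
        (Coalgebra.comul (R := k) a ⊗ₜ Coalgebra.comul (R := k) b))) =
      Coalgebra.counit (R := k) a * Coalgebra.counit (R := k) b)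
    {ρ : X →ₗ[k] X ⊗[k] A} (hρ : IsCoaction ρ) {σ : Y →ₗ[k] Y ⊗[k] A} (hσ : IsCoaction σ) :
    comoduleBraiding 𝓢 σ ρ ∘ₗ comoduleBraiding 𝓡 ρ σ = LinearMap.id := by
  refine TensorProduct.ext' fun x y => ?_
  rw [LinearMap.comp_apply, comoduleBraiding_tmul, LinearMap.id_apply]
  -- The composite is `𝓢(x₁, y₁) 𝓡(y₂, x₂) x₀ ⊗ y₀`: the second braiding coacts on `x₀` and `y₀`, so
  -- `𝓢` receives the inner legs. After coassociativity in both variables the scalar is the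
  -- convolution product of the hypothesis, and the counit axioms finish.
  let Θ : (X ⊗[k] (A ⊗[k] A)) ⊗[k] (Y ⊗[k] (A ⊗[k] A)) →ₗ[k] X ⊗[k] Y :=
    (TensorProduct.rid k (X ⊗[k] Y)).toLinearMap ∘ₗ
    (LinearMap.mul' k k ∘ₗ TensorProduct.map 𝓢 (𝓡 ∘ₗ (TensorProduct.comm k A A).toLinearMap) ∘ₗ
      (TensorProduct.tensorTensorTensorComm k A A A A).toLinearMap).lTensor (X ⊗[k] Y) ∘ₗ
    (TensorProduct.tensorTensorTensorComm k X (A ⊗[k] A) Y (A ⊗[k] A)).toLinearMap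
  have c1 : ∀ (u : X ⊗[k] A) (v : Y ⊗[k] A),
      comoduleBraiding 𝓢 σ ρ (formContract 𝓡 Y X (v ⊗ₜ u)) =
      Θ (TensorProduct.assoc k X A A (ρ.rTensor A u) ⊗ₜ
        TensorProduct.assoc k Y A A (σ.rTensor A v)) := by
    intro u v
    induction u using TensorProduct.induction_on with
    | zero => simp
    | add w w' h h' => simp only [map_add, TensorProduct.tmul_add, TensorProduct.add_tmul, h, h']
    | tmul x a =>
    induction v using TensorProduct.induction_on with
    | zero => simp
    | add w w' h h' => simp only [map_add, TensorProduct.tmul_add, TensorProduct.add_tmul, h, h']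
    | tmul y b =>
    rw [formContract_tmul, map_smul, comoduleBraiding_tmul, LinearMap.rTensor_tmul,
      LinearMap.rTensor_tmul]
    induction ρ x using TensorProduct.induction_on with
    | zero => simp
    | add w w' h h' => simp only [map_add, TensorProduct.add_tmul, smul_add, h, h']
    | tmul x a' =>
    induction σ y using TensorProduct.induction_on with
    | zero => simp
    | add w w' h h' =>
      simp only [map_add, TensorProduct.tmul_add, TensorProduct.add_tmul, smul_add, h, h']
    | tmul y b' => simp [Θ, smul_smul, mul_comm]
  have c2 : ∀ (u : X ⊗[k] A) (v : Y ⊗[k] A),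
      Θ ((Coalgebra.comul (R := k) (A := A)).lTensor X u ⊗ₜ
        (Coalgebra.comul (R := k) (A := A)).lTensor Y v) =
      TensorProduct.rid k X ((Coalgebra.counit (R := k) (A := A)).lTensor X u) ⊗ₜ
        TensorProduct.rid k Y ((Coalgebra.counit (R := k) (A := A)).lTensor Y v) := by
    intro u v
    induction u using TensorProduct.induction_on with
    | zero => simp
    | add w w' h h' => simp only [map_add, TensorProduct.add_tmul, h, h']
    | tmul x a =>
    induction v using TensorProduct.induction_on with
    | zero => simp
    | add w w' h h' => simp only [map_add, TensorProduct.tmul_add, h, h']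
    | tmul y b =>
    have := h a b
    simp only [Θ, LinearMap.comp_apply, LinearMap.lTensor_tmul, LinearEquiv.coe_coe,
      TensorProduct.tensorTensorTensorComm_tmul, TensorProduct.rid_tmul, this]
    rw [TensorProduct.smul_tmul_smul]
  rw [c1, hρ.coassoc_apply, hσ.coassoc_apply, c2, hρ.counit_apply, hσ.counit_apply]

/-- This is where `Δ` and `ε` have to be multiplicative. Both ways of coacting twice are rewritten
as a product of legs in the algebra `A ⊗ A`, where the coassociativity of each factor applies
separately. -/
theorem IsCoaction.tensor {ρ : X →ₗ[k] X ⊗[k] A} (hρ : IsCoaction ρ) {σ : Y →ₗ[k] Y ⊗[k] A}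
    (hσ : IsCoaction σ) : IsCoaction (tensorCoaction ρ σ) where
  coassoc := by
    refine TensorProduct.ext' fun x y => ?_
    simp only [LinearMap.comp_apply, LinearEquiv.coe_coe, tensorCoaction_tmul]
    have c1 : ∀ (u : X ⊗[k] A) (v : Y ⊗[k] A), TensorProduct.assoc k (X ⊗[k] Y) A A
        ((tensorCoaction ρ σ).rTensor A (tmulA X Y A (u ⊗ₜ v))) =
        tmulA X Y (A ⊗[k] A) (TensorProduct.assoc k X A A (ρ.rTensor A u) ⊗ₜ
          TensorProduct.assoc k Y A A (σ.rTensor A v)) := by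
      intro u v
      induction u using TensorProduct.induction_on with
      | zero => simp
      | add w w' h h' => simp only [map_add, TensorProduct.add_tmul, h, h']
      | tmul x a =>
      induction v using TensorProduct.induction_on with
      | zero => simp
      | add w w' h h' => simp only [map_add, TensorProduct.tmul_add, h, h']
      | tmul y b =>
      rw [tmulA_tmul, LinearMap.rTensor_tmul, tensorCoaction_tmul, LinearMap.rTensor_tmul,
        LinearMap.rTensor_tmul]
      induction ρ x using TensorProduct.induction_on with
      | zero => simp
      | add w w' h h' => simp only [map_add, TensorProduct.add_tmul, h, h']
      | tmul x a' =>
      induction σ y using TensorProduct.induction_on with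
      | zero => simp
      | add w w' h h' => simp only [map_add, TensorProduct.tmul_add, TensorProduct.add_tmul, h, h']
      | tmul y b' => simp
    have c2 : ∀ (u : X ⊗[k] A) (v : Y ⊗[k] A),
        (Coalgebra.comul (R := k) (A := A)).lTensor (X ⊗[k] Y) (tmulA X Y A (u ⊗ₜ v)) =
        tmulA X Y (A ⊗[k] A) ((Coalgebra.comul (R := k) (A := A)).lTensor X u ⊗ₜ
          (Coalgebra.comul (R := k) (A := A)).lTensor Y v) := by
      intro u v
      induction u using TensorProduct.induction_on with
      | zero => simp
      | add w w' h h' => simp only [map_add, TensorProduct.add_tmul, h, h']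
      | tmul x a =>
      induction v using TensorProduct.induction_on with
      | zero => simp
      | add w w' h h' => simp only [map_add, TensorProduct.tmul_add, h, h']
      | tmul y b => simp [Bialgebra.comul_mul]
    rw [c1, c2, hρ.coassoc_apply, hσ.coassoc_apply]
  counit := by
    refine TensorProduct.ext' fun x y => ?_
    simp only [LinearMap.comp_apply, LinearEquiv.coe_coe, tensorCoaction_tmul, LinearMap.id_apply]
    have c : ∀ (u : X ⊗[k] A) (v : Y ⊗[k] A), TensorProduct.rid k (X ⊗[k] Y)
        ((Coalgebra.counit (R := k) (A := A)).lTensor (X ⊗[k] Y) (tmulA X Y A (u ⊗ₜ v))) =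
        TensorProduct.rid k X ((Coalgebra.counit (R := k) (A := A)).lTensor X u) ⊗ₜ
          TensorProduct.rid k Y ((Coalgebra.counit (R := k) (A := A)).lTensor Y v) := by
      intro u v
      induction u using TensorProduct.induction_on with
      | zero => simp
      | add w w' h h' => simp only [map_add, TensorProduct.add_tmul, h, h']
      | tmul x a =>
      induction v using TensorProduct.induction_on with
      | zero => simp
      | add w w' h h' => simp only [map_add, TensorProduct.tmul_add, h, h']
      | tmul y b => simp [← TensorProduct.smul_tmul', smul_smul, mul_comm]
    rw [c, hρ.counit_apply, hσ.counit_apply]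

/-- Needed because the coaction on `V^{⊗ (d + 1)}` is by definition the tensor coaction on `V^{⊗ d}
⊗ V` transported along `snocE`. -/
theorem IsCoaction.congr {ρ : X →ₗ[k] X ⊗[k] A} (hρ : IsCoaction ρ) (E : X ≃ₗ[k] Y) :
    IsCoaction (E.toLinearMap.rTensor A ∘ₗ ρ ∘ₗ E.symm.toLinearMap) where
  coassoc := by
    refine LinearMap.ext fun y => ?_
    obtain ⟨x, rfl⟩ := E.surjective y
    simp only [LinearMap.comp_apply, LinearEquiv.coe_coe, LinearEquiv.symm_apply_apply]
    have c1 : ∀ u : X ⊗[k] A, TensorProduct.assoc k Y A A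
        ((E.toLinearMap.rTensor A ∘ₗ ρ ∘ₗ E.symm.toLinearMap).rTensor A
          (E.toLinearMap.rTensor A u)) =
        E.toLinearMap.rTensor (A ⊗[k] A) (TensorProduct.assoc k X A A (ρ.rTensor A u)) := by
      intro u
      induction u using TensorProduct.induction_on with
      | zero => simp
      | add w w' h h' => simp only [map_add, h, h']
      | tmul x a =>
      simp only [LinearMap.rTensor_tmul, LinearMap.comp_apply, LinearEquiv.coe_coe,
        LinearEquiv.symm_apply_apply]
      induction ρ x using TensorProduct.induction_on with
      | zero => simp
      | add w w' h h' => simp only [map_add, TensorProduct.add_tmul, h, h']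
      | tmul x a' => simp
    have c2 : ∀ u : X ⊗[k] A, (Coalgebra.comul (R := k) (A := A)).lTensor Y
          (E.toLinearMap.rTensor A u) =
        E.toLinearMap.rTensor (A ⊗[k] A) ((Coalgebra.comul (R := k) (A := A)).lTensor X u) := by
      intro u
      induction u using TensorProduct.induction_on with
      | zero => simp
      | add w w' h h' => simp only [map_add, h, h']
      | tmul x a => simp
    rw [c1, c2, hρ.coassoc_apply]
  counit := by
    refine LinearMap.ext fun y => ?_
    obtain ⟨x, rfl⟩ := E.surjective y
    simp only [LinearMap.comp_apply, LinearEquiv.coe_coe, LinearEquiv.symm_apply_apply,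
      LinearMap.id_apply]
    have c : ∀ u : X ⊗[k] A, TensorProduct.rid k Y ((Coalgebra.counit (R := k) (A := A)).lTensor Y
          (E.toLinearMap.rTensor A u)) =
        E (TensorProduct.rid k X ((Coalgebra.counit (R := k) (A := A)).lTensor X u)) := by
      intro u
      induction u using TensorProduct.induction_on with
      | zero => simp
      | add w w' h h' => simp only [map_add, h, h']
      | tmul x a => simp
    rw [c, hρ.counit_apply]

theorem IsCoaction.tpow {ρ : X →ₗ[k] X ⊗[k] A} (hρ : IsCoaction ρ) (d : ℕ) :
    IsCoaction (tpowCoaction ρ d) := by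
  induction d with
  | zero =>
    constructor
    · refine LinearMap.ext fun x => ?_
      simp [tpowCoaction, Algebra.TensorProduct.one_def]
    · refine LinearMap.ext fun x => ?_
      simp [tpowCoaction]
  | succ d ih => exact (ih.tensor hρ).congr (snocE d)

end ComoduleBraiding

/-! ### Convolution inverses of skew pairings -/

section ConvolutionInverse

namespace IsSkewPairing
variable {k : Type u} [Field k] {A B : Type u} [Ring A] [Bialgebra k A] [Ring B] [Bialgebra k B]

/-- Both rules involve only products and coproducts, and `φ` respects both. It will be applied to
the reversal of indices. -/
theorem comp {𝓡 : B ⊗[k] B →ₗ[k] k} (h : IsSkewPairing 𝓡) (φ : A →ₐ[k] B)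
    (hφ : ∀ a, Coalgebra.comul (R := k) (φ a) =
      TensorProduct.map φ.toLinearMap φ.toLinearMap (Coalgebra.comul (R := k) a)) :
    IsSkewPairing (𝓡 ∘ₗ TensorProduct.map φ.toLinearMap φ.toLinearMap) where
  tmul_mul a b c := by
    simp only [LinearMap.comp_apply, TensorProduct.map_tmul, AlgHom.toLinearMap_apply, map_mul,
      h.tmul_mul, hφ, TensorProduct.map_map]
    congr 2
  mul_tmul a b c := by
    simp only [LinearMap.comp_apply, TensorProduct.map_tmul, AlgHom.toLinearMap_apply, map_mul,
      h.mul_tmul, hφ, TensorProduct.map_map]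
    congr 2

end IsSkewPairing

namespace FRT
variable {k : Type u} [Field k] {ι : Type} [Fintype ι] [DecidableEq ι]
variable {R : ι → ι → ι → ι → k}

/-- Elements `a` with `m(a₁) n(a₂) = ε(a)` form a subspace, and `hmul` makes it closed under
products since `Δ` and `ε` are multiplicative; so the generators decide. The hypothesis `hmul`
speaks of arbitrary tensors `s`, `t` and not of coproducts, so that bilinearity can be used to
verify it. -/
theorem convolution_eq_counit {C : Type*} [Ring C] [Algebra k C] (m n : FRT R →ₗ[k] C)
    (hm : m 1 = 1) (hn : n 1 = 1)
    (hgen : ∀ i j, ∑ c, m (x R i c) * n (x R c j) = if i = j then 1 else 0)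
    (hmul : ∀ (s t : FRT R ⊗[k] FRT R) (c d : k),
      LinearMap.mul' k C (TensorProduct.map m n s) = algebraMap k C c →
      LinearMap.mul' k C (TensorProduct.map m n t) = algebraMap k C d →
      LinearMap.mul' k C (TensorProduct.map m n (s * t)) = algebraMap k C (c * d)) (a : FRT R) :
    LinearMap.mul' k C (TensorProduct.map m n (Coalgebra.comul (R := k) a)) =
      algebraMap k C (Coalgebra.counit (R := k) a) := by
  induction a using FRT.induction with
  | hx i j =>
    rw [comul_x, counit_x, map_sum, map_sum]
    simp only [TensorProduct.map_tmul, LinearMap.mul'_apply, hgen]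
    split_ifs <;> simp
  | hc r =>
    rw [Bialgebra.comul_algebraMap, Bialgebra.counit_algebraMap, Algebra.algebraMap_eq_smul_one,
      map_smul, map_smul, Algebra.TensorProduct.one_def, TensorProduct.map_tmul,
      LinearMap.mul'_apply, hm, hn, mul_one, Algebra.algebraMap_eq_smul_one]
  | hadd a b ha hb => simp only [map_add, ha, hb]
  | hmul a b ha hb => rw [Bialgebra.comul_mul, Bialgebra.counit_mul]; exact hmul _ _ _ _ ha hb

theorem convolution_eq_counit_of_antihom {C : Type*} [Ring C] [Algebra k C] (m n : FRT R →ₗ[k] C)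
    (hm : m 1 = 1) (hn : n 1 = 1) (hmm : ∀ a b, m (a * b) = m b * m a)
    (hnm : ∀ a b, n (a * b) = n a * n b)
    (hgen : ∀ i j, ∑ c, m (x R i c) * n (x R c j) = if i = j then 1 else 0) (a : FRT R) :
    LinearMap.mul' k C (TensorProduct.map m n (Coalgebra.comul (R := k) a)) =
      algebraMap k C (Coalgebra.counit (R := k) a) := by
  refine convolution_eq_counit m n hm hn hgen (fun s t c d hs ht => ?_) a
  -- With `m` reversing products and `n` preserving them, a product contributes `m(b) m(a) n(a')
  -- n(b')`. The inner pair sums to the scalar `c`, which is central and can be pulled out before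
  -- the outer pair is summed.
  have key : ∀ t, LinearMap.mul' k C (TensorProduct.map m n (s * t)) =
      algebraMap k C c * LinearMap.mul' k C (TensorProduct.map m n t) := by
    intro t
    induction t using TensorProduct.induction_on with
    | zero => simp
    | add t t' h h' => simp only [map_add, mul_add, h, h']
    | tmul b b' =>
    have : ∀ s, LinearMap.mul' k C (TensorProduct.map m n (s * b ⊗ₜ[k] b')) =
        m b * LinearMap.mul' k C (TensorProduct.map m n s) * n b' := by
      intro s
      induction s using TensorProduct.induction_on with
      | zero => simp
      | add t t' h h' => simp only [map_add, mul_add, add_mul, h, h']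
      | tmul a a' => simp [hmm, hnm, mul_assoc]
    rw [this, hs, ← Algebra.commutes, mul_assoc, TensorProduct.map_tmul, LinearMap.mul'_apply]
  rw [key, ht, map_mul]

theorem convolution_eq_counit_of_hom {C : Type*} [Ring C] [Algebra k C] (m n : FRT R →ₗ[k] C)
    (hm : m 1 = 1) (hn : n 1 = 1) (hmm : ∀ a b, m (a * b) = m a * m b)
    (hnm : ∀ a b, n (a * b) = n b * n a)
    (hgen : ∀ i j, ∑ c, m (x R i c) * n (x R c j) = if i = j then 1 else 0) (a : FRT R) :
    LinearMap.mul' k C (TensorProduct.map m n (Coalgebra.comul (R := k) a)) =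
      algebraMap k C (Coalgebra.counit (R := k) a) := by
  refine convolution_eq_counit m n hm hn hgen (fun s t c d hs ht => ?_) a
  -- Here `m` preserves products and `n` reverses them, so the second factor `t` is the inner one
  -- and collapses first.
  have key : ∀ s, LinearMap.mul' k C (TensorProduct.map m n (s * t)) =
      algebraMap k C d * LinearMap.mul' k C (TensorProduct.map m n s) := by
    intro s
    induction s using TensorProduct.induction_on with
    | zero => simp
    | add t t' h h' => simp only [map_add, mul_add, add_mul, h, h']
    | tmul b b' =>
    have : ∀ t, LinearMap.mul' k C (TensorProduct.map m n (b ⊗ₜ[k] b' * t)) =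
        m b * LinearMap.mul' k C (TensorProduct.map m n t) * n b' := by
      intro t
      induction t using TensorProduct.induction_on with
      | zero => simp
      | add t t' h h' => simp only [map_add, mul_add, add_mul, h, h']
      | tmul a a' => simp [hmm, hnm, mul_assoc]
    rw [this, ht, ← Algebra.commutes, mul_assoc, TensorProduct.map_tmul, LinearMap.mul'_apply]
  rw [key, hs, ← map_mul, mul_comm]

open WithConv in
/-- Two skew pairings on `FRT R` that are inverse to each other on the generators are
convolution inverse. -/
theorem skewPairing_convolution {𝓡 𝓢 : FRT R ⊗[k] FRT R →ₗ[k] k} (h𝓡 : IsSkewPairing 𝓡)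
    (h𝓢 : IsSkewPairing 𝓢)
    (h𝓡1 : ∀ a, 𝓡 (a ⊗ₜ 1) = Coalgebra.counit (R := k) a)
    (h𝓡2 : ∀ a, 𝓡 (1 ⊗ₜ a) = Coalgebra.counit (R := k) a)
    (h𝓢1 : ∀ a, 𝓢 (a ⊗ₜ 1) = Coalgebra.counit (R := k) a)
    (h𝓢2 : ∀ a, 𝓢 (1 ⊗ₜ a) = Coalgebra.counit (R := k) a)
    (hgen : ∀ i j l m, ∑ d, ∑ c, 𝓢 (x R i c ⊗ₜ x R l d) * 𝓡 (x R d m ⊗ₜ x R c j) =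
      if i = j ∧ l = m then 1 else 0) (a b : FRT R) :
    LinearMap.mul' k k (TensorProduct.map 𝓢
      (𝓡 ∘ₗ (TensorProduct.comm k (FRT R) (FRT R)).toLinearMap)
      (TensorProduct.tensorTensorTensorComm k _ _ _ _
        (Coalgebra.comul (R := k) a ⊗ₜ Coalgebra.comul (R := k) b))) =
      Coalgebra.counit (R := k) a * Coalgebra.counit (R := k) b := by
  -- First stage: the variable `a` is a generator and `b` is arbitrary. Collecting the values at all
  -- generators in matrices, `M` preserves products by the rule for `𝓢(a, b c)` and `N` reverses
  -- them by the rule for `𝓡(a b, c)`. The matrix identity on generators `b` is `hgen`.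
  let M : FRT R →ₗ[k] Matrix ι ι k := LinearMap.pi fun i => LinearMap.pi fun c =>
    TensorProduct.curry 𝓢 (x R i c)
  let N : FRT R →ₗ[k] Matrix ι ι k := LinearMap.pi fun c => LinearMap.pi fun j =>
    (TensorProduct.curry 𝓡).flip (x R c j)
  have hM : ∀ b i c, M b i c = 𝓢 (x R i c ⊗ₜ b) := fun _ _ _ => rfl
  have hN : ∀ b i c, N b i c = 𝓡 (b ⊗ₜ x R i c) := fun _ _ _ => rfl
  have hMN := convolution_eq_counit_of_hom M N
    (by ext i j; rw [hM, h𝓢1, counit_x, Matrix.one_apply])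
    (by ext i j; rw [hN, h𝓡2, counit_x, Matrix.one_apply])
    (by intro a b; ext i j; simp [hM, h𝓢.tmul_mul, comul_x, Matrix.mul_apply])
    (by intro a b; ext i j; simp [hN, h𝓡.mul_tmul, comul_x, Matrix.mul_apply])
    (by
      intro l m
      ext i j
      simp only [Matrix.sum_apply, Matrix.mul_apply, hM, hN, hgen]
      by_cases h1 : l = m <;> by_cases h2 : i = j <;> simp [h1, h2, Matrix.one_apply])
  -- Second stage: `a` is arbitrary. In the convolution algebra of functionals of `b`, the map `a ↦
  -- 𝓢(a, -)` reverses products and `a ↦ 𝓡(-, a)` preserves them, and the required identity on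
  -- generators `a` is the result of the first stage.
  let m : FRT R →ₗ[k] WithConv (FRT R →ₗ[k] k) :=
    (WithConv.linearEquiv k (FRT R →ₗ[k] k)).symm.toLinearMap ∘ₗ TensorProduct.curry 𝓢
  let n : FRT R →ₗ[k] WithConv (FRT R →ₗ[k] k) :=
    (WithConv.linearEquiv k (FRT R →ₗ[k] k)).symm.toLinearMap ∘ₗ (TensorProduct.curry 𝓡).flip
  have hm : ∀ a b, m a b = 𝓢 (a ⊗ₜ b) := fun _ _ => rfl
  have hn : ∀ a b, n a b = 𝓡 (b ⊗ₜ a) := fun _ _ => rfl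
  have hmn := convolution_eq_counit_of_antihom m n
    (by ext b; rw [hm, h𝓢2]; simp)
    (by ext b; rw [hn, h𝓡1]; simp)
    (by intro a b; ext c; rw [hm, h𝓢.mul_tmul, LinearMap.convMul_apply]; rfl)
    (by intro a b; ext c; rw [hn, h𝓡.tmul_mul, LinearMap.convMul_apply]; rfl)
    (by
      intro i j
      ext b
      have h := congrFun (congrFun (hMN b) i) j
      have e : ∀ t : FRT R ⊗[k] FRT R,
          LinearMap.mul' k (Matrix ι ι k) (TensorProduct.map M N t) i j =
          ∑ c, LinearMap.mul' k k (TensorProduct.map (m (x R i c)).ofConv (n (x R c j)).ofConv t) := by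
        intro t
        induction t using TensorProduct.induction_on with
        | zero => simp
        | add t t' h h' => simp only [map_add, Matrix.add_apply, h, h', Finset.sum_add_distrib]
        | tmul a a' =>
          simp only [TensorProduct.map_tmul, LinearMap.mul'_apply, Matrix.mul_apply]
          rfl
      rw [e] at h
      simp only [ofConv_sum, LinearMap.sum_apply, LinearMap.convMul_apply]
      rw [h, Matrix.algebraMap_matrix_apply]
      split_ifs <;> simp) a
  have h := congrArg (fun f : WithConv (FRT R →ₗ[k] k) => f b) hmn
  refine Eq.trans ?_ (h.trans ?_)
  · generalize Coalgebra.comul (R := k) a = s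
    induction s using TensorProduct.induction_on with
    | zero => simp
    | add s t hs ht =>
      simp only [map_add, TensorProduct.add_tmul, hs, ht]
      rfl
    | tmul a a' =>
      rw [TensorProduct.map_tmul, LinearMap.mul'_apply, LinearMap.convMul_apply]
      induction Coalgebra.comul (R := k) b using TensorProduct.induction_on with
      | zero => simp
      | add s t hs ht => simp only [map_add, TensorProduct.tmul_add, hs, ht]
      | tmul b b' => simp; rfl
  · simp [Algebra.algebraMap_eq_smul_one]

/-! ### The universal form is a skew pairing -/

variable (hR : YangBaxter R)

theorem univR_tmul_one (a : FRT R) : univR hR (a ⊗ₜ 1) = Coalgebra.counit (R := k) a := by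
  rw [univR_tmul, map_one]; simp

theorem univR_tmul_mul (a b c : FRT R) :
    univR hR (a ⊗ₜ (b * c)) = LinearMap.mul' k k (TensorProduct.map
      ((TensorProduct.curry (univR hR)).flip b) ((TensorProduct.curry (univR hR)).flip c)
      (Coalgebra.comul (R := k) a)) := by
  rw [univR_tmul, map_mul, LinearMap.convMul_apply]
  rfl

/-- On a generator this reads off an entry of `ell hR 1`, the identity matrix. The passage to
products uses that `1` is grouplike. -/
theorem univR_one_tmul (a : FRT R) : univR hR (1 ⊗ₜ a) = Coalgebra.counit (R := k) a := by
  induction a using FRT.induction with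
  | hx i j =>
    rw [univR_tmul, univHom_x, map_one, Matrix.one_apply, counit_x]
    simp only [eq_comm]
  | hc r => rw [Algebra.algebraMap_eq_smul_one, TensorProduct.tmul_smul, map_smul, univR_tmul_one,
      map_smul]
  | hadd a b ha hb => simp only [TensorProduct.tmul_add, map_add, ha, hb]
  | hmul a b ha hb =>
    rw [univR_tmul_mul, Bialgebra.comul_one, Algebra.TensorProduct.one_def, TensorProduct.map_tmul,
      Bialgebra.counit_mul, ← ha, ← hb]
    rfl

/-- Multiplicativity in the second argument is built into `univHom`; this rule in the first argument
comes by induction on `c`. For a generator it is multiplicativity of the matrix representation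
`ell`, whose transposed indexing puts `b` on `c₁` and `a` on `c₂`. -/
theorem univR_mul_tmul (a b c : FRT R) :
    univR hR ((a * b) ⊗ₜ c) = LinearMap.mul' k k (TensorProduct.map
      (TensorProduct.curry (univR hR) b) (TensorProduct.curry (univR hR) a)
      (Coalgebra.comul (R := k) c)) := by
  induction c using FRT.induction generalizing a b with
  | hx i j =>
    simp only [comul_x, map_sum, TensorProduct.map_tmul, LinearMap.mul'_apply,
      TensorProduct.curry_apply, univR_tmul, univHom_x, map_mul, Matrix.mul_apply]
    exact Finset.sum_congr rfl fun c _ => mul_comm _ _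
  | hc r =>
    rw [Algebra.algebraMap_eq_smul_one, TensorProduct.tmul_smul, map_smul, map_smul, map_smul,
      map_smul, univR_tmul_one, Bialgebra.comul_one, Algebra.TensorProduct.one_def,
      TensorProduct.map_tmul, LinearMap.mul'_apply, TensorProduct.curry_apply,
      TensorProduct.curry_apply, univR_tmul_one, univR_tmul_one, Bialgebra.counit_mul, mul_comm]
  | hadd c d hc hd => simp only [TensorProduct.tmul_add, map_add, hc, hd]
  | hmul c d hc hd =>
    have e1 := (Coalgebra.Repr.arbitrary k a).eq
    have e2 := (Coalgebra.Repr.arbitrary k b).eq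
    have e3 := (Coalgebra.Repr.arbitrary k c).eq
    have e4 := (Coalgebra.Repr.arbitrary k d).eq
    rw [univR_tmul_mul, Bialgebra.comul_mul, Bialgebra.comul_mul, ← e1, ← e2, ← e3, ← e4]
    simp only [Finset.sum_mul_sum, map_sum, Algebra.TensorProduct.tmul_mul_tmul,
      TensorProduct.map_tmul, LinearMap.mul'_apply, LinearMap.flip_apply,
      TensorProduct.curry_apply, hc, hd, univR_tmul_mul]
    rw [← e1, ← e2, ← e3, ← e4]
    simp only [Finset.sum_mul_sum, map_sum,
      TensorProduct.map_tmul, LinearMap.mul'_apply, LinearMap.flip_apply,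
      TensorProduct.curry_apply]
    -- Both sides now consist of the products `𝓡(b₁, c₁) 𝓡(a₁, c₂) 𝓡(b₂, d₁) 𝓡(a₂, d₂)`. They differ
    -- only in the order of summation and of the factors.
    have e : ∀ {α β γ δ : Type u} (s : Finset α) (t : Finset β) (u : Finset γ) (v : Finset δ)
        (G : α → β → γ → δ → k), ∑ i ∈ s, ∑ j ∈ t, ∑ p ∈ u, ∑ r ∈ v, G i j p r =
        ∑ p ∈ u, ∑ r ∈ v, ∑ j ∈ t, ∑ i ∈ s, G i j p r := by
      intro α β γ δ s t u v G
      rw [Finset.sum_congr rfl fun i _ => Finset.sum_comm, Finset.sum_comm]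
      refine Finset.sum_congr rfl fun p _ => ?_
      rw [Finset.sum_congr rfl fun i _ => Finset.sum_comm, Finset.sum_comm]
      exact Finset.sum_congr rfl fun r _ => Finset.sum_comm
    rw [e]
    refine Finset.sum_congr rfl fun p _ => Finset.sum_congr rfl fun r _ =>
      Finset.sum_congr rfl fun j _ => Finset.sum_congr rfl fun i _ => ?_
    ring

theorem univR_isSkewPairing : IsSkewPairing (univR hR) :=
  ⟨univR_tmul_mul hR, univR_mul_tmul hR⟩

end FRT

/-! ### The inverse form on quantum matrices, from the reversed order of the indices -/

namespace QMat
variable {k : Type u} [Field k] (q : kˣ) (n : ℕ)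

/-- The Hecke relation in the form `R = R⁻¹ + (q - q⁻¹)`. Reversing the order of the basis moves the
term with coefficient `q - q⁻¹` from pairs `i > j` to pairs `i < j`, and replacing `q` by `q⁻¹`
changes its sign, so the first summand is indeed the inverse of `R`; that fact is verified in
`invR_univR`. -/
theorem stdR_eq_rev_add (p r i j : Fin n) :
    stdR q n p r i j = stdR q⁻¹ n p.rev r.rev i.rev j.rev +
      if p = i ∧ r = j then (q : k) - (q : k)⁻¹ else 0 := by
  unfold stdR
  simp only [Fin.rev_lt_rev, Fin.rev_inj, Units.val_inv_eq_inv_val, inv_inv]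
  rcases lt_trichotomy i j with h | h | h
  · simp only [h, h.ne, h.not_gt, if_true, if_false]
    split_ifs <;> ring
  · subst h
    simp only [lt_irrefl, if_true, if_false]
    split_ifs <;> ring
  · simp only [h, h.ne', h.not_gt, if_true, if_false]
    split_ifs <;> ring

/-- The isomorphism `A_q(n,n) → A_{q⁻¹}(n,n)` that reverses the order of the indices. -/
def revHom : QMat q n →ₐ[k] QMat q⁻¹ n :=
  FRT.lift (fun i j => FRT.x (stdR q⁻¹ n) i.rev j.rev) (by
    intro p r i j
    have h := FRT.rtt (stdR q⁻¹ n) p.rev r.rev i.rev j.rev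
    have e : ∀ G : Fin n → Fin n → QMat q⁻¹ n, ∑ a : Fin n, ∑ b : Fin n, G a.rev b.rev =
        ∑ a, ∑ b, G a b := by
      intro G
      refine (Equiv.sum_comp Fin.revPerm fun a => ∑ b : Fin n, G a b.rev).trans ?_
      exact Finset.sum_congr rfl fun a _ => Equiv.sum_comp Fin.revPerm fun b => G a b
    -- A scalar matrix satisfies the RTT relation trivially: it adds the same multiple of `x_{pi}
    -- x_{rj}` (with reversed indices) to both sides. What remains is the RTT relation of the
    -- `R`-matrix of `q⁻¹` with all indices reversed.
    simp only [stdR_eq_rev_add q, add_smul, Finset.sum_add_distrib]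
    congr 1
    · rw [e fun a b => stdR q⁻¹ n p.rev r.rev a b •
        (FRT.x (stdR q⁻¹ n) a i.rev * FRT.x (stdR q⁻¹ n) b j.rev), h]
      exact (e fun a b => stdR q⁻¹ n a b i.rev j.rev •
        (FRT.x (stdR q⁻¹ n) p.rev a * FRT.x (stdR q⁻¹ n) r.rev b)).symm
    · simp [ite_and])

@[simp] theorem revHom_x (i j : Fin n) :
    revHom q n (FRT.x (stdR q n) i j) = FRT.x (stdR q⁻¹ n) i.rev j.rev :=
  FRT.lift_x _ _ _ _

theorem comul_revHom (a : QMat q n) : Coalgebra.comul (R := k) (revHom q n a) =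
    TensorProduct.map (revHom q n).toLinearMap (revHom q n).toLinearMap
      (Coalgebra.comul (R := k) a) := by
  have : (Bialgebra.comulAlgHom k (QMat q⁻¹ n)).comp (revHom q n) =
      (Algebra.TensorProduct.map (revHom q n) (revHom q n)).comp
        (Bialgebra.comulAlgHom k (QMat q n)) := by
    refine FRT.algHom_ext fun i j => ?_
    simp only [AlgHom.comp_apply, revHom_x, Bialgebra.comulAlgHom_apply, FRT.comul_x, map_sum,
      Algebra.TensorProduct.map_tmul]
    exact (Equiv.sum_comp Fin.revPerm fun c => FRT.x (stdR q⁻¹ n) i.rev c ⊗ₜ[k]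
      FRT.x (stdR q⁻¹ n) c j.rev).symm
  exact DFunLike.congr_fun this a

theorem counit_revHom (a : QMat q n) :
    Coalgebra.counit (R := k) (revHom q n a) = Coalgebra.counit (R := k) a := by
  have : (Bialgebra.counitAlgHom k (QMat q⁻¹ n)).comp (revHom q n) =
      Bialgebra.counitAlgHom k (QMat q n) := by
    refine FRT.algHom_ext fun i j => ?_
    simp [FRT.counit_x]
  exact DFunLike.congr_fun this a

/-- The inverse of the universal form, with its arguments exchanged: on generators it is given by
the inverse of the `R`-matrix. -/
def invR : QMat q n ⊗[k] QMat q n →ₗ[k] k :=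
  univR q⁻¹ n ∘ₗ TensorProduct.map (revHom q n).toLinearMap (revHom q n).toLinearMap

theorem univR_tmul_one (a : QMat q n) : univR q n (a ⊗ₜ 1) = Coalgebra.counit (R := k) a :=
  FRT.univR_tmul_one _ a

theorem univR_one_tmul (a : QMat q n) : univR q n (1 ⊗ₜ a) = Coalgebra.counit (R := k) a :=
  FRT.univR_one_tmul _ a

theorem univR_isSkewPairing : IsSkewPairing (univR q n) := FRT.univR_isSkewPairing _

/-- Both forms are skew pairings normalised by the counit, so the identity has to be checked on
generators only, where it says `R⁻¹ R = 1`. -/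
theorem invR_univR (a b : QMat q n) :
    LinearMap.mul' k k (TensorProduct.map (invR q n)
      (univR q n ∘ₗ (TensorProduct.comm k (QMat q n) (QMat q n)).toLinearMap)
      (TensorProduct.tensorTensorTensorComm k _ _ _ _
        (Coalgebra.comul (R := k) a ⊗ₜ Coalgebra.comul (R := k) b))) =
      Coalgebra.counit (R := k) a * Coalgebra.counit (R := k) b := by
  refine FRT.skewPairing_convolution (univR_isSkewPairing q n)
    ((univR_isSkewPairing q⁻¹ n).comp (revHom q n) (comul_revHom q n))
    (univR_tmul_one q n) (univR_one_tmul q n) ?_ ?_ ?_ a b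
  · intro a
    simp only [LinearMap.comp_apply, TensorProduct.map_tmul, AlgHom.toLinearMap_apply, map_one]
    exact (univR_tmul_one _ _ _).trans (counit_revHom q n a)
  · intro a
    simp only [LinearMap.comp_apply, TensorProduct.map_tmul, AlgHom.toLinearMap_apply, map_one]
    exact (univR_one_tmul _ _ _).trans (counit_revHom q n a)
  · intro i j l m
    simp only [LinearMap.comp_apply, TensorProduct.map_tmul, AlgHom.toLinearMap_apply, revHom_x,
      univR, FRT.univR_x]
    -- The double sum is the matrix entry `(R⁻¹ R)^{il}_{jm}`. A column of `R` has at most two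
    -- nonzero entries, and `R⁻¹` is then replaced by `R - (q - q⁻¹)`, which leaves a finite
    -- comparison of cases.
    have h := stdR_sum q n j m fun d c => stdR q⁻¹ n i.rev l.rev d.rev c.rev
    simp only [mul_comm] at h ⊢
    rw [h]
    have h' := fun a b => stdR_eq_rev_add q n i l a b
    simp only [← sub_eq_iff_eq_add] at h'
    rw [← h', ← h']
    unfold stdR
    rcases lt_trichotomy j m with h | h | h
    · simp only [h, h.ne, h.ne', h.not_gt, if_true, if_false]
      split_ifs <;> simp
    · subst h
      simp only [lt_irrefl, if_true, if_false]
      split_ifs <;> simp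
    · simp only [h, h.ne', h.ne, h.not_gt, if_true, if_false]
      by_cases h1 : i = j <;> by_cases h2 : l = m <;> simp [h1, h2, h.ne, h.ne']

end QMat

end ConvolutionInverse

/-! ### Maps into `M' ⊗ A` given by elements of `B ⊗ A` -/

section Coact

variable {k : Type u} [Field k] {A A' B C M M' N N' : Type u} [AddCommGroup B] [Module k B]
  [AddCommGroup C] [Module k C] [AddCommGroup M] [Module k M] [AddCommGroup N] [Module k N]
  [AddCommGroup M'] [Module k M'] [AddCommGroup N'] [Module k N']

section Module
variable [AddCommGroup A] [Module k A] [AddCommGroup A'] [Module k A']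

variable (A) in
/-- The map `M → M' ⊗ A`, `x ↦ ∑ φ(f_i)(x) ⊗ a_i`, given by an element `∑ f_i ⊗ a_i`. -/
def coact (φ : B →ₗ[k] (M →ₗ[k] M')) : B ⊗[k] A →ₗ[k] (M →ₗ[k] M' ⊗[k] A) :=
  TensorProduct.rTensorHomToHomRTensor (.id k) _ _ _ ∘ₗ φ.rTensor A

@[simp] theorem coact_tmul (φ : B →ₗ[k] (M →ₗ[k] M')) (f : B) (a : A) (x : M) :
    coact A φ (f ⊗ₜ a) x = φ f x ⊗ₜ a := by
  simp [coact]

/-- Over a field `φ ⊗ A` stays injective, and `Hom(M, M') ⊗ A → Hom(M, M' ⊗ A)` is injective because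
`M` is finite dimensional. This is the transfer principle: an identity seen in a faithful
representation holds in `B ⊗ A`, hence in every representation of `B`. -/
theorem coact_injective [FiniteDimensional k M] {φ : B →ₗ[k] (M →ₗ[k] M')}
    (hφ : Function.Injective φ) : Function.Injective (coact A φ) := by
  have h1 : Function.Injective (TensorProduct.rTensorHomToHomRTensor (.id k) M M' A) := by
    rw [← rTensorHomEquivHomRTensor_toLinearMap]
    exact (rTensorHomEquivHomRTensor k M M' A).injective
  exact h1.comp (Module.Flat.rTensor_preserves_injective_linearMap φ hφ)

theorem coact_lTensor (φ : B →ₗ[k] (M →ₗ[k] M')) (h : A →ₗ[k] A') (s : B ⊗[k] A) (x : M) :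
    coact A' φ (h.lTensor B s) x = h.lTensor M' (coact A φ s x) := by
  induction s using TensorProduct.induction_on with
  | zero => simp
  | add s t hs ht => simp only [map_add, LinearMap.add_apply, hs, ht]
  | tmul f a => simp

theorem coact_rTensor (φ : C →ₗ[k] (M →ₗ[k] M')) (h : B →ₗ[k] C) (s : B ⊗[k] A) (x : M) :
    coact A φ (h.rTensor A s) x = coact A (φ ∘ₗ h) s x := by
  induction s using TensorProduct.induction_on with
  | zero => simp
  | add s t hs ht => simp only [map_add, LinearMap.add_apply, hs, ht]
  | tmul f a => simp

/-- Coacting by `t` and then by `s` is coacting by the product `s₁₂ t₁₃` in `B ⊗ A ⊗ A'`. The later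
coaction `s` occupies the inner leg, in accordance with coassociativity of right comodules. -/
theorem coact_comp (φ : B →ₗ[k] (M →ₗ[k] M)) (m : B →ₗ[k] B →ₗ[k] B)
    (hm : ∀ f g x, φ (m f g) x = φ f (φ g x)) (s : B ⊗[k] A) (t : B ⊗[k] A') (x : M) :
    coact (A ⊗[k] A') φ (TensorProduct.map₂ m (TensorProduct.mk k A A') s t) x =
      TensorProduct.assoc k M A A' ((coact A φ s).rTensor A' (coact A' φ t x)) := by
  induction t using TensorProduct.induction_on with
  | zero => simp
  | add s t hs ht => simp only [map_add, LinearMap.add_apply, hs, ht]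
  | tmul g b =>
  rw [coact_tmul, LinearMap.rTensor_tmul]
  induction s using TensorProduct.induction_on with
  | zero => simp
  | add s t hs ht => simp only [map_add, LinearMap.add_apply, TensorProduct.add_tmul, hs, ht]
  | tmul f a => simp [hm]

theorem rid_lTensor_coact (φ : B →ₗ[k] (M →ₗ[k] M')) (h : A →ₗ[k] k) (s : B ⊗[k] A) (x : M) :
    TensorProduct.rid k M' (h.lTensor M' (coact A φ s x)) =
      φ (TensorProduct.rid k B (h.lTensor B s)) x := by
  induction s using TensorProduct.induction_on with
  | zero => simp
  | add s t hs ht => simp only [map_add, LinearMap.add_apply, hs, ht]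
  | tmul f a => simp

/-- An intertwiner of two representations of `B` is colinear for the coactions given by one and the
same `s`. Applied to the components of a natural transformation. -/
theorem coact_intertwine (φ : B →ₗ[k] (M →ₗ[k] M)) (ψ : B →ₗ[k] (N →ₗ[k] N)) (α : M →ₗ[k] N)
    (h : ∀ f x, α (φ f x) = ψ f (α x)) (s : B ⊗[k] A) (x : M) :
    coact A ψ s (α x) = α.rTensor A (coact A φ s x) := by
  induction s using TensorProduct.induction_on with
  | zero => simp
  | add s t hs ht => simp only [map_add, LinearMap.add_apply, hs, ht]
  | tmul f a => simp [h]

end Module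

variable [Ring A] [Bialgebra k A]

theorem coact_tmulA (φ : B →ₗ[k] (M →ₗ[k] M')) (ψ : C →ₗ[k] (N →ₗ[k] N')) (s : B ⊗[k] A)
    (t : C ⊗[k] A) (x : M) (y : N) :
    coact A (TensorProduct.homTensorHomMap (.id k) _ _ _ _ ∘ₗ TensorProduct.map φ ψ)
      (tmulA B C A (s ⊗ₜ t)) (x ⊗ₜ y) = tmulA M' N' A (coact A φ s x ⊗ₜ coact A ψ t y) := by
  induction s using TensorProduct.induction_on with
  | zero => simp
  | add s t hs ht => simp only [map_add, LinearMap.add_apply, TensorProduct.add_tmul, hs, ht]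
  | tmul f a =>
  induction t using TensorProduct.induction_on with
  | zero => simp
  | add s t hs ht => simp only [map_add, LinearMap.add_apply, TensorProduct.tmul_add, hs, ht]
  | tmul g b => simp

/-- The contraction with `𝓡` can be performed on the coefficient elements before any representation
is chosen. With universal elements for `s` and `t`, one element of `C ⊗ B` describes the braiding on
tensor powers and on polynomial functors alike. -/
theorem formContract_coact (𝓡 : A ⊗[k] A →ₗ[k] k) (φ : B →ₗ[k] (M →ₗ[k] M'))
    (ψ : C →ₗ[k] (N →ₗ[k] N')) (s : B ⊗[k] A) (t : C ⊗[k] A) (x : M) (y : N) :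
    formContract 𝓡 N' M' (coact A ψ t y ⊗ₜ coact A φ s x) =
      TensorProduct.homTensorHomMap (.id k) _ _ _ _
        (TensorProduct.map ψ φ (formContract 𝓡 C B (t ⊗ₜ s))) (y ⊗ₜ x) := by
  induction s using TensorProduct.induction_on with
  | zero => simp
  | add s t hs ht => simp only [map_add, LinearMap.add_apply, TensorProduct.tmul_add, hs, ht]
  | tmul f a =>
  induction t using TensorProduct.induction_on with
  | zero => simp
  | add s t hs ht => simp only [map_add, LinearMap.add_apply, TensorProduct.add_tmul, hs, ht]
  | tmul g b => simp

end Coact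

/-! ### Universal elements and the comodules `F(V)` -/

namespace EHeckePair
variable {k : Type u} [Field k] {q : kˣ} {e : ℕ}

theorem coact_univ (d : ℕ) (V : EHeckePair k q e) :
    coact (QMat q V.n) BHom.val (univ d V) = tpowCoaction V.coaction d := univ_spec d V

theorem coact_inclHom {A : Type u} [AddCommGroup A] [Module k A] {a b d : ℕ} (h : a + b = d)
    (V W : EHeckePair k q e) (s : ((BHom a V W) ⊗[k] (BHom b V W)) ⊗[k] A)
    (z : (⨂[k]^a V.carrier) ⊗[k] (⨂[k]^b V.carrier)) :
    coact A (inclHom h V W) s (mulE V.carrier a b d h z) =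
      (mulE W.carrier a b d h).toLinearMap.rTensor A
        (coact A (TensorProduct.homTensorHomMap (.id k) _ _ _ _ ∘ₗ
          TensorProduct.map BHom.val BHom.val) s z) := by
  induction s using TensorProduct.induction_on with
  | zero => simp
  | add s t hs ht => simp only [map_add, LinearMap.add_apply, hs, ht]
  | tmul f c => simp [inclHom, LinearEquiv.arrowCongr_apply]

/-- The restriction of the universal element of degree `d` along `B_a × B_b ⊂ B_d` is the product
of the universal elements of degrees `a` and `b`. -/
theorem res_univ {a b d : ℕ} (h : a + b = d) (V : EHeckePair k q e) :
    (res h V V).rTensor (QMat q V.n) (univ d V) =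
      tmulA (BHom a V V) (BHom b V V) (QMat q V.n) (univ a V ⊗ₜ univ b V) := by
  -- Tested on `V^{⊗ a} ⊗ V^{⊗ b}`, the claim is that concatenation is colinear, which is
  -- `tpowCoaction_mulE`.
  apply coact_injective (inclHom_injective (a := a) (b := b) h V V)
  refine mulE_ext h fun x y => ?_
  have e : inclHom (a := a) (b := b) h V V ∘ₗ res h V V = BHom.val :=
    LinearMap.ext fun f => inclHom_res h V V f
  rw [coact_rTensor, e, coact_univ, coact_inclHom, coact_tmulA, coact_univ, coact_univ,
    tpowCoaction_mulE]

/-- The rule `(1 ⊗ Δ) U = U₁₂ U₁₃`, which in the faithful representation on `V^{⊗ d}` is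
coassociativity of the coaction there. -/
theorem univ_comul (d : ℕ) (V : EHeckePair k q e) :
    (Coalgebra.comul (R := k) (A := QMat q V.n)).lTensor (BHom d V V) (univ d V) =
      TensorProduct.map₂ (compHom d V V V) (TensorProduct.mk k _ _) (univ d V) (univ d V) := by
  apply coact_injective (BHom.val_injective (d := d) (V := V) (W := V))
  refine LinearMap.ext fun x => ?_
  rw [coact_lTensor, coact_comp _ _ (fun f g x => by rw [compHom_val]; rfl), coact_univ,
    (V.isCoaction.tpow d).coassoc_apply]

theorem univ_counit (d : ℕ) (V : EHeckePair k q e) :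
    TensorProduct.rid k _ ((Coalgebra.counit (R := k) (A := QMat q V.n)).lTensor (BHom d V V)
      (univ d V)) = BHom.id d V := by
  apply BHom.val_injective
  refine LinearMap.ext fun x => ?_
  rw [← rid_lTensor_coact, coact_univ, (V.isCoaction.tpow d).counit_apply]
  rfl

end EHeckePair

namespace PolyFun
open EHeckePair
variable {k : Type u} [Field k] {q : kˣ} {e d : ℕ}

theorem coaction_eq_coact (F : PolyFun k q e d) (V : EHeckePair k q e) :
    F.coaction V = coact (QMat q V.n) (F.act V V) (univ d V) := rfl

/-- The comodule axioms are images under `F` of `univ_comul` and `univ_counit`, since `F` respects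
composition and identities. -/
theorem coaction_isCoaction (F : PolyFun k q e d) (V : EHeckePair k q e) :
    IsCoaction (F.coaction V) where
  coassoc := by
    refine LinearMap.ext fun x => ?_
    simp only [LinearMap.comp_apply, LinearEquiv.coe_coe, coaction_eq_coact]
    rw [← coact_lTensor, univ_comul, coact_comp _ _ fun f g x => F.act_comp f g x]
  counit := by
    refine LinearMap.ext fun x => ?_
    simp only [LinearMap.comp_apply, LinearEquiv.coe_coe, coaction_eq_coact]
    rw [rid_lTensor_coact, univ_counit, act_id, LinearMap.id_apply]

theorem coaction_app {F G : PolyFun k q e d} (α : F ⟶ G) (V : EHeckePair k q e) (x : F.sp V) :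
    G.coaction V (app α V x) = (app α V).rTensor _ (F.coaction V x) :=
  coact_intertwine (F.act V V) (G.act V V) (app α V) (fun f x => app_act α f x) _ x

end PolyFun

namespace QPoly
open EHeckePair PolyFun
variable {k : Type u} [Field k] {q : kˣ} {e : ℕ} {F G : QPoly k q e}

/-- On this summand `End_{B_d}` acts through restriction to `B_a × B_b`, and by `res_univ` the
restricted universal element is the product of those of degrees `a` and `b`. This identifies the
comodule structure of `(F ⊗ G)(V)`, which both hexagons need. -/
theorem coaction_incl {a b d : ℕ} (h : a + b = d) (V : EHeckePair k q e)
    (z : (F.deg a).sp V ⊗[k] (G.deg b).sp V) :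
    ((tensor F G).deg d).coaction V (incl F G h V z) =
      (incl F G h V).rTensor _
        (tensorCoaction ((F.deg a).coaction V) ((G.deg b).coaction V) z) := by
  have key : ∀ s : BHom d V V ⊗[k] QMat q V.n,
      coact (QMat q V.n) (((tensor F G).deg d).act V V) s (incl F G h V z) =
      (incl F G h V).rTensor _ (coact (QMat q V.n) (eact (F.deg a) (G.deg b) V V)
        ((res h V V).rTensor _ s) z) := by
    intro s
    induction s using TensorProduct.induction_on with
    | zero => simp
    | add s t hs ht => simp only [map_add, LinearMap.add_apply, hs, ht]
    | tmul f c => simp [tensor_act]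
  rw [coaction_eq_coact, key, res_univ]
  clear key
  congr 1
  induction z using TensorProduct.induction_on with
  | zero => simp
  | add s t hs ht => simp only [map_add, hs, ht]
  | tmul x y =>
    rw [tensorCoaction_tmul]
    exact coact_tmulA _ _ _ _ _ _

end QPoly

/-! ### The braiding of tensor powers as a composite of braid generators -/

section TensorPowerBraiding

variable {k : Type u} [Field k] {V : Type u} [AddCommGroup V] [Module k V]

theorem mulE_zero_left {d : ℕ} (h : 0 + d = d) (y : ⨂[k]^d V) :
    mulE V 0 d d h (PiTensorProduct.tprod k Fin.elim0 ⊗ₜ y) = y := by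
  induction y using PiTensorProduct.induction_on with
  | add x x' hx hx' => simp only [map_add, TensorProduct.tmul_add, hx, hx']
  | smul_tprod r y =>
    simp only [TensorProduct.tmul_smul, map_smul, mulE_tprod]
    congr 2

theorem mulE_zero_right {d : ℕ} (h : d + 0 = d) (y : ⨂[k]^d V) :
    mulE V d 0 d h (y ⊗ₜ PiTensorProduct.tprod k Fin.elim0) = y := by
  induction y using PiTensorProduct.induction_on with
  | add x x' hx hx' => simp only [map_add, TensorProduct.add_tmul, hx, hx']
  | smul_tprod r y =>
    simp only [← TensorProduct.smul_tmul', map_smul, mulE_tprod]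
    congr 2
    funext i
    simp

theorem tpow_zero_induction {P : (⨂[k]^0 V) → Prop}
    (h : ∀ c : k, P (c • PiTensorProduct.tprod k Fin.elim0)) (x : ⨂[k]^0 V) : P x := by
  have : x = PiTensorProduct.isEmptyEquiv (R := k) (s := fun _ => V) (Fin 0) x •
      PiTensorProduct.tprod k Fin.elim0 := by
    apply (PiTensorProduct.isEmptyEquiv (R := k) (s := fun _ => V) (Fin 0)).injective
    simp
  rw [this]
  exact h _

/-- The operator `1_{V^{⊗ a}} ⊗ T` on `V^{⊗ d}`. -/
def blockL (a m d : ℕ) (h : a + m = d) (T : (⨂[k]^m V) →ₗ[k] (⨂[k]^m V)) :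
    (⨂[k]^d V) →ₗ[k] (⨂[k]^d V) :=
  (mulE V a m d h).toLinearMap ∘ₗ T.lTensor _ ∘ₗ (mulE V a m d h).symm.toLinearMap

/-- The operator `T ⊗ 1_{V^{⊗ b}}` on `V^{⊗ d}`. -/
def blockR (m b d : ℕ) (h : m + b = d) (T : (⨂[k]^m V) →ₗ[k] (⨂[k]^m V)) :
    (⨂[k]^d V) →ₗ[k] (⨂[k]^d V) :=
  (mulE V m b d h).toLinearMap ∘ₗ T.rTensor _ ∘ₗ (mulE V m b d h).symm.toLinearMap

theorem blockL_mulE (a m d : ℕ) (h : a + m = d) (T : (⨂[k]^m V) →ₗ[k] (⨂[k]^m V))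
    (x : ⨂[k]^a V) (y : ⨂[k]^m V) :
    blockL a m d h T (mulE V a m d h (x ⊗ₜ y)) = mulE V a m d h (x ⊗ₜ T y) := by
  simp [blockL]

theorem blockR_mulE (m b d : ℕ) (h : m + b = d) (T : (⨂[k]^m V) →ₗ[k] (⨂[k]^m V))
    (x : ⨂[k]^m V) (y : ⨂[k]^b V) :
    blockR m b d h T (mulE V m b d h (x ⊗ₜ y)) = mulE V m b d h (T x ⊗ₜ y) := by
  simp [blockR]

theorem mulE_ext₃ {M : Type*} [AddCommGroup M] [Module k M] {a b c ab d : ℕ} (h1 : a + b = ab)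
    (h2 : ab + c = d) {f g : (⨂[k]^d V) →ₗ[k] M}
    (hfg : ∀ x y z, f (mulE V ab c d h2 (mulE V a b ab h1 (x ⊗ₜ y) ⊗ₜ z)) =
      g (mulE V ab c d h2 (mulE V a b ab h1 (x ⊗ₜ y) ⊗ₜ z))) : f = g := by
  refine EHeckePair.mulE_ext h2 fun w z => ?_
  obtain ⟨w, rfl⟩ := (mulE V a b ab h1).surjective w
  induction w using TensorProduct.induction_on with
  | zero => simp
  | add w w' h h' => simp only [map_add, TensorProduct.add_tmul, h, h']
  | tmul x y => exact hfg x y z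

variable {A : Type u} [Ring A] [Bialgebra k A] (𝓡 : A ⊗[k] A →ₗ[k] k) (ρ : V →ₗ[k] V ⊗[k] A)

/-- The braiding `R_{V^{⊗ a}, V^{⊗ b}}` as an operator on `V^{⊗ d}`, where `d = a + b`. -/
def powBraiding (a b d : ℕ) (h : a + b = d) (h' : b + a = d) : (⨂[k]^d V) →ₗ[k] (⨂[k]^d V) :=
  (mulE V b a d h').toLinearMap ∘ₗ
    comoduleBraiding 𝓡 (tpowCoaction ρ a) (tpowCoaction ρ b) ∘ₗ
    (mulE V a b d h).symm.toLinearMap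

theorem powBraiding_mulE (a b d : ℕ) (h : a + b = d) (h' : b + a = d)
    (z : (⨂[k]^a V) ⊗[k] (⨂[k]^b V)) :
    powBraiding 𝓡 ρ a b d h h' (mulE V a b d h z) =
      mulE V b a d h' (comoduleBraiding 𝓡 (tpowCoaction ρ a) (tpowCoaction ρ b) z) := by
  simp [powBraiding]

variable {𝓡 ρ}

theorem tpowCoaction_mulE_eq (a b d : ℕ) (h : a + b = d)
    (z : (⨂[k]^a V) ⊗[k] (⨂[k]^b V)) :
    tpowCoaction ρ d ((mulE V a b d h).toLinearMap z) =
      (mulE V a b d h).toLinearMap.rTensor A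
        (tensorCoaction (tpowCoaction ρ a) (tpowCoaction ρ b) z) := by
  induction z using TensorProduct.induction_on with
  | zero => simp
  | add w w' h h' => simp only [map_add, h, h']
  | tmul x y => rw [tensorCoaction_tmul]; exact tpowCoaction_mulE ρ a b d h x y

/-- The hexagon `comoduleBraiding_tensor_left`, transported to operators on the single space `V^{⊗
d}`. In this form each factor is a braiding of smaller tensor powers acting on consecutive
positions, ready for induction. -/
theorem powBraiding_add_left (h𝓡 : IsSkewPairing 𝓡) (hρ : IsCoaction ρ)
    {a a' b aa ab ab' d : ℕ} (haa : a + a' = aa) (h : aa + b = d) (h' : b + aa = d)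
    (hab : a + b = ab) (hba : b + a = ab) (hab' : a' + b = ab') (hba' : b + a' = ab')
    (hl : a + ab' = d) (hr : ab + a' = d) :
    powBraiding 𝓡 ρ aa b d h h' = blockR ab a' d hr (powBraiding 𝓡 ρ a b ab hab hba) ∘ₗ
      blockL a ab' d hl (powBraiding 𝓡 ρ a' b ab' hab' hba') := by
  refine mulE_ext₃ haa h fun x x' y => ?_
  -- Concatenation is colinear, so the braiding of `V^{⊗ aa}` can be computed on `V^{⊗ a} ⊗ V^{⊗
  -- a'}`, where the hexagon applies.
  have e1 := comoduleBraiding_naturality 𝓡 (tpowCoaction_mulE_eq (ρ := ρ) a a' aa haa)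
    (ψ := LinearMap.id) (σ := tpowCoaction ρ b) (σ' := tpowCoaction ρ b) (by intro y; simp)
    ((x ⊗ₜ x') ⊗ₜ y)
  rw [TensorProduct.map_tmul, LinearMap.id_apply, LinearEquiv.coe_coe] at e1
  rw [powBraiding_mulE, e1, comoduleBraiding_tensor_left h𝓡 _ _ (hρ.tpow b), LinearMap.comp_apply,
    mulE_assoc a a' b aa ab' d haa h hab' hl, blockL_mulE, powBraiding_mulE]
  induction comoduleBraiding 𝓡 (tpowCoaction ρ a') (tpowCoaction ρ b) (x' ⊗ₜ[k] y) using
    TensorProduct.induction_on with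
  | zero => simp
  | add w w' h h' => simp only [map_add, TensorProduct.tmul_add, h, h']
  | tmul y x' =>
  rw [← mulE_assoc a b a' ab ab' d hab hr hba' hl, blockR_mulE, powBraiding_mulE,
    TensorProduct.assoc_symm_tmul, LinearMap.rTensor_tmul]
  induction comoduleBraiding 𝓡 (tpowCoaction ρ a) (tpowCoaction ρ b) (x ⊗ₜ[k] y) using
    TensorProduct.induction_on with
  | zero => simp
  | add w w' h h' => simp only [map_add, TensorProduct.add_tmul, h, h']
  | tmul y x =>
  rw [mulE_assoc b a a' ab aa d hba hr haa h', TensorProduct.assoc_tmul, TensorProduct.map_tmul,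
    LinearMap.id_apply, LinearEquiv.coe_coe]

theorem powBraiding_add_right (h𝓡 : IsSkewPairing 𝓡) (hρ : IsCoaction ρ)
    {a b b' bb ab ab' d : ℕ} (hbb : b + b' = bb) (h : a + bb = d) (h' : bb + a = d)
    (hab : a + b = ab) (hba : b + a = ab) (hab' : a + b' = ab') (hba' : b' + a = ab')
    (hl : b + ab' = d) (hr : ab + b' = d) :
    powBraiding 𝓡 ρ a bb d h h' = blockL b ab' d hl (powBraiding 𝓡 ρ a b' ab' hab' hba') ∘ₗ
      blockR ab b' d hr (powBraiding 𝓡 ρ a b ab hab hba) := by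
  refine mulE_ext₃ hab hr fun x y y' => ?_
  have e1 := comoduleBraiding_naturality 𝓡 (φ := LinearMap.id) (ρ := tpowCoaction ρ a)
    (ρ' := tpowCoaction ρ a) (by intro y; simp) (tpowCoaction_mulE_eq (ρ := ρ) b b' bb hbb)
    (x ⊗ₜ (y ⊗ₜ y'))
  rw [TensorProduct.map_tmul, LinearMap.id_apply, LinearEquiv.coe_coe] at e1
  rw [LinearMap.comp_apply, blockR_mulE, powBraiding_mulE,
    mulE_assoc a b b' ab bb d hab hr hbb h, powBraiding_mulE, e1,
    comoduleBraiding_tensor_right h𝓡 (hρ.tpow a)]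
  induction comoduleBraiding 𝓡 (tpowCoaction ρ a) (tpowCoaction ρ b) (x ⊗ₜ[k] y) using
    TensorProduct.induction_on with
  | zero => simp
  | add w w' h h' => simp only [map_add, TensorProduct.add_tmul, h, h']
  | tmul y x =>
  rw [mulE_assoc b a b' ab ab' d hba hr hab' hl, blockL_mulE, powBraiding_mulE,
    TensorProduct.assoc_tmul, LinearMap.lTensor_tmul]
  induction comoduleBraiding 𝓡 (tpowCoaction ρ a) (tpowCoaction ρ b') (x ⊗ₜ[k] y') using
    TensorProduct.induction_on with
  | zero => simp
  | add w w' h h' => simp only [map_add, TensorProduct.tmul_add, h, h']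
  | tmul y' x =>
  rw [← mulE_assoc b b' a bb ab' d hbb h' hba' hl, TensorProduct.assoc_symm_tmul,
    TensorProduct.map_tmul, LinearMap.id_apply, LinearEquiv.coe_coe]

/-- The coaction on `V^{⊗ 0}` is `x ↦ x ⊗ 1`, so `𝓡` contracts as the counit and the braiding
becomes the flip. Concatenation with a scalar multiple of the empty tensor is the same on either
side. -/
theorem powBraiding_zero_left (h𝓡 : ∀ a, 𝓡 (a ⊗ₜ 1) = Coalgebra.counit (R := k) a)
    (hρ : IsCoaction ρ) (d : ℕ) (h : 0 + d = d) (h' : d + 0 = d) :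
    powBraiding 𝓡 ρ 0 d d h h' = LinearMap.id := by
  refine EHeckePair.mulE_ext h fun x y => ?_
  rw [powBraiding_mulE, LinearMap.id_apply, comoduleBraiding_tmul]
  have : ∀ w : (⨂[k]^d V) ⊗[k] A, formContract 𝓡 _ _ (w ⊗ₜ tpowCoaction ρ 0 x) =
      TensorProduct.rid k _ ((Coalgebra.counit (R := k) (A := A)).lTensor _ w) ⊗ₜ x := by
    intro w
    induction w using TensorProduct.induction_on with
    | zero => simp
    | add w w' h h' => simp only [map_add, TensorProduct.add_tmul, h, h']
    | tmul y a => simp [tpowCoaction, h𝓡, TensorProduct.smul_tmul']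
  rw [this, (hρ.tpow d).counit_apply]
  induction x using tpow_zero_induction with
  | h c =>
  rw [TensorProduct.tmul_smul, map_smul, mulE_zero_right, ← TensorProduct.smul_tmul', map_smul,
    mulE_zero_left]

theorem powBraiding_zero_right (h𝓡 : ∀ a, 𝓡 (1 ⊗ₜ a) = Coalgebra.counit (R := k) a)
    (hρ : IsCoaction ρ) (d : ℕ) (h : d + 0 = d) (h' : 0 + d = d) :
    powBraiding 𝓡 ρ d 0 d h h' = LinearMap.id := by
  refine EHeckePair.mulE_ext h fun x y => ?_
  rw [powBraiding_mulE, LinearMap.id_apply, comoduleBraiding_tmul]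
  have : ∀ w : (⨂[k]^d V) ⊗[k] A, formContract 𝓡 _ _ (tpowCoaction ρ 0 y ⊗ₜ w) =
      y ⊗ₜ TensorProduct.rid k _ ((Coalgebra.counit (R := k) (A := A)).lTensor _ w) := by
    intro w
    induction w using TensorProduct.induction_on with
    | zero => simp
    | add w w' h h' => simp only [map_add, TensorProduct.tmul_add, h, h']
    | tmul x a => simp [tpowCoaction, h𝓡]
  rw [this, (hρ.tpow d).counit_apply]
  induction y using tpow_zero_induction with
  | h c =>
  rw [TensorProduct.tmul_smul, map_smul, mulE_zero_right, ← TensorProduct.smul_tmul', map_smul,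
    mulE_zero_left]

/-- The link with the braid group: since `V ≃ V^{⊗ 1}` is colinear, the braiding of two copies of
`V^{⊗ 1}` is `R_V`, the action of the generator of `B_2` with nothing to its left or right. -/
theorem powBraiding_one_one (h : 1 + 1 = 2) (h' : 0 + (2 + 0) = 2) :
    powBraiding 𝓡 ρ 1 1 2 h h = braidGen (comoduleBraiding 𝓡 ρ ρ) 0 0 2 h' := by
  have e1 : ∀ w : V ⊗[k] V, splitE V 0 0 2 h' (PiTensorProduct.tprod k Fin.elim0 ⊗ₜ
      (w ⊗ₜ PiTensorProduct.tprod k Fin.elim0)) = pairE V w := by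
    intro w
    rw [splitE_tmul, mulE_zero_right, mulE_zero_left]
  have e2 : ∀ w : V ⊗[k] V, powBraiding 𝓡 ρ 1 1 2 h h (pairE V w) =
      pairE V (comoduleBraiding 𝓡 ρ ρ w) := by
    intro w
    have := comoduleBraiding_naturality 𝓡 (φ := (consE V).toLinearMap) (ψ := (consE V).toLinearMap)
      (tpowCoaction_consE ρ) (tpowCoaction_consE ρ) w
    exact (powBraiding_mulE 𝓡 ρ 1 1 2 h h _).trans (congrArg _ this)
  refine LinearMap.ext fun z => ?_
  obtain ⟨w, rfl⟩ := (pairE V).surjective z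
  rw [e2, ← e1 w, braidGen_splitE, e1]

end TensorPowerBraiding

/-! ### Morphisms of the divided power category commute with the braidings -/

namespace EHeckePair
variable {k : Type u} [Field k] {q : kˣ} {e : ℕ}

/-- Restriction to `B_a × B_m` writes `f` as a sum of tensor products of braid-equivariant maps, and
the operators act on the second factor only. So commutation with all morphisms of degree `m` passes
to morphisms of degree `d`. -/
theorem val_blockL {V W : EHeckePair k q e} {a m d : ℕ} (h : a + m = d)
    {S : (⨂[k]^m V.carrier) →ₗ[k] (⨂[k]^m V.carrier)}
    {T : (⨂[k]^m W.carrier) →ₗ[k] (⨂[k]^m W.carrier)}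
    (hST : ∀ g : BHom m V W, g.val ∘ₗ S = T ∘ₗ g.val) (f : BHom d V W) :
    f.val ∘ₗ blockL a m d h S = blockL a m d h T ∘ₗ f.val := by
  rw [← inclHom_res h V W f]
  induction res h V W f using TensorProduct.induction_on with
  | zero => simp
  | add s t hs ht => simp only [map_add, LinearMap.add_comp, LinearMap.comp_add, hs, ht]
  | tmul f g =>
    refine mulE_ext h fun x y => ?_
    simp only [LinearMap.comp_apply, blockL_mulE, inclHom_tmul]
    rw [← LinearMap.comp_apply, hST, LinearMap.comp_apply]

theorem val_blockR {V W : EHeckePair k q e} {m b d : ℕ} (h : m + b = d)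
    {S : (⨂[k]^m V.carrier) →ₗ[k] (⨂[k]^m V.carrier)}
    {T : (⨂[k]^m W.carrier) →ₗ[k] (⨂[k]^m W.carrier)}
    (hST : ∀ g : BHom m V W, g.val ∘ₗ S = T ∘ₗ g.val) (f : BHom d V W) :
    f.val ∘ₗ blockR m b d h S = blockR m b d h T ∘ₗ f.val := by
  rw [← inclHom_res h V W f]
  induction res h V W f using TensorProduct.induction_on with
  | zero => simp
  | add s t hs ht => simp only [map_add, LinearMap.add_comp, LinearMap.comp_add, hs, ht]
  | tmul f g =>
    refine mulE_ext h fun x y => ?_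
    simp only [LinearMap.comp_apply, blockR_mulE, inclHom_tmul]
    rw [← LinearMap.comp_apply, hST, LinearMap.comp_apply]

/-- The braiding `R_{V^{⊗ a}, V^{⊗ b}}`, on `V^{⊗ d}`. -/
abbrev powR (V : EHeckePair k q e) (a b d : ℕ) (h : a + b = d) (h' : b + a = d) :
    (⨂[k]^d V.carrier) →ₗ[k] (⨂[k]^d V.carrier) :=
  powBraiding (QMat.univR q V.n) V.coaction a b d h h'

/-- One strand is moved past `b` strands, one crossing at a time: splitting off the last of the `b +
1` strands leaves the induction hypothesis on the first `b + 1` positions and one crossing on the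
last two. -/
theorem val_powR_one {V W : EHeckePair k q e} (b d : ℕ) (h : 1 + b = d) (h' : b + 1 = d)
    (f : BHom d V W) : f.val ∘ₗ V.powR 1 b d h h' = W.powR 1 b d h h' ∘ₗ f.val := by
  induction b generalizing d with
  | zero =>
    obtain rfl : d = 1 := by omega
    rw [powR, powR, powBraiding_zero_right (QMat.univR_one_tmul q V.n) V.isCoaction,
      powBraiding_zero_right (QMat.univR_one_tmul q W.n) W.isCoaction]
    rfl
  | succ b ih =>
    rw [powR, powR, powBraiding_add_right (QMat.univR_isSkewPairing q V.n) V.isCoaction rfl h h'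
      (ab := b + 1) (by omega) rfl (ab' := 2) rfl rfl (by omega) (by omega),
      powBraiding_add_right (QMat.univR_isSkewPairing q W.n) W.isCoaction rfl h h'
      (ab := b + 1) (by omega) rfl (ab' := 2) rfl rfl (by omega) (by omega),
      ← LinearMap.comp_assoc, val_blockL _ _ f, LinearMap.comp_assoc, LinearMap.comp_assoc,
      val_blockR _ (ih (b + 1) _ _) f]
    intro g
    -- The single crossing is the generator of `B_2`, with which a morphism of degree 2 commutes by
    -- definition.
    rw [powBraiding_one_one rfl rfl, powBraiding_one_one rfl rfl]
    exact g.val_mem 0 0 rfl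

/-- The `a` strands are moved past the `b` strands one strand at a time. This is the only input
about `f` that naturality in `V` needs; no relation between the quantum matrix algebras of `V` and
`W` enters. -/
theorem val_powR {V W : EHeckePair k q e} (a b d : ℕ) (h : a + b = d) (h' : b + a = d)
    (f : BHom d V W) : f.val ∘ₗ V.powR a b d h h' = W.powR a b d h h' ∘ₗ f.val := by
  induction a generalizing d with
  | zero =>
    obtain rfl : b = d := by omega
    rw [powR, powR, powBraiding_zero_left (QMat.univR_tmul_one q V.n) V.isCoaction,
      powBraiding_zero_left (QMat.univR_tmul_one q W.n) W.isCoaction]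
    rfl
  | succ a ih =>
    rw [powR, powR, powBraiding_add_left (QMat.univR_isSkewPairing q V.n) V.isCoaction rfl h h'
      (ab := a + b) rfl (by omega) (ab' := 1 + b) rfl (by omega) (by omega) (by omega),
      powBraiding_add_left (QMat.univR_isSkewPairing q W.n) W.isCoaction rfl h h'
      (ab := a + b) rfl (by omega) (ab' := 1 + b) rfl (by omega) (by omega) (by omega),
      ← LinearMap.comp_assoc, val_blockR _ (ih (a + b) _ _) f, LinearMap.comp_assoc,
      LinearMap.comp_assoc, val_blockL _ (val_powR_one b (1 + b) _ _) f]

/-- The element of `End_{B_b}(V^{⊗ b}) ⊗ End_{B_a}(V^{⊗ a})` that acts as `R_{V^{⊗ a}, V^{⊗ b}} τ`. -/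
def twist (V : EHeckePair k q e) (a b : ℕ) : BHom b V V ⊗[k] BHom a V V :=
  formContract (QMat.univR q V.n) (BHom b V V) (BHom a V V) (univ b V ⊗ₜ univ a V)

theorem inclHom_twist (V : EHeckePair k q e) {a b d : ℕ} (h : a + b = d) (h' : b + a = d)
    (z : (⨂[k]^a V.carrier) ⊗[k] (⨂[k]^b V.carrier)) :
    inclHom h' V V (V.twist a b) (mulE V.carrier b a d h' (TensorProduct.comm k _ _ z)) =
      V.powR a b d h h' (mulE V.carrier a b d h z) := by
  rw [powBraiding_mulE]
  induction z using TensorProduct.induction_on with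
  | zero => simp
  | add s t hs ht => simp only [map_add, hs, ht]
  | tmul x y =>
    rw [TensorProduct.comm_tmul, comoduleBraiding_tmul, ← coact_univ, ← coact_univ,
      formContract_coact]
    simp [inclHom, LinearEquiv.arrowCongr_apply, twist]

/-- Exchanging the two tensor factors of `s` conjugates its action by the flip of the two blocks of
positions. -/
theorem inclHom_comm {V W : EHeckePair k q e} {a b d : ℕ} (h : a + b = d) (h' : b + a = d)
    (s : BHom a V W ⊗[k] BHom b V W) (x : ⨂[k]^a V.carrier) (y : ⨂[k]^b V.carrier) :
    inclHom h' V W (TensorProduct.comm k _ _ s) (mulE V.carrier b a d h' (y ⊗ₜ x)) =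
      mulE W.carrier b a d h' (TensorProduct.comm k _ _ ((mulE W.carrier a b d h).symm
        (inclHom h V W s (mulE V.carrier a b d h (x ⊗ₜ y))))) := by
  induction s using TensorProduct.induction_on with
  | zero => simp
  | add s t hs ht => simp only [map_add, LinearMap.add_apply, hs, ht]
  | tmul f g => simp [inclHom_tmul]

theorem inclHom_map₂ {V W U : EHeckePair k q e} {a b d : ℕ} (h : a + b = d)
    (s : BHom a W U ⊗[k] BHom b W U) (t : BHom a V W ⊗[k] BHom b V W) :
    inclHom h V U (TensorProduct.map₂ (compHom a V W U) (compHom b V W U) s t) =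
      inclHom h W U s ∘ₗ inclHom h V W t := by
  induction s using TensorProduct.induction_on with
  | zero => simp
  | add x y hx hy => simp only [map_add, LinearMap.add_apply, hx, hy, LinearMap.add_comp]
  | tmul s s' =>
  induction t using TensorProduct.induction_on with
  | zero => simp
  | add x y hx hy => simp only [map_add, hx, hy, LinearMap.comp_add]
  | tmul t t' =>
  refine mulE_ext h fun x y => ?_
  rw [TensorProduct.map₂_apply_tmul, TensorProduct.map_tmul, inclHom_tmul, LinearMap.comp_apply,
    inclHom_tmul, inclHom_tmul]
  rfl

/-- This is `val_powR` freed from the tensor powers: `inclHom` is injective, so the commutation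
becomes an identity in `Hom_{B_b} ⊗ Hom_{B_a}`, to which any pair of polynomial functors of degrees
`b` and `a` can be applied. -/
theorem twist_res {V W : EHeckePair k q e} {a b d : ℕ} (h : a + b = d) (h' : b + a = d)
    (f : BHom d V W) :
    TensorProduct.map₂ (compHom b V W W) (compHom a V W W) (W.twist a b)
        (TensorProduct.comm k _ _ (res h V W f)) =
      TensorProduct.map₂ (compHom b V V W) (compHom a V V W) (res h' V W f) (V.twist a b) := by
  apply inclHom_injective (a := b) (b := a) h' V W
  rw [inclHom_map₂, inclHom_map₂, inclHom_res]
  refine mulE_ext h' fun y x => ?_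
  rw [LinearMap.comp_apply, LinearMap.comp_apply, inclHom_comm h h', inclHom_twist W h h',
    LinearEquiv.apply_symm_apply, inclHom_res, ← TensorProduct.comm_tmul k _ _ x y,
    inclHom_twist V h h']
  exact (DFunLike.congr_fun (val_powR a b d h h' f) _).symm

end EHeckePair

/-! ### The braiding of quantum polynomial functors -/

namespace QPoly
open EHeckePair PolyFun
variable {k : Type u} [Field k] {q : kˣ} {e : ℕ} {F G H F' G' : QPoly k q e}

/-- The braiding `R_{F_a(V), G_b(V)}`. -/
abbrev partBraiding (F G : QPoly k q e) (V : EHeckePair k q e) (a b : ℕ) :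
    (F.deg a).sp V ⊗[k] (G.deg b).sp V →ₗ[k] (G.deg b).sp V ⊗[k] (F.deg a).sp V :=
  comoduleBraiding (QMat.univR q V.n) ((F.deg a).coaction V) ((G.deg b).coaction V)

/-- The inverse of the braiding `R_{F_a(V), G_b(V)}`. -/
abbrev partBraidingInv (F G : QPoly k q e) (V : EHeckePair k q e) (a b : ℕ) :
    (G.deg b).sp V ⊗[k] (F.deg a).sp V →ₗ[k] (F.deg a).sp V ⊗[k] (G.deg b).sp V :=
  comoduleBraiding (QMat.invR q V.n) ((G.deg b).coaction V) ((F.deg a).coaction V)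

theorem partBraidingInv_comp (V : EHeckePair k q e) (a b : ℕ) :
    partBraidingInv F G V a b ∘ₗ partBraiding F G V a b = LinearMap.id :=
  comoduleBraiding_leftInverse (QMat.invR_univR q V.n) (coaction_isCoaction _ V)
    (coaction_isCoaction _ V)

theorem comp_partBraidingInv (V : EHeckePair k q e) (a b : ℕ) :
    partBraiding F G V a b ∘ₗ partBraidingInv F G V a b = LinearMap.id := by
  -- Composing with the flip turns both maps into endomorphisms of `F_a(V) ⊗ G_b(V)`. This space is
  -- finite dimensional, so a one-sided inverse is two-sided.
  let τ := TensorProduct.comm k ((F.deg a).sp V) ((G.deg b).sp V)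
  have h : (partBraidingInv F G V a b ∘ₗ τ.toLinearMap) *
      (τ.symm.toLinearMap ∘ₗ partBraiding F G V a b) = 1 := by
    rw [Module.End.mul_eq_comp, LinearMap.comp_assoc, ← LinearMap.comp_assoc _ _ τ.toLinearMap,
      LinearEquiv.comp_symm, LinearMap.id_comp, partBraidingInv_comp]
    rfl
  rw [mul_eq_one_comm, Module.End.mul_eq_comp] at h
  refine LinearMap.ext fun z => ?_
  obtain ⟨w, rfl⟩ := τ.surjective z
  apply τ.symm.injective
  rw [LinearMap.id_apply, LinearEquiv.symm_apply_apply]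
  exact DFunLike.congr_fun h w

/-- The coactions on `F_a(V)` and `G_b(V)` come from universal elements, so their contraction with
`𝓡` is the image of `twist` under `G_b ⊗ F_a`. -/
theorem partBraiding_eq_eact (V : EHeckePair k q e) (a b : ℕ)
    (z : (F.deg a).sp V ⊗[k] (G.deg b).sp V) :
    partBraiding F G V a b z =
      eact (G.deg b) (F.deg a) V V (V.twist a b) (TensorProduct.comm k _ _ z) := by
  induction z using TensorProduct.induction_on with
  | zero => simp
  | add s t hs ht => simp only [map_add, hs, ht]
  | tmul x y =>
    rw [TensorProduct.comm_tmul, comoduleBraiding_tmul]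
    exact formContract_coact _ _ _ _ _ _ _

theorem comm_eact {a b : ℕ} (F : PolyFun k q e a) (G : PolyFun k q e b) (V W : EHeckePair k q e)
    (s : BHom a V W ⊗[k] BHom b V W) (z : F.sp V ⊗[k] G.sp V) :
    TensorProduct.comm k _ _ (eact F G V W s z) =
      eact G F V W (TensorProduct.comm k _ _ s) (TensorProduct.comm k _ _ z) := by
  induction s using TensorProduct.induction_on with
  | zero => simp
  | add s t hs ht => simp only [map_add, LinearMap.add_apply, hs, ht]
  | tmul f g =>
  induction z using TensorProduct.induction_on with
  | zero => simp
  | add s t hs ht => simp only [map_add, hs, ht]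
  | tmul x y => simp

/-- Naturality in `V`, the heart of the theorem: both sides are the flip followed by the action of
an element of `Hom_{B_b} ⊗ Hom_{B_a}`, and `twist_res` says that these two elements agree. -/
theorem partBraiding_eact {a b d : ℕ} (h : a + b = d) (h' : b + a = d) {V W : EHeckePair k q e}
    (f : BHom d V W) (z : (F.deg a).sp V ⊗[k] (G.deg b).sp V) :
    partBraiding F G W a b (eact (F.deg a) (G.deg b) V W (res h V W f) z) =
      eact (G.deg b) (F.deg a) V W (res h' V W f) (partBraiding F G V a b z) := by
  rw [partBraiding_eq_eact, partBraiding_eq_eact, comm_eact, ← LinearMap.comp_apply, ← eact_comp,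
    twist_res h h', eact_comp, LinearMap.comp_apply]

variable (F G)

/-- The braiding of `F` and `G` on values. -/
def braidLin (d : ℕ) (V : EHeckePair k q e) :
    ((tensor F G).deg d).sp V →ₗ[k] ((tensor G F).deg d).sp V :=
  desc fun a b h => incl G F ((Nat.add_comm b a).trans h) V ∘ₗ partBraiding F G V a b

/-- The inverse of the braiding of `F` and `G` on values. -/
def braidInvLin (d : ℕ) (V : EHeckePair k q e) :
    ((tensor G F).deg d).sp V →ₗ[k] ((tensor F G).deg d).sp V :=
  desc fun b a h => incl F G ((Nat.add_comm a b).trans h) V ∘ₗ partBraidingInv F G V a b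

/-- The braiding `R_{F, G} : F ⊗ G ≅ G ⊗ F`. -/
def braidIso : tensor F G ≅ tensor G F :=
  qiso (braidLin F G)
    (by
      intro d V W f
      refine tensor_ext' fun a b h z => ?_
      rw [LinearMap.comp_apply, LinearMap.comp_apply, tensor_act, braidLin, desc_incl, braidLin,
        desc_incl, LinearMap.comp_apply, LinearMap.comp_apply, tensor_act,
        partBraiding_eact h ((Nat.add_comm b a).trans h)])
    (braidInvLin F G)
    (by
      intro d V x
      have : braidInvLin F G d V ∘ₗ braidLin F G d V = LinearMap.id := by
        refine tensor_ext' fun a b h z => ?_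
        rw [LinearMap.comp_apply, braidLin, desc_incl, LinearMap.comp_apply, braidInvLin, desc_incl,
          LinearMap.comp_apply, ← LinearMap.comp_apply (partBraidingInv F G V a b),
          partBraidingInv_comp]
        rfl
      exact DFunLike.congr_fun this x)
    (by
      intro d V x
      have : braidLin F G d V ∘ₗ braidInvLin F G d V = LinearMap.id := by
        refine tensor_ext' fun a b h z => ?_
        -- The roles of the indices are exchanged here: `z` lies in `G_a(V) ⊗ F_b(V)`, so the
        -- braiding that occurs is that of `F_b(V)` with `G_a(V)`.
        rw [LinearMap.comp_apply, braidInvLin, desc_incl, LinearMap.comp_apply, braidLin, desc_incl,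
          LinearMap.comp_apply, ← LinearMap.comp_apply (partBraiding F G V b a),
          comp_partBraidingInv]
        rfl
      exact DFunLike.congr_fun this x)

theorem braidIso_incl {a b d : ℕ} (h : a + b = d) (h' : b + a = d) (V : EHeckePair k q e)
    (z : (F.deg a).sp V ⊗[k] (G.deg b).sp V) :
    ap (braidIso F G).hom d V (incl F G h V z) = incl G F h' V (partBraiding F G V a b z) := by
  change braidLin F G d V _ = _
  rw [braidLin, desc_incl, LinearMap.comp_apply]

variable {F G}

theorem tmap_incl' (α : F ⟶ F') (β : G ⟶ G') {a b d : ℕ} (h : a + b = d)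
    (V : EHeckePair k q e) (z : (F.deg a).sp V ⊗[k] (G.deg b).sp V) :
    ap (tmap α β) d V (incl F G h V z) =
      incl F' G' h V (TensorProduct.map (ap α a V) (ap β b V) z) := by
  rw [tmap, ap_qmk, desc_incl, LinearMap.comp_apply]

/-- Unlike a morphism of pairs, a natural transformation has colinear components at each `V` by
`coaction_app`, so naturality of the comodule braiding suffices. -/
theorem braidIso_naturality (α : F ⟶ F') (β : G ⟶ G') :
    tmap α β ≫ (braidIso F' G').hom = (braidIso F G).hom ≫ tmap β α := by
  refine qhom_ext fun d V => tensor_ext' fun a b h z => ?_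
  have h' : b + a = d := (Nat.add_comm b a).trans h
  rw [ap_comp, ap_comp, tmap_incl', braidIso_incl F G h h', tmap_incl', braidIso_incl F' G' h h']
  exact congrArg _ (comoduleBraiding_naturality _ (coaction_app (α a) V) (coaction_app (β b) V) z)

theorem braidIso_hexagon_forward :
    (assocIso F G H).hom ≫ (braidIso F (tensor G H)).hom ≫ (assocIso G H F).hom =
      tmap (braidIso F G).hom (𝟙 H) ≫ (assocIso G F H).hom ≫ tmap (𝟙 G) (braidIso F H).hom := by
  refine qhom_ext fun d V => tensor_ext_left fun a b ab c h1 h2 x y z => ?_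
  have h3 : a + (b + c) = d := by omega
  have h4 : b + c + a = d := by omega
  have h6 : b + a = ab := by omega
  have h7 : b + (a + c) = d := by omega
  -- The summand `G_b(V) ⊗ H_c(V)` is included colinearly, so the braiding of `F_a(V)` with all of
  -- `(G ⊗ H)_{b + c}(V)` restricts on it to the braiding with the tensor product comodule.
  have e1 := comoduleBraiding_naturality (QMat.univR q V.n) (φ := LinearMap.id)
    (ρ := (F.deg a).coaction V) (ρ' := (F.deg a).coaction V) (by intro y; simp)
    (coaction_incl (F := G) (G := H) (rfl : b + c = b + c) V) (x ⊗ₜ (y ⊗ₜ z))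
  rw [TensorProduct.map_tmul, LinearMap.id_apply] at e1
  rw [ap_comp, ap_comp, ap_comp, ap_comp, assocIso_incl F G H h1 h2 rfl h3,
    braidIso_incl F (tensor G H) h3 h4, tmap_incl, ap_id, braidIso_incl F G h1 h6]
  rw [e1, comoduleBraiding_tensor_right (QMat.univR_isSkewPairing q V.n) (coaction_isCoaction _ V)]
  -- The braided element is a sum of pure tensors, and everything that follows is linear in it. On
  -- pure tensors the associators only reindex the summands.
  induction partBraiding F G V a b (x ⊗ₜ y) using TensorProduct.induction_on with
  | zero => simp
  | add s t hs ht => simp only [map_add, TensorProduct.add_tmul, hs, ht]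
  | tmul y x =>
  rw [assocIso_incl G F H h6 h2 rfl h7, tmap_incl, ap_id, braidIso_incl F H rfl (Nat.add_comm c a),
    TensorProduct.assoc_tmul, LinearMap.lTensor_tmul]
  induction partBraiding F H V a c (x ⊗ₜ z) using TensorProduct.induction_on with
  | zero => simp
  | add s t hs ht => simp only [map_add, TensorProduct.tmul_add, hs, ht]
  | tmul z x =>
  rw [TensorProduct.assoc_symm_tmul, TensorProduct.map_tmul, LinearMap.id_apply,
    assocIso_incl G H F rfl h4 (Nat.add_comm c a) h7]

theorem braidIso_hexagon_reverse :
    (assocIso F G H).inv ≫ (braidIso (tensor F G) H).hom ≫ (assocIso H F G).inv =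
      tmap (𝟙 F) (braidIso G H).hom ≫ (assocIso F H G).inv ≫ tmap (braidIso F H).hom (𝟙 G) := by
  have hinv : ∀ {F G H : QPoly k q e} {a b c ab bc d : ℕ} (h1 : a + b = ab) (h2 : ab + c = d)
      (h3 : b + c = bc) (h4 : a + bc = d) (V : EHeckePair k q e) (x : (F.deg a).sp V)
      (y : (G.deg b).sp V) (z : (H.deg c).sp V),
      ap (assocIso F G H).inv d V (incl F (tensor G H) h4 V (x ⊗ₜ incl G H h3 V (y ⊗ₜ z))) =
        incl (tensor F G) H h2 V (incl F G h1 V (x ⊗ₜ y) ⊗ₜ z) :=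
    fun h1 h2 h3 h4 V x y z => assocInvLin_incl _ _ _ h1 h2 h3 h4 V x y z
  refine qhom_ext fun d V => tensor_ext_right fun a b c bc h1 h2 x y z => ?_
  have h3 : (a + b) + c = d := by omega
  have h4 : c + (a + b) = d := by omega
  have h5 : c + b = bc := by omega
  have h6 : a + c + b = d := by omega
  -- As for the first hexagon, now with the tensor product comodule `F_a(V) ⊗ G_b(V)` in the first
  -- argument of the braiding.
  have e1 := comoduleBraiding_naturality (QMat.univR q V.n)
    (coaction_incl (F := F) (G := G) (rfl : a + b = a + b) V) (ψ := LinearMap.id)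
    (σ := (H.deg c).coaction V) (σ' := (H.deg c).coaction V) (by intro y; simp)
    ((x ⊗ₜ y) ⊗ₜ z)
  rw [TensorProduct.map_tmul, LinearMap.id_apply] at e1
  rw [ap_comp, ap_comp, ap_comp, ap_comp, hinv rfl h3 h1 h2,
    braidIso_incl (tensor F G) H h3 h4, tmap_incl, ap_id, braidIso_incl G H h1 h5]
  rw [e1, comoduleBraiding_tensor_left (QMat.univR_isSkewPairing q V.n) _ _
    (coaction_isCoaction _ V)]
  induction partBraiding G H V b c (y ⊗ₜ z) using TensorProduct.induction_on with
  | zero => simp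
  | add s t hs ht => simp only [map_add, TensorProduct.tmul_add, hs, ht]
  | tmul z y =>
  rw [hinv rfl h6 h5 h2, tmap_incl, ap_id, braidIso_incl F H rfl (Nat.add_comm c a),
    TensorProduct.assoc_symm_tmul, LinearMap.rTensor_tmul]
  induction partBraiding F H V a c (x ⊗ₜ z) using TensorProduct.induction_on with
  | zero => simp
  | add s t hs ht => simp only [map_add, TensorProduct.add_tmul, hs, ht]
  | tmul z x =>
  rw [TensorProduct.assoc_tmul, TensorProduct.map_tmul, LinearMap.id_apply,
    hinv (Nat.add_comm c a) h6 rfl h4]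

/-- The braided monoidal structure on the category of quantum polynomial functors. -/
abbrev braidedCategory : BraidedCategory (QPoly k q e) where
  braiding := braidIso
  braiding_naturality_right X _ _ f := braidIso_naturality (𝟙 X) f
  braiding_naturality_left f Z := braidIso_naturality f (𝟙 Z)
  hexagon_forward _ _ _ := braidIso_hexagon_forward
  hexagon_reverse _ _ _ := braidIso_hexagon_reverse

end QPoly

end QuantumPoly

end

/-- Naturality in `F` and `G` and both hexagons are part of the structure `β`. The unit axioms need
no computation with `𝓡`: they hold in every braided monoidal category. -/
theorem theorem4p4 {k : Type*} [Field k] (q : kˣ) (e : ℕ) :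
    ∃ β : BraidedCategory (QuantumPoly.QPoly k q e),
      (∀ (F G : QuantumPoly.QPoly k q e) (V : QuantumPoly.EHeckePair k q e)
          (a b d : ℕ) (hab : a + b = d) (hba : b + a = d)
          (x : (F.deg a).sp V) (y : (G.deg b).sp V),
        QuantumPoly.QPoly.ap (β.braiding F G).hom d V
            (QuantumPoly.QPoly.incl F G hab V (x ⊗ₜ[k] y)) =
          QuantumPoly.QPoly.incl G F hba V
            (QuantumPoly.comoduleBraiding (QuantumPoly.QMat.univR q V.n)
              ((F.deg a).coaction V) ((G.deg b).coaction V) (x ⊗ₜ[k] y))) ∧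
      (∀ F : QuantumPoly.QPoly k q e,
        (β.braiding F (MonoidalCategory.tensorUnit (QuantumPoly.QPoly k q e))).hom ≫
            (MonoidalCategory.leftUnitor F).hom = (MonoidalCategory.rightUnitor F).hom ∧
        (β.braiding (MonoidalCategory.tensorUnit (QuantumPoly.QPoly k q e)) F).hom ≫
            (MonoidalCategory.rightUnitor F).hom = (MonoidalCategory.leftUnitor F).hom) := by
  refine ⟨QuantumPoly.QPoly.braidedCategory, fun F G V a b d hab hba x y =>
    QuantumPoly.QPoly.braidIso_incl F G hab hba V (x ⊗ₜ[k] y), fun F => ?_⟩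
  let _ := QuantumPoly.QPoly.braidedCategory (k := k) (q := q) (e := e)
  exact ⟨braiding_leftUnitor F, braiding_rightUnitor F⟩
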